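/- Let $d\ge 2$. A function $f$ on $\mathbb{R}^d$ is unconditional if $f(x_1,\dots,x_d)=f(|x_1|,\dots,|x_d|)$ for all $x$; an unconditional $f:\mathbb{R}^d\to[0,\infty]$ is block decreasing if its restriction to $[0,\infty)^d$ is decreasing in each variable. For $f\in L^1(\mathbb{R}^d)$ let $V(f)=\sup\{\int_{\mathbb{R}^d} f\,\operatorname{div}\phi\,dx:\ \phi\in [C^1_c(\mathbb{R}^d)]^d,\ \sup_x|\phi(x)|\le 1\}$, where $|\cdot|$ is the Euclidean norm; $BV(\mathbb{R}^d)$ is the set of $f\in L^1(\mathbb{R}^d)$ with $V(f)<\infty$, with $\|f\|_{BV}=\|f\|_{L^1}+V(f)$, and $BD(\mathbb{R}^d)$ is the cone of block decreasing functions $f:\mathbb{R}^d\to[0,\infty]$ in $BV(\mathbb{R}^d)$. Let $W^{1,1}(\mathbb{R}^d)$ be the set of $g\in L^1(\mathbb{R}^d)$ with a weak gradient $\nabla g\in L^1(\mathbb{R}^d)$, with $\|g\|_{W^{1,1}}=\|g\|_{L^1}+\int_{\mathbb{R}^d}|\nabla g|\,dx$. For a norm $\mu$ on $\mathbb{R}^d$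 and $R>0$, the local uncentered maximal function is $$M_{R,\mu}f(x)=\sup\Big\{\frac{1}{|B|}\int_{B}|f(u)|\,du:\ B=\{z:\mu(z-y)\le\delta\},\ y\in\mathbb{R}^d,\ 0<\delta\le R,\ x\in B\Big\}.$$ Write $\log^+R=\max\{\log R,0\}$. (1) For every unconditional norm $\mu$ on $\mathbb{R}^d$ there is a constant $c=c(\mu,d)>0$ such that for all $R>0$ and all $f\in BD(\mathbb{R}^d)$ we have $M_{R,\mu}f\in BV(\mathbb{R}^d)$ and $$\|M_{R,\mu}f\|_{BV(\mathbb{R}^d)}\le c\left(\|f\|_{BV(\mathbb{R}^d)}+\|f\|_{L^1(\mathbb{R}^d)}\log^+R\right).$$ (2) If $\mu=\|\cdot\|_\infty$, there is a constant $c=c(d)>0$ such that for all $R>0$ and all $f\in BD(\mathbb{R}^d)$ we have $M_{R,\infty}f:=M_{R,\mu}f\in W^{1,1}(\mathbb{R}^d)$ and $$\|M_{R,\infty}f\|_{W^{1,1}(\mathbb{R}^d)}\le c\left(\|f\|_{BV(\mathbb{R}^d)}+\|f\|_{L^1(\mathbb{R}^d)}\log^+R\right).$$ -/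

import Mathlib

open MeasureTheory

/-- A function on `ℝ^d` is unconditional if `f (x₁, …, x_d) = f (|x₁|, …, |x_d|)` for all `x`. -/
def IsUnconditional {d : ℕ} {α : Type*} (f : (Fin d → ℝ) → α) : Prop :=
  ∀ x : Fin d → ℝ, f x = f (fun i => |x i|)

/-- An unconditional function `f : ℝ^d → [0, ∞]` is block decreasing if its restriction to the
cone `[0, ∞)^d` is decreasing in each variable. -/
def IsBlockDecreasing {d : ℕ} (f : (Fin d → ℝ) → ENNReal) : Prop :=
  IsUnconditional f ∧
    ∀ x : Fin d → ℝ, (∀ j, 0 ≤ x j) →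
      ∀ (i : Fin d) (t : ℝ), x i ≤ t → f (Function.update x i t) ≤ f x

/-- A seminorm `μ` on `ℝ^d` is a norm if it vanishes only at the origin. -/
def IsNormOn {d : ℕ} (μ : Seminorm ℝ (Fin d → ℝ)) : Prop :=
  ∀ x : Fin d → ℝ, μ x = 0 → x = 0

/-- The norm `ℓ_∞` on `ℝ^d`, `‖x‖_∞ = max |x_i|` (this is Mathlib's norm of `Fin d → ℝ`). -/
noncomputable def ellInfty (d : ℕ) : Seminorm ℝ (Fin d → ℝ) :=
  normSeminorm ℝ (Fin d → ℝ)

/-- The closed `μ`-ball `{x | μ (x - y) ≤ δ}`. -/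
def muBall {d : ℕ} (μ : Seminorm ℝ (Fin d → ℝ)) (y : Fin d → ℝ) (δ : ℝ) : Set (Fin d → ℝ) :=
  {x | μ (x - y) ≤ δ}

/-- The local uncentered maximal function: the supremum of the averages of `f ≥ 0` over all closed
`μ`-balls that contain `x` and have radius `0 < δ ≤ R`. -/
noncomputable def localMaximal {d : ℕ} (R : ℝ) (μ : Seminorm ℝ (Fin d → ℝ))
    (f : (Fin d → ℝ) → ENNReal) (x : Fin d → ℝ) : ENNReal :=
  ⨆ (y : Fin d → ℝ) (δ : ℝ) (_ : 0 < δ ∧ δ ≤ R ∧ x ∈ muBall μ y δ),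
    (∫⁻ u in muBall μ y δ, f u) / volume (muBall μ y δ)

/-- The divergence `∑ i, ∂φ_i/∂x_i` of a vector field. -/
noncomputable def divergence {d : ℕ} (φ : (Fin d → ℝ) → EuclideanSpace ℝ (Fin d))
    (x : Fin d → ℝ) : ℝ :=
  ∑ i : Fin d, fderiv ℝ φ x (Pi.single i 1) i

/-- The variation of a locally integrable function on `ℝ^d`: the supremum of `∫ u div φ` over
all compactly supported `C¹` vector fields `φ` with `|φ| ≤ 1` (Euclidean length). The field
`φ = 0` is allowed, so the truncation at `0` in `ENNReal.ofReal` does not change the supremum. -/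
noncomputable def variation {d : ℕ} (u : (Fin d → ℝ) → ℝ) : ENNReal :=
  ⨆ (φ : (Fin d → ℝ) → EuclideanSpace ℝ (Fin d))
    (_ : ContDiff ℝ 1 φ ∧ HasCompactSupport φ ∧ ∀ x, ‖φ x‖ ≤ 1),
    ENNReal.ofReal (∫ x, u x * divergence φ x)

/-- The `L¹` norm of a function with values in `[0, ∞]`. -/
noncomputable def l1Norm {d : ℕ} (f : (Fin d → ℝ) → ENNReal) : ENNReal :=
  ∫⁻ x, f x

/-- `f ∈ L¹(ℝ^d)`, for a function with values in `[0, ∞]`. -/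
def MemL1 {d : ℕ} (f : (Fin d → ℝ) → ENNReal) : Prop :=
  AEMeasurable f ∧ l1Norm f < ⊤

/-- The `BV` norm `‖f‖_{L¹} + |Df|(ℝ^d)` of an `L¹` function with values in `[0, ∞]`
(such a function is finite almost everywhere, so that `toReal` changes it on a null set only). -/
noncomputable def bvNorm {d : ℕ} (f : (Fin d → ℝ) → ENNReal) : ENNReal :=
  l1Norm f + variation (fun x => (f x).toReal)

/-- `f ∈ BV(ℝ^d)`: `f` is in `L¹` and has finite variation. -/
def MemBV {d : ℕ} (f : (Fin d → ℝ) → ENNReal) : Prop :=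
  MemL1 f ∧ variation (fun x => (f x).toReal) < ⊤

/-- The cone `BD(ℝ^d)` of nonnegative block decreasing functions in `BV(ℝ^d)`. -/
def MemBD {d : ℕ} (f : (Fin d → ℝ) → ENNReal) : Prop :=
  IsBlockDecreasing f ∧ MemBV f

/-- `G` is the weak gradient of `u` on `ℝ^d`. -/
def HasWeakGradient {d : ℕ} (u : (Fin d → ℝ) → ℝ)
    (G : (Fin d → ℝ) → EuclideanSpace ℝ (Fin d)) : Prop :=
  LocallyIntegrable u ∧ LocallyIntegrable G ∧
    ∀ (i : Fin d) (φ : (Fin d → ℝ) → ℝ), ContDiff ℝ ((⊤ : ℕ∞) : WithTop ℕ∞) φ →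
      HasCompactSupport φ →
        ∫ x, u x * fderiv ℝ φ x (Pi.single i 1) = - ∫ x, G x i * φ x

/-! A block decreasing function is one that decreases in all `|x j|` together, and on this cone the
variation is equivalent to a quantity much easier to handle. In each direction `i` the function
rises up to the hyperplane `x i = 0` and falls afterwards, so its variation along the lines in that
direction is twice the integral of its one-sided trace on the hyperplane. Thus `variation` and the
sum of the `traceNorm`s control each other (`variation_le_sum_traceNorm`, `traceNorm_le_variation`).
The trace norm is monotone under pointwise domination, which the variation is not. Since the maximal
function of an absolutely antitone function is again absolutely antitone
(`absAntitone_localMaximal`), it suffices to bound its integral and its traces from above. Comparing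
balls with cubes reduces any unconditional norm to `ellInfty`.

For a cube of half-side `δ` containing `x`, let `S` be the set of coordinates with `|x j| ≤ 4 * δ`.
Centring the cube at `0` in those coordinates increases the integral; in the others the cube stays
at distance comparable to `|x j|`. So the average is at most the integral, over a cube in the
coordinates of `S`, of the dilate `g` of `f` by `1 / 4` (`average_le_boxInt`). Its scale may be
shrunk to the largest `|x j|`, `j ∈ S`. Integrating over `x` and decomposing with respect to the
scale `r` gives the integral of `dr / r` times the mass of `g` in `|u j| ≤ r`. This mass is at most
`2 * r` times a trace, which settles `r ≤ 1`, and at most the full mass, which produces the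
logarithm for `1 < r ≤ 4 * R` (`setLIntegral_boxInt_self_le`). For the trace in direction `i` one
power of `r` is lost, but both `|u i|` and another `|u l|` are at most `r`. The result is the
integral of `g / max |u i| |u l|`, which traces control without any logarithm
(`setLIntegral_boxInt_insert_le`).

For cubes the maximal function is moreover Lipschitz away from the coordinate hyperplanes: small
cubes can be replaced by larger ones there, and translating a cube only changes slabs parallel to
the hyperplanes, whose mass is bounded by traces. Evenness excludes a jump across a hyperplane, so
the distributional gradient is the pointwise one (`exists_lipschitzWith_clipNear`,
`integral_toReal_mul_fderiv_eq`). -/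

/-! ### Absolutely antitone functions -/

/-- A function is absolutely antitone if it decreases when all the coordinates increase in absolute
value. -/
def AbsAntitone {d : ℕ} (f : (Fin d → ℝ) → ENNReal) : Prop :=
  ∀ x y : Fin d → ℝ, (∀ j, |x j| ≤ |y j|) → f y ≤ f x

/-- The coordinates are changed one at a time. The relation is left general because both `≤` (for
functions) and `≥` (for norms) are needed. -/
theorem rel_of_forall_update {d : ℕ} {α : Type*} (r : α → α → Prop) [Std.Refl r] [IsTrans α r]
    (f : (Fin d → ℝ) → α)
    (h : ∀ (y : Fin d → ℝ) (i : Fin d) (s : ℝ), |s| ≤ |y i| → r (f y) (f (Function.update y i s)))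
    (x y : Fin d → ℝ) (hxy : ∀ j, |x j| ≤ |y j|) : r (f y) (f x) := by
  have key : ∀ s : Finset (Fin d), r (f y) (f (s.piecewise x y)) := by
    intro s
    induction s using Finset.induction_on with
    | empty => simpa using refl_of r (f y)
    | insert i s hi ih =>
      rw [Finset.piecewise_insert]
      refine trans_of r ih (h _ _ _ ?_)
      simpa [hi] using hxy i
  simpa using key Finset.univ

theorem absAntitone_of_update {d : ℕ} {f : (Fin d → ℝ) → ENNReal}
    (h : ∀ (y : Fin d → ℝ) (i : Fin d) (s : ℝ), |s| ≤ |y i| → f y ≤ f (Function.update y i s)) :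
    AbsAntitone f :=
  fun x y hxy => rel_of_forall_update (· ≤ ·) f h x y hxy

theorem IsBlockDecreasing.absAntitone {d : ℕ} {f : (Fin d → ℝ) → ENNReal}
    (hf : IsBlockDecreasing f) : AbsAntitone f := by
  refine absAntitone_of_update fun y i s hs => ?_
  have h := hf.2 (Function.update (fun j => |y j|) i |s|) (fun j => by
    by_cases hj : j = i
    · subst hj; simp
    · simp [hj]) i |y i| (by simpa using hs)
  rw [hf.1 y, hf.1 (Function.update y i s)]
  have e1 : (fun j => |Function.update y i s j|) = Function.update (fun j => |y j|) i |s| := by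
    ext j; by_cases hj : j = i
    · subst hj; simp
    · simp [hj]
  rw [e1]
  simpa using h

namespace AbsAntitone

variable {d : ℕ} {f : (Fin d → ℝ) → ENNReal}

theorem eq_of_abs_eq (hf : AbsAntitone f) {x y : Fin d → ℝ} (h : ∀ j, |x j| = |y j|) :
    f x = f y :=
  le_antisymm (hf _ _ fun j => (h j).ge) (hf _ _ fun j => (h j).le)

theorem comp_smul (hf : AbsAntitone f) (r : ℝ) : AbsAntitone fun x => f (r • x) := by
  intro x y h
  refine hf _ _ fun j => ?_
  simp only [Pi.smul_apply, smul_eq_mul, abs_mul]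
  exact mul_le_mul_of_nonneg_left (h j) (abs_nonneg r)

end AbsAntitone

/-! ### Borel representatives -/

/-- The lower semicontinuous envelope of an absolutely antitone function. -/
noncomputable def lscEnvelope {d : ℕ} (f : (Fin d → ℝ) → ENNReal) (x : Fin d → ℝ) : ENNReal :=
  ⨆ n : ℕ, f (fun j => |x j| + 1 / ((n : ℝ) + 1))

section Envelope

variable {d : ℕ} {f : (Fin d → ℝ) → ENNReal}

theorem lscEnvelope_le (hf : AbsAntitone f) (x : Fin d → ℝ) : lscEnvelope f x ≤ f x := by
  refine iSup_le fun n => hf _ _ fun j => ?_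
  have : (0 : ℝ) ≤ 1 / ((n : ℝ) + 1) := by positivity
  exact (le_add_of_nonneg_right this).trans (le_abs_self _)

theorem absAntitone_lscEnvelope (hf : AbsAntitone f) : AbsAntitone (lscEnvelope f) := by
  intro x y h
  refine iSup_mono fun n => hf _ _ fun j => ?_
  have : (0 : ℝ) ≤ 1 / ((n : ℝ) + 1) := by positivity
  rw [abs_of_nonneg (add_nonneg (abs_nonneg (x j)) this),
    abs_of_nonneg (add_nonneg (abs_nonneg (y j)) this)]
  linarith [h j]

theorem lowerSemicontinuous_lscEnvelope (hf : AbsAntitone f) :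
    LowerSemicontinuous (lscEnvelope f) := by
  intro x t ht
  obtain ⟨n, hn⟩ := lt_iSup_iff.1 ht
  obtain ⟨m, hm⟩ := exists_nat_one_div_lt (show (0 : ℝ) < 1 / ((n : ℝ) + 1) / 2 by positivity)
  filter_upwards [Metric.ball_mem_nhds x (show (0 : ℝ) < 1 / ((n : ℝ) + 1) / 2 by positivity)]
    with y hy
  refine lt_of_lt_of_le (lt_of_lt_of_le hn ?_) (le_iSup _ m)
  refine hf _ _ fun j => ?_
  have h1 : |y j - x j| ≤ dist y x := by
    rw [← Real.dist_eq]; exact dist_le_pi_dist y x j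
  have h2 := abs_sub_abs_le_abs_sub (y j) (x j)
  rw [Metric.mem_ball] at hy
  rw [abs_of_nonneg (add_nonneg (abs_nonneg (y j)) (by positivity)),
    abs_of_nonneg (add_nonneg (abs_nonneg (x j)) (by positivity))]
  linarith

theorem ae_forall_ne_zero (d : ℕ) : ∀ᵐ x : Fin d → ℝ, ∀ j, x j ≠ 0 := by
  rw [MeasureTheory.ae_all_iff]
  intro j
  exact Measure.ae_eval_ne (fun _ : Fin d => (volume : Measure ℝ)) j 0

/-- A dilation is a measurable embedding, so `f` may be arbitrary. -/
theorem lintegral_comp_smul {d : ℕ} (f : (Fin d → ℝ) → ENNReal) {r : ℝ} (hr : 0 < r) :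
    ∫⁻ x, f (r • x) = ENNReal.ofReal ((r ^ d)⁻¹) * ∫⁻ x, f x := by
  have e := (Homeomorph.smul (isUnit_iff_ne_zero.2 hr.ne').unit :
    (Fin d → ℝ) ≃ₜ (Fin d → ℝ)).toMeasurableEquiv.measurableEmbedding
  have h := Measure.map_addHaar_smul (volume : Measure (Fin d → ℝ)) hr.ne'
  have h2 : ∫⁻ x, f (r • x) = ∫⁻ x, f x ∂(Measure.map (r • ·) (volume : Measure (Fin d → ℝ))) :=
    (e.lintegral_map f).symm
  rw [h2, h, lintegral_smul_measure, abs_of_nonneg (by positivity)]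
  simp

/-- Off the coordinate hyperplanes the envelope dominates every dilate `f (r • x)` with `r > 1`. As
`r` tends to `1` the integrals of these dilates tend to that of `f`, so the envelope, which lies
below `f`, has the same finite integral. It is a Borel representative that is monotone at every
point. -/
theorem lscEnvelope_ae_eq (hf : AbsAntitone f) (hm : AEMeasurable f) (hi : ∫⁻ x, f x ≠ ⊤) :
    lscEnvelope f =ᵐ[volume] f := by
  have hms := (lowerSemicontinuous_lscEnvelope hf).measurable
  refine (ae_eq_of_ae_le_of_lintegral_le (Filter.Eventually.of_forall (lscEnvelope_le hf))
    (ne_top_of_le_ne_top hi (lintegral_mono (lscEnvelope_le hf))) hm ?_)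
  have h1 : ∀ r : ℝ, 1 < r → ENNReal.ofReal ((r ^ d)⁻¹) * ∫⁻ x, f x ≤ ∫⁻ x, lscEnvelope f x := by
    intro r hr
    rw [← lintegral_comp_smul f (by linarith)]
    refine lintegral_mono_ae ?_
    filter_upwards [ae_forall_ne_zero d] with x hx
    obtain ⟨ε, hε, hε'⟩ : ∃ ε : ℝ, 0 < ε ∧ ∀ j, ε ≤ (r - 1) * |x j| := by
      have : ∀ j, ∃ ε : ℝ, 0 < ε ∧ ε ≤ (r - 1) * |x j| := fun j =>
        ⟨(r - 1) * |x j|, mul_pos (by linarith) (abs_pos.2 (hx j)), le_rfl⟩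
      choose e he he' using this
      rcases isEmpty_or_nonempty (Fin d) with h | h
      · exact ⟨1, one_pos, fun j => h.elim j⟩
      · obtain ⟨j₀, hj₀⟩ := Finite.exists_min e
        exact ⟨e j₀, he j₀, fun j => (hj₀ j).trans (he' j)⟩
    obtain ⟨n, hn⟩ := exists_nat_one_div_lt hε
    refine le_trans (hf (fun j => |x j| + 1 / ((n : ℝ) + 1)) _ fun j => ?_)
      (le_iSup (fun n : ℕ => f (fun j => |x j| + 1 / ((n : ℝ) + 1))) n)
    have := hε' j
    rw [abs_of_nonneg (add_nonneg (abs_nonneg (x j)) (by positivity))]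
    simp only [Pi.smul_apply, smul_eq_mul, abs_mul, abs_of_pos (show 0 < r by linarith)]
    linarith
  have h2 : Filter.Tendsto (fun r : ℝ => ENNReal.ofReal ((r ^ d)⁻¹) * ∫⁻ x, f x)
      (nhdsWithin 1 (Set.Ioi 1)) (nhds (ENNReal.ofReal (((1 : ℝ) ^ d)⁻¹) * ∫⁻ x, f x)) := by
    refine ENNReal.Tendsto.mul_const ?_ (Or.inr hi)
    refine ENNReal.tendsto_ofReal ?_
    refine Filter.Tendsto.mono_left ?_ nhdsWithin_le_nhds
    exact ((continuous_pow d).tendsto 1).inv₀ (by simp)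
  have := le_of_tendsto h2 (Filter.eventually_of_mem self_mem_nhdsWithin fun r hr => h1 r hr)
  simpa using this

end Envelope

/-! ### Translation of integrals by reflection -/

section Reflection

variable {d : ℕ}

/-- Reflection of the `i`-th coordinate about `s / 2`. -/
def reflectAt (i : Fin d) (s : ℝ) : (Fin d → ℝ) ≃ᵐ (Fin d → ℝ) :=
  MeasurableEquiv.ofInvolutive (fun u j => if j = i then s - u j else u j)
    (fun u => by ext j; by_cases h : j = i <;> simp [h])
    (measurable_pi_iff.2 fun j => by by_cases h : j = i <;> simp [h] <;> fun_prop)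

theorem reflectAt_apply (i : Fin d) (s : ℝ) (u : Fin d → ℝ) (j : Fin d) :
    reflectAt i s u j = if j = i then s - u j else u j := rfl

theorem measurePreserving_reflectAt (i : Fin d) (s : ℝ) :
    MeasurePreserving (reflectAt i s : (Fin d → ℝ) → (Fin d → ℝ)) := by
  refine volume_preserving_pi (f := fun j t => if j = i then s - t else t) fun j => ?_
  by_cases h : j = i
  · simpa [h] using Measure.measurePreserving_sub_left (volume : Measure ℝ) s
  · simp only [h, if_false]
    exact MeasurePreserving.id (volume : Measure ℝ)

/-- The integral of an absolutely antitone function over a translate of a set that is symmetric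
and convex in each coordinate direction is absolutely antitone in the translation. -/
theorem absAntitone_setLIntegral_translate {f : (Fin d → ℝ) → ENNReal} (hf : AbsAntitone f)
    {B : Set (Fin d → ℝ)} (hBm : MeasurableSet B)
    (hB : ∀ (z : Fin d → ℝ) (i : Fin d) (s : ℝ), |s| ≤ |z i| → z ∈ B → Function.update z i s ∈ B) :
    AbsAntitone fun y => ∫⁻ u in {u | u - y ∈ B}, f u := by
  refine absAntitone_of_update fun y i s hs => ?_
  set y' := Function.update y i s with hy'
  set D : Set (Fin d → ℝ) := {u | u - y ∈ B} with hD
  set D' : Set (Fin d → ℝ) := {u | u - y' ∈ B} with hD'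
  have hDm : MeasurableSet D := (measurable_id.sub_const y) hBm
  have hDm' : MeasurableSet D' := (measurable_id.sub_const y') hBm
  have hsub : ∀ u, u - y' = Function.update (u - y) i (u i - s) := by
    intro u; ext j
    by_cases h : j = i
    · subst h; simp [hy']
    · simp [hy', h]
  have hsub' : ∀ u, u - y = Function.update (u - y') i (u i - y i) := by
    intro u; ext j
    by_cases h : j = i
    · subst h; simp
    · simp [hy', h]
  have hflip : ∀ (z : Fin d → ℝ), Function.update z i (-z i) ∈ B ↔ z ∈ B := by
    intro z
    constructor
    · intro h
      have := hB _ i (z i) (by simp) h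
      simpa using this
    · exact hB _ _ _ (by simp)
  -- Reflection in the hyperplane halfway between the centres `y` and `y'`; it exchanges the two
  -- translates.
  set ρ := reflectAt i (y i + s)
  have h1 : ∀ u, ρ u - y = Function.update (u - y') i (-((u - y') i)) := by
    intro u; ext j
    by_cases h : j = i
    · subst h; simp [ρ, reflectAt_apply, hy']; ring
    · simp [ρ, reflectAt_apply, h, hy']
  have h2 : ∀ u, ρ u - y' = Function.update (u - y) i (-((u - y) i)) := by
    intro u; ext j
    by_cases h : j = i
    · subst h; simp [ρ, reflectAt_apply, hy']; ring
    · simp [ρ, reflectAt_apply, h, hy']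
  have hpre : ρ ⁻¹' (D' \ D) = D \ D' := by
    ext u
    simp only [Set.mem_preimage, Set.mem_sdiff, hD, hD', Set.mem_ofPred_eq, h1, h2, hflip]
  -- A point of `D \ D'` is closer to `y i` than to `s` in the coordinate `i`; as `|s| ≤ |y i|`, its
  -- mirror image has smaller absolute value there.
  have hle : ∀ u ∈ D \ D', f u ≤ f (ρ u) := by
    intro u hu
    have hlt : |u i - y i| < |u i - s| := by
      by_contra! hcon
      refine hu.2 ?_
      simp only [hD', Set.mem_ofPred_eq, hsub u]
      exact hB _ _ _ (by simpa using hcon) hu.1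
    refine hf _ _ fun j => ?_
    by_cases h : j = i
    · subst h
      simp only [ρ, reflectAt_apply, if_true]
      rw [← sq_le_sq] at hs ⊢
      rw [← sq_lt_sq] at hlt
      -- The goal amounts to `(y j + s) * (2 * u j - (y j + s)) ≥ 0`. Multiplied by `(y j - s) ^ 2`,
      -- this is the product of the left sides in `a1` and `a2`.
      have a1 : 0 < (y j - s) * (2 * u j - (y j + s)) := by nlinarith
      have a2 : 0 ≤ (y j - s) * (y j + s) := by nlinarith
      have a3 : 0 ≤ (y j - s) ^ 2 * ((y j + s) * (2 * u j - (y j + s))) := by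
        have := mul_nonneg a1.le a2
        nlinarith
      have a4 : 0 < (y j - s) ^ 2 := by
        have : y j - s ≠ 0 := by rintro h0; rw [h0] at a1; simp at a1
        positivity
      have a5 := nonneg_of_mul_nonneg_right a3 a4
      nlinarith
    · simp [ρ, reflectAt_apply, h]
  have e1 := lintegral_inter_add_sdiff (μ := volume) f D hDm'
  have e2 := lintegral_inter_add_sdiff (μ := volume) f D' hDm
  rw [← e1, ← e2, Set.inter_comm D' D]
  gcongr 1
  calc ∫⁻ u in D \ D', f u ≤ ∫⁻ u in D \ D', f (ρ u) :=
        setLIntegral_mono' (hDm.diff hDm') hle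
    _ = ∫⁻ u in D' \ D, f u := by
        rw [← hpre]
        exact (measurePreserving_reflectAt i (y i + s)).setLIntegral_comp_preimage_emb
          ρ.measurableEmbedding f _

end Reflection

/-! ### Balls of an unconditional norm -/

section Ball

variable {d : ℕ} {μ : Seminorm ℝ (Fin d → ℝ)}

theorem Seminorm.continuous_pi (μ : Seminorm ℝ (Fin d → ℝ)) : Continuous μ :=
  (ConvexOn.locallyLipschitz (by simpa using μ.convexOn)).continuous

theorem measurableSet_muBall (μ : Seminorm ℝ (Fin d → ℝ)) (y : Fin d → ℝ) (δ : ℝ) :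
    MeasurableSet (muBall μ y δ) :=
  (isClosed_le (μ.continuous_pi.comp (continuous_id.sub continuous_const))
    continuous_const).measurableSet

theorem muBall_eq_preimage (μ : Seminorm ℝ (Fin d → ℝ)) (y : Fin d → ℝ) (δ : ℝ) :
    muBall μ y δ = {u | u - y ∈ muBall μ 0 δ} := by
  ext u; simp [muBall]

theorem volume_muBall (μ : Seminorm ℝ (Fin d → ℝ)) (y : Fin d → ℝ) (δ : ℝ) :
    volume (muBall μ y δ) = volume (muBall μ 0 δ) := by
  rw [muBall_eq_preimage μ y δ]
  simp only [sub_eq_add_neg]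
  exact measure_preimage_add_right volume (-y) (muBall μ 0 δ)

theorem Seminorm.update_le (hu : IsUnconditional fun x => μ x) (z : Fin d → ℝ) (i : Fin d) (s : ℝ)
    (hs : |s| ≤ |z i|) : μ (Function.update z i s) ≤ μ z := by
  have hneg : μ (Function.update z i (-z i)) = μ z := by
    have h1 := hu z
    have h2 := hu (Function.update z i (-z i))
    simp only at h1 h2
    rw [h1, h2]
    congr 1; ext j
    by_cases h : j = i
    · subst h; simp
    · simp [h]
  -- As `s` lies between `-z i` and `z i`, the updated vector is a convex combination of `z` and its
  -- mirror image, which have equal norm.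
  obtain ⟨a, b, ha, hb, hab, hs'⟩ : ∃ a b : ℝ, 0 ≤ a ∧ 0 ≤ b ∧ a + b = 1 ∧
      s = a * z i + b * (-z i) := by
    rcases eq_or_ne (z i) 0 with h0 | h0
    · refine ⟨1, 0, zero_le_one, le_rfl, by norm_num, ?_⟩
      rw [h0, abs_zero] at hs
      simp [h0, abs_nonpos_iff.1 hs]
    · have h1 : |s / z i| ≤ 1 := by rw [abs_div]; exact div_le_one_of_le₀ hs (abs_nonneg _)
      rw [abs_le] at h1
      refine ⟨(1 + s / z i) / 2, (1 - s / z i) / 2, by linarith, by linarith, by ring, ?_⟩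
      field_simp; ring
  have : Function.update z i s = a • z + b • Function.update z i (-z i) := by
    ext j
    by_cases h : j = i
    · subst h; simp [hs']
    · simp [h, ← add_mul, hab]
  rw [this]
  calc μ (a • z + b • Function.update z i (-z i))
      ≤ μ (a • z) + μ (b • Function.update z i (-z i)) := map_add_le_add _ _ _
    _ = a * μ z + b * μ z := by
        rw [map_smul_eq_mul, map_smul_eq_mul, hneg, Real.norm_of_nonneg ha, Real.norm_of_nonneg hb]
    _ = μ z := by rw [← add_mul, hab, one_mul]

theorem Seminorm.le_of_abs_le (hu : IsUnconditional fun x => μ x) (x y : Fin d → ℝ)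
    (h : ∀ j, |x j| ≤ |y j|) : μ x ≤ μ y :=
  rel_of_forall_update (· ≥ ·) μ (fun z i s hs => Seminorm.update_le hu z i s hs) x y h

/-- The sphere lies in the frontier of a convex set, since moving outwards along a ray from `y`
leaves the ball. -/
theorem volume_sphere_eq_zero (μ : Seminorm ℝ (Fin d → ℝ)) (y : Fin d → ℝ) {δ : ℝ} (hδ : 0 < δ) :
    volume {u | μ (u - y) = δ} = 0 := by
  have hconv : Convex ℝ (muBall μ y δ) := by
    have := μ.convex_closedBall y δ
    rwa [Seminorm.closedBall] at this
  refine measure_mono_null ?_ (hconv.addHaar_frontier volume)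
  intro u hu
  refine ⟨subset_closure (show μ (u - y) ≤ δ from le_of_eq hu), fun hint => ?_⟩
  have hc : Filter.Tendsto (fun t : ℝ => y + t • (u - y)) (nhds 1) (nhds u) := by
    have : Continuous fun t : ℝ => y + t • (u - y) := by fun_prop
    simpa using this.tendsto 1
  have h1 := hc.eventually (mem_interior_iff_mem_nhds.1 hint)
  have h2 : ∀ᶠ t : ℝ in nhdsWithin 1 (Set.Ioi 1), y + t • (u - y) ∈ muBall μ y δ :=
    nhdsWithin_le_nhds h1
  obtain ⟨t, ht, ht1⟩ := (h2.and self_mem_nhdsWithin).exists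
  simp only [muBall, Set.mem_ofPred_eq, add_sub_cancel_left, map_smul_eq_mul] at ht
  rw [show μ (u - y) = δ from hu, Real.norm_of_nonneg (zero_le_one.trans (le_of_lt ht1))] at ht
  have : 1 < t := ht1
  nlinarith

end Ball

/-! ### Monotonicity and semicontinuity of the maximal function -/

section Maximal

variable {d : ℕ} {μ : Seminorm ℝ (Fin d → ℝ)} {f : (Fin d → ℝ) → ENNReal}

theorem le_localMaximal {R δ : ℝ} {x y : Fin d → ℝ} (hδ : 0 < δ) (hR : δ ≤ R)
    (hx : x ∈ muBall μ y δ) :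
    (∫⁻ u in muBall μ y δ, f u) / volume (muBall μ y δ) ≤ localMaximal R μ f x :=
  le_iSup_of_le y (le_iSup_of_le δ (le_iSup_of_le ⟨hδ, hR, hx⟩ le_rfl))

theorem localMaximal_congr_ae {R : ℝ} {g : (Fin d → ℝ) → ENNReal} (h : f =ᵐ[volume] g) :
    localMaximal R μ f = localMaximal R μ g := by
  ext x
  simp only [localMaximal]
  refine iSup_congr fun y => iSup_congr fun δ => iSup_congr fun _ => ?_
  rw [lintegral_congr_ae (ae_restrict_of_ae h)]

theorem absAntitone_setLIntegral_muBall (hu : IsUnconditional fun x => μ x) (hf : AbsAntitone f)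
    (δ : ℝ) : AbsAntitone fun y => ∫⁻ u in muBall μ y δ, f u := by
  have := absAntitone_setLIntegral_translate hf (measurableSet_muBall μ 0 δ)
    (fun z i s hs hz => by
      simp only [muBall, sub_zero, Set.mem_ofPred_eq] at hz ⊢
      exact (Seminorm.update_le hu z i s hs).trans hz)
  simp only [← muBall_eq_preimage] at this
  exact this

/-- A ball around `c` containing `y` is matched by a ball of the same radius that contains `x` and
whose centre is no farther from `0` in each coordinate; moving the centre inwards only increases the
integral. -/
theorem absAntitone_localMaximal (hu : IsUnconditional fun x => μ x) (hf : AbsAntitone f) (R : ℝ) :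
    AbsAntitone (localMaximal R μ f) := by
  intro x y hxy
  refine iSup_le fun c => iSup_le fun δ => iSup_le fun h => ?_
  obtain ⟨hδ, hR, hy⟩ := h
  -- Take `c' = x j` when `|x j| ≤ |c j|`, and otherwise `|c j|` with the sign of `x j`.
  have hc : ∀ j, ∃ c' : ℝ, |c'| ≤ |c j| ∧ |x j - c'| ≤ |y j - c j| := by
    intro j
    have hj := hxy j
    have h1 := abs_abs_sub_abs_le_abs_sub (y j) (c j)
    have h1' := (abs_le.1 h1).1
    have h1'' := (abs_le.1 h1).2
    have h0 := abs_nonneg (c j)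
    rcases le_total (|c j|) (|x j|) with h | h
    · rcases le_total 0 (x j) with hx | hx
      · refine ⟨|c j|, by simp, ?_⟩
        rw [abs_of_nonneg hx] at h hj
        rw [abs_of_nonneg (by linarith)]
        linarith
      · refine ⟨-|c j|, by simp, ?_⟩
        rw [abs_of_nonpos hx] at h hj
        rw [abs_of_nonpos (by linarith)]
        linarith
    · exact ⟨x j, h, by simp⟩
  choose c' h1 h2 using hc
  have hx : x ∈ muBall μ c' δ :=
    (Seminorm.le_of_abs_le hu (x - c') (y - c) (fun j => by simpa using h2 j)).trans hy
  refine le_trans ?_ (le_localMaximal hδ hR hx)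
  rw [volume_muBall μ c, volume_muBall μ c']
  gcongr 1
  exact absAntitone_setLIntegral_muBall hu hf δ _ _ h1

theorem lowerSemicontinuous_localMaximal (μ : Seminorm ℝ (Fin d → ℝ)) (R : ℝ)
    (f : (Fin d → ℝ) → ENNReal) : LowerSemicontinuous (localMaximal R μ f) := by
  intro x t ht
  simp only [localMaximal, gt_iff_lt, lt_iSup_iff] at ht
  obtain ⟨y, δ, ⟨hδ, hR, hx⟩, ht⟩ := ht
  rw [volume_muBall] at ht
  -- Up to a null set the ball is an increasing union of concentric smaller ones, some of which may
  -- be empty. Integrals over directed unions converge without measurability of `f`.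
  have hae : (⋃ n : ℕ, muBall μ y (δ - 1 / ((n : ℝ) + 1))) =ᵐ[volume] muBall μ y δ := by
    have hu : (⋃ n : ℕ, muBall μ y (δ - 1 / ((n : ℝ) + 1))) = {u | μ (u - y) < δ} := by
      ext u
      simp only [Set.mem_iUnion, muBall, Set.mem_ofPred_eq]
      constructor
      · rintro ⟨n, hn⟩
        have : (0 : ℝ) < 1 / ((n : ℝ) + 1) := by positivity
        linarith
      · intro h
        obtain ⟨n, hn⟩ := exists_nat_one_div_lt (sub_pos.2 h)
        exact ⟨n, by linarith⟩
    rw [hu]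
    have hz := volume_sphere_eq_zero μ y hδ
    refine Filter.eventuallyEq_set.2 ?_
    filter_upwards [measure_eq_zero_iff_ae_notMem.1 hz] with u hu
    simp only [muBall, Set.mem_ofPred_eq] at hu ⊢
    exact ⟨le_of_lt, fun h => lt_of_le_of_ne h hu⟩
  have hmono : Monotone fun n : ℕ => muBall μ y (δ - 1 / ((n : ℝ) + 1)) := by
    intro m n hmn u hu
    simp only [muBall, Set.mem_ofPred_eq] at hu ⊢
    refine hu.trans ?_
    gcongr
  rw [← setLIntegral_congr hae, setLIntegral_iUnion_of_directed f (directed_of_isDirected_le hmono),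
    ENNReal.iSup_div, lt_iSup_iff] at ht
  obtain ⟨n, hn⟩ := ht
  have hc : Filter.Tendsto (fun x' => μ (x' - x)) (nhds x) (nhds 0) := by
    have : Continuous fun x' => μ (x' - x) :=
      μ.continuous_pi.comp (continuous_id.sub continuous_const)
    simpa using this.tendsto x
  filter_upwards [hc.eventually (gt_mem_nhds (show (0 : ℝ) < 1 / ((n : ℝ) + 1) by positivity))]
    with x' hx'
  -- The radius may already equal `R`, so the ball is translated rather than enlarged; it still
  -- contains the slightly smaller concentric ball.
  have hxb : x' ∈ muBall μ (y + (x' - x)) δ := by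
    simpa [muBall, show x' - (y + (x' - x)) = x - y by abel] using hx
  refine lt_of_lt_of_le (hn.trans_le ?_) (le_localMaximal hδ hR hxb)
  rw [volume_muBall μ (y + (x' - x))]
  gcongr 1
  refine lintegral_mono_set fun u hu => ?_
  simp only [muBall, Set.mem_ofPred_eq] at hu ⊢
  have := map_sub_le_add μ (u - y) (x' - x)
  rw [show u - (y + (x' - x)) = (u - y) - (x' - x) by abel]
  linarith

theorem measurable_localMaximal (μ : Seminorm ℝ (Fin d → ℝ)) (R : ℝ)
    (f : (Fin d → ℝ) → ENNReal) : Measurable (localMaximal R μ f) :=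
  (lowerSemicontinuous_localMaximal μ R f).measurable

end Maximal

/-! ### Fubini in one coordinate and exchange of coordinates -/

section Coordinate

variable {d : ℕ}

theorem lintegral_le_of_forall_lintegral_update_le (i : Fin d) {f g : (Fin d → ℝ) → ENNReal}
    (hf : Measurable f) (hg : Measurable g)
    (h : ∀ x, ∫⁻ t, f (Function.update x i t) ≤ ∫⁻ t, g (Function.update x i t)) :
    ∫⁻ x, f x ≤ ∫⁻ x, g x := by
  refine lintegral_le_of_lmarginal_le (μ := fun _ : Fin d => (volume : Measure ℝ)) {i} hf hg ?_
  rw [lmarginal_singleton, lmarginal_singleton]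
  exact h

/-- If `F` does not depend on `x i` and the integrals of `W` along the lines in the direction `i`
are at most `c`, then the integral of `W * F` is at most `c` times the integral of `F` over
a slab of thickness one. -/
theorem lintegral_mul_le_slab (i : Fin d) {W F : (Fin d → ℝ) → ENNReal} (hW : Measurable W)
    (hF : Measurable F) (hFi : ∀ x t, F (Function.update x i t) = F x) {c : ENNReal}
    (hc : ∀ x, ∫⁻ t, W (Function.update x i t) ≤ c) :
    ∫⁻ x, W x * F x ≤ c * ∫⁻ x in {x | x i ∈ Set.Ioo (0 : ℝ) 1}, F x := by
  have hs : MeasurableSet {x : Fin d → ℝ | x i ∈ Set.Ioo (0 : ℝ) 1} :=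
    measurable_pi_apply i measurableSet_Ioo
  rw [← lintegral_indicator hs, ← lintegral_const_mul c (hF.indicator hs)]
  refine lintegral_le_of_forall_lintegral_update_le i (hW.mul hF)
    ((hF.indicator hs).const_mul c) fun x => ?_
  simp only [hFi]
  rw [lintegral_mul_const _ (by fun_prop)]
  have : ∀ t, c * ({x : Fin d → ℝ | x i ∈ Set.Ioo (0 : ℝ) 1}.indicator F (Function.update x i t))
      = (Set.Ioo (0 : ℝ) 1).indicator (fun _ => c * F x) t := by
    intro t
    by_cases ht : t ∈ Set.Ioo (0 : ℝ) 1
    · rw [Set.indicator_of_mem (by simpa using ht), Set.indicator_of_mem ht, hFi]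
    · rw [Set.indicator_of_notMem (by simpa using ht), Set.indicator_of_notMem ht, mul_zero]
  simp only [this]
  rw [lintegral_indicator measurableSet_Ioo]
  simp only [lintegral_const, Measure.restrict_apply, MeasurableSet.univ, Set.univ_inter,
    Real.volume_Ioo, sub_zero, ENNReal.ofReal_one, mul_one]
  gcongr
  exact hc x

/-- Exchanging the coordinates in `S` of two vectors preserves the measure. -/
theorem lintegral_swap_coord (S : Finset (Fin d)) {F : (Fin d → ℝ) × (Fin d → ℝ) → ENNReal}
    (hF : Measurable F) :
    ∫⁻ x : Fin d → ℝ, ∫⁻ w : Fin d → ℝ, F (S.piecewise w x, S.piecewise x w) =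
      ∫⁻ x : Fin d → ℝ, ∫⁻ w : Fin d → ℝ, F (x, w) := by
  have e := volume_measurePreserving_arrowProdEquivProdArrow ℝ ℝ (Fin d)
  have hsw : MeasurePreserving
      (fun (p : Fin d → ℝ × ℝ) (j : Fin d) => if j ∈ S then (p j).swap else p j) := by
    refine volume_preserving_pi (f := fun j (t : ℝ × ℝ) => if j ∈ S then t.swap else t) fun j => ?_
    by_cases h : j ∈ S
    · simp only [h, if_true]
      exact Measure.measurePreserving_swap
    · simp only [h, if_false]
      exact MeasurePreserving.id _
  have hm : Measurable fun p : (Fin d → ℝ) × (Fin d → ℝ) =>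
      (S.piecewise p.2 p.1, S.piecewise p.1 p.2) := by
    refine Measurable.prodMk ?_ ?_ <;>
    · refine measurable_pi_iff.2 fun j => ?_
      by_cases h : j ∈ S <;> simp [h] <;> fun_prop
  rw [← lintegral_prod F hF.aemeasurable,
    ← lintegral_prod (fun p : (Fin d → ℝ) × (Fin d → ℝ) =>
      F (S.piecewise p.2 p.1, S.piecewise p.1 p.2)) (hF.comp hm).aemeasurable]
  have e2 := e.lintegral_comp (hF.comp hm)
  simp only [Function.comp_def] at e2
  have e3 := hsw.lintegral_comp (hF.comp e.measurable)
  simp only [Function.comp_def] at e3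
  rw [← Measure.volume_eq_prod, ← e.lintegral_comp hF, ← e2, ← e3]
  refine lintegral_congr fun p => ?_
  congr 1
  refine Prod.ext ?_ ?_ <;>
  · ext j
    by_cases h : j ∈ S <;> simp [h, MeasurableEquiv.arrowProdEquivProdArrow]

end Coordinate

/-! ### Traces on the coordinate hyperplanes -/

section Trace

variable {d : ℕ} {f : (Fin d → ℝ) → ENNReal}

/-- The one-sided trace of an absolutely antitone function on the hyperplane `x i = 0`, as
a function that does not depend on `x i`. -/
noncomputable def trace (f : (Fin d → ℝ) → ENNReal) (i : Fin d) (x : Fin d → ℝ) : ENNReal :=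
  ⨆ n : ℕ, f (Function.update x i (1 / ((n : ℝ) + 1)))

/-- The integral of the trace over the hyperplane `x i = 0`. -/
noncomputable def traceNorm (f : (Fin d → ℝ) → ENNReal) (i : Fin d) : ENNReal :=
  ∫⁻ x in {x : Fin d → ℝ | x i ∈ Set.Ioo (0 : ℝ) 1}, trace f i x

theorem measurable_trace (hf : Measurable f) (i : Fin d) : Measurable (trace f i) :=
  Measurable.iSup fun _ => hf.comp measurable_update_left

theorem trace_update (i : Fin d) (x : Fin d → ℝ) (t : ℝ) :
    trace f i (Function.update x i t) = trace f i x := by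
  simp [trace]

theorem measurableSet_slab (i : Fin d) {s : Set ℝ} (hs : MeasurableSet s) :
    MeasurableSet {x : Fin d → ℝ | x i ∈ s} :=
  measurable_pi_apply i hs

theorem AbsAntitone.le_trace (hf : AbsAntitone f) (i : Fin d) {x : Fin d → ℝ} (hx : x i ≠ 0) :
    f x ≤ trace f i x := by
  obtain ⟨n, hn⟩ := exists_nat_one_div_lt (abs_pos.2 hx)
  refine (hf (Function.update x i (1 / ((n : ℝ) + 1))) x fun j => ?_).trans
    (le_iSup (fun n : ℕ => f (Function.update x i (1 / ((n : ℝ) + 1)))) n)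
  by_cases h : j = i
  · subst h
    simp only [Function.update_self]
    rw [abs_of_pos (by positivity)]
    exact hn.le
  · simp [h]

/-- Off the hyperplane `f` is at most its trace, which is constant along the lines in direction `i`,
so only the line integrals of the weight matter. Slabs and cones are the weights to be used. -/
theorem lintegral_mul_le_traceNorm (hf : AbsAntitone f) (hm : Measurable f) (i : Fin d)
    {W : (Fin d → ℝ) → ENNReal} (hW : Measurable W) {c : ENNReal}
    (hc : ∀ x, ∫⁻ t, W (Function.update x i t) ≤ c) :
    ∫⁻ x, W x * f x ≤ c * traceNorm f i := by
  refine le_trans (lintegral_mono_ae ?_)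
    (lintegral_mul_le_slab i hW (measurable_trace hm i) (trace_update i) hc)
  filter_upwards [ae_forall_ne_zero d] with x hx
  gcongr
  exact hf.le_trace i (hx i)

theorem setLIntegral_slab_le (hf : AbsAntitone f) (hm : Measurable f) (i : Fin d) {s : Set ℝ}
    (hs : MeasurableSet s) :
    ∫⁻ x in {x : Fin d → ℝ | x i ∈ s}, f x ≤ volume s * traceNorm f i := by
  have := lintegral_mul_le_traceNorm hf hm i
    (W := {x : Fin d → ℝ | x i ∈ s}.indicator 1)
    (measurable_one.indicator (measurableSet_slab i hs)) (c := volume s) (fun x => by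
      rw [← lintegral_indicator_one hs]
      refine lintegral_mono fun t => le_of_eq ?_
      by_cases h : t ∈ s
      · rw [Set.indicator_of_mem h, Set.indicator_of_mem (by simpa using h)]; rfl
      · rw [Set.indicator_of_notMem h, Set.indicator_of_notMem (by simpa using h)])
  refine le_trans (le_of_eq ?_) this
  rw [← lintegral_indicator (measurableSet_slab i hs)]
  refine lintegral_congr fun x => ?_
  by_cases h : x i ∈ s <;> simp [h]

theorem setLIntegral_abs_le_le (hf : AbsAntitone f) (hm : Measurable f) (i : Fin d) (r : ℝ) :
    ∫⁻ x in {x : Fin d → ℝ | |x i| ≤ r}, f x ≤ ENNReal.ofReal (2 * r) * traceNorm f i := by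
  have := setLIntegral_slab_le hf hm i (measurableSet_Icc (a := -r) (b := r))
  rw [Real.volume_Icc, show r - -r = 2 * r by ring] at this
  simpa only [Set.mem_Icc, ← abs_le] using this

/-- The dilation maps the slab of thickness one into itself because `r ≤ 1`. The resulting constant
loses a factor `r⁻¹`, which is harmless for the fixed `r = 1 / 4`. -/
theorem traceNorm_comp_smul_le (hf : AbsAntitone f) (i : Fin d) {r : ℝ}
    (hr : 0 < r) (hr1 : r ≤ 1) :
    traceNorm (fun x => f (r • x)) i ≤ ENNReal.ofReal ((r ^ d)⁻¹) * traceNorm f i := by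
  have h1 : ∀ x, trace (fun x => f (r • x)) i x ≤ trace f i (r • x) := by
    intro x
    refine iSup_le fun n => (hf.le_trace i ?_).trans ?_
    · simp only [Pi.smul_apply, Function.update_self, smul_eq_mul]; positivity
    · rw [← Function.update_smul, trace_update]
  unfold traceNorm
  calc ∫⁻ x in {x : Fin d → ℝ | x i ∈ Set.Ioo (0 : ℝ) 1}, trace (fun x => f (r • x)) i x
      ≤ ∫⁻ x in {x : Fin d → ℝ | x i ∈ Set.Ioo (0 : ℝ) 1}, trace f i (r • x) :=
        lintegral_mono fun x => h1 x
    _ = ∫⁻ x, {x : Fin d → ℝ | x i ∈ Set.Ioo (0 : ℝ) 1}.indicator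
          (fun x => trace f i (r • x)) x :=
        (lintegral_indicator (measurableSet_slab i measurableSet_Ioo) _).symm
    _ ≤ ∫⁻ x, {x : Fin d → ℝ | x i ∈ Set.Ioo (0 : ℝ) 1}.indicator (trace f i) (r • x) := by
        refine lintegral_mono fun x => ?_
        by_cases hx : x ∈ {x : Fin d → ℝ | x i ∈ Set.Ioo (0 : ℝ) 1}
        swap
        · rw [Set.indicator_of_notMem hx]; exact zero_le
        rw [Set.indicator_of_mem hx, Set.indicator_of_mem]
        have h0 : 0 < x i := hx.1
        have h2 : x i < 1 := hx.2
        exact ⟨mul_pos hr h0, by simp only [Pi.smul_apply, smul_eq_mul]; nlinarith⟩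
    _ = _ := by
        rw [lintegral_comp_smul _ hr, lintegral_indicator (measurableSet_slab i measurableSet_Ioo)]

end Trace

/-! ### Integrals over cubes in some of the coordinates -/

section BoxIntegral

variable {d : ℕ}

/-- The unit cube `[-1, 1] ^ d`. -/
def unitCube (d : ℕ) : Set (Fin d → ℝ) := {v | ∀ j, |v j| ≤ 1}

theorem measurableSet_forall_mem (S : Finset (Fin d)) {I : Fin d → Set ℝ}
    (hI : ∀ j, MeasurableSet (I j)) : MeasurableSet {x : Fin d → ℝ | ∀ j ∈ S, x j ∈ I j} := by
  have : {x : Fin d → ℝ | ∀ j ∈ S, x j ∈ I j} = ⋂ j ∈ S, {x | x j ∈ I j} := by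
    ext; simp
  rw [this]
  exact S.measurableSet_biInter fun j _ => measurable_pi_apply j (hI j)

theorem unitCube_eq_pi (d : ℕ) : unitCube d = Set.univ.pi fun _ => Set.Icc (-1 : ℝ) 1 := by
  ext v; simp [unitCube, abs_le, Pi.le_def, forall_and]

theorem measurableSet_unitCube (d : ℕ) : MeasurableSet (unitCube d) := by
  rw [unitCube_eq_pi]
  exact MeasurableSet.univ_pi fun _ => measurableSet_Icc

theorem volume_unitCube (d : ℕ) : volume (unitCube d) = 2 ^ d := by
  rw [unitCube_eq_pi, volume_pi_pi]
  norm_num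

theorem measurable_piecewise_prod (S : Finset (Fin d)) :
    Measurable fun p : (Fin d → ℝ) × (Fin d → ℝ) => S.piecewise p.2 p.1 := by
  refine measurable_pi_iff.2 fun j => ?_
  by_cases h : j ∈ S <;> simp [h] <;> fun_prop

/-- The integral of `g` over the cube of half-side `r` in the coordinates of `S`, the other
coordinates being those of `x`, up to a normalization. -/
noncomputable def boxInt (S : Finset (Fin d)) (r : ℝ) (g : (Fin d → ℝ) → ENNReal)
    (x : Fin d → ℝ) : ENNReal :=
  ∫⁻ v in unitCube d, g (S.piecewise (r • v) x)

theorem measurable_boxInt (S : Finset (Fin d)) {g : (Fin d → ℝ) → ENNReal} (hg : Measurable g) :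
    Measurable fun p : ℝ × (Fin d → ℝ) => boxInt S p.1 g p.2 := by
  unfold boxInt
  refine Measurable.lintegral_prod_right'
    (f := fun q : (ℝ × (Fin d → ℝ)) × (Fin d → ℝ) => g (S.piecewise (q.1.1 • q.2) q.1.2)) ?_
  exact hg.comp ((measurable_piecewise_prod S).comp
    ((by fun_prop : Measurable fun q : (ℝ × (Fin d → ℝ)) × (Fin d → ℝ) => (q.1.2, q.1.1 • q.2))))

theorem boxInt_anti (S : Finset (Fin d)) {g : (Fin d → ℝ) → ENNReal} (hg : AbsAntitone g)
    {r s : ℝ} (hr : 0 ≤ r) (hrs : r ≤ s) (x : Fin d → ℝ) : boxInt S s g x ≤ boxInt S r g x := by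
  refine lintegral_mono fun v => hg _ _ fun j => ?_
  by_cases h : j ∈ S
  · simp only [h, Finset.piecewise_eq_of_mem, Pi.smul_apply, smul_eq_mul, abs_mul]
    rw [abs_of_nonneg hr, abs_of_nonneg (hr.trans hrs)]
    gcongr
  · simp [h]

/-- Exchange the coordinates in `S` between `x` and the cube variable. The `S`-coordinates of the
cube variable and the other coordinates of `x` then form one full variable for `g`; the leftover
variable ranges over a box. Its sides outside `S` have length `2 * r`, since the cube variable
carries all `d` coordinates. -/
theorem setLIntegral_boxInt_le (S : Finset (Fin d)) {g : (Fin d → ℝ) → ENNReal}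
    (hg : Measurable g) {r : ℝ} (hr : 0 < r) {I : Fin d → Set ℝ} (hI : ∀ j, MeasurableSet (I j)) :
    ∫⁻ x in {x : Fin d → ℝ | ∀ j ∈ S, x j ∈ I j}, boxInt S r g x ≤
      ENNReal.ofReal ((r ^ d)⁻¹) * (∏ j, if j ∈ S then volume (I j) else ENNReal.ofReal (2 * r)) *
        ∫⁻ u in {u : Fin d → ℝ | ∀ j ∈ S, |u j| ≤ r}, g u := by
  set E : Set (Fin d → ℝ) := {x | ∀ j ∈ S, x j ∈ I j} with hE
  set Q : Set (Fin d → ℝ) := {w | ∀ j, |w j| ≤ r} with hQ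
  set A : Set (Fin d → ℝ) := {u | ∀ j ∈ S, |u j| ≤ r} with hA
  set Z : Set (Fin d → ℝ) := Set.univ.pi fun j => if j ∈ S then I j else Set.Icc (-r) r with hZ
  have hEm : MeasurableSet E := measurableSet_forall_mem S hI
  have hAm : MeasurableSet A := by
    have := measurableSet_forall_mem S (I := fun _ => Set.Icc (-r) r) fun _ => measurableSet_Icc
    simpa only [Set.mem_Icc, ← abs_le] using this
  have hQm : MeasurableSet Q := by
    have := measurableSet_forall_mem Finset.univ (d := d) (I := fun _ => Set.Icc (-r) r)
      fun _ => measurableSet_Icc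
    simpa only [Set.mem_Icc, ← abs_le, Finset.mem_univ, forall_true_left] using this
  have hZm : MeasurableSet Z := MeasurableSet.univ_pi fun j => by
    by_cases h : j ∈ S
    · simp [h, hI j]
    · simp [h]
  have hvol : volume Z = ∏ j, if j ∈ S then volume (I j) else ENNReal.ofReal (2 * r) := by
    rw [hZ, volume_pi_pi]
    refine Finset.prod_congr rfl fun j _ => ?_
    by_cases h : j ∈ S
    · simp [h]
    · simp only [h, if_false, Real.volume_Icc]
      congr 1; ring
  have hbox : ∀ x, boxInt S r g x =
      ENNReal.ofReal ((r ^ d)⁻¹) * ∫⁻ w, Q.indicator (fun w => g (S.piecewise w x)) w := by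
    intro x
    rw [← lintegral_comp_smul _ hr, boxInt, ← lintegral_indicator (measurableSet_unitCube d)]
    refine lintegral_congr fun v => ?_
    have hiff : v ∈ unitCube d ↔ r • v ∈ Q := by
      simp only [unitCube, hQ, Set.mem_ofPred_eq, Pi.smul_apply, smul_eq_mul, abs_mul,
        abs_of_pos hr]
      exact forall_congr' fun j => (mul_le_iff_le_one_right hr).symm
    by_cases h : v ∈ unitCube d
    · rw [Set.indicator_of_mem h, Set.indicator_of_mem (hiff.1 h)]
    · rw [Set.indicator_of_notMem h, Set.indicator_of_notMem (fun h' => h (hiff.2 h'))]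
  have hF : Measurable fun p : (Fin d → ℝ) × (Fin d → ℝ) =>
      A.indicator g p.1 * Z.indicator 1 p.2 :=
    ((hg.indicator hAm).comp measurable_fst).mul
      ((measurable_one.indicator hZm).comp measurable_snd)
  calc ∫⁻ x in E, boxInt S r g x
      = ENNReal.ofReal ((r ^ d)⁻¹) *
          ∫⁻ x, ∫⁻ w, A.indicator g (S.piecewise w x) * Z.indicator 1 (S.piecewise x w) := by
        rw [← lintegral_indicator hEm, ← lintegral_const_mul' _ _ ENNReal.ofReal_ne_top]
        refine lintegral_congr fun x => ?_
        by_cases hx : x ∈ E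
        · rw [Set.indicator_of_mem hx, hbox]
          congr 1
          refine lintegral_congr fun w => ?_
          have hiff : w ∈ Q ↔ S.piecewise w x ∈ A ∧ S.piecewise x w ∈ Z := by
            simp only [hQ, hA, hZ, Set.mem_ofPred_eq, Set.mem_pi, Set.mem_univ, forall_true_left]
            constructor
            · intro h
              refine ⟨fun j hj => by simpa [hj] using h j, fun j => ?_⟩
              by_cases hj : j ∈ S
              · simpa [hj] using hx j hj
              · simpa [hj, abs_le] using h j
            · rintro ⟨h1, h2⟩ j
              by_cases hj : j ∈ S
              · simpa [hj] using h1 j hj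
              · simpa [hj, abs_le] using h2 j
          by_cases hw : w ∈ Q
          · rw [Set.indicator_of_mem hw, Set.indicator_of_mem (hiff.1 hw).1,
              Set.indicator_of_mem (hiff.1 hw).2]
            simp
          · rw [Set.indicator_of_notMem hw]
            by_cases h1 : S.piecewise w x ∈ A
            · have h2 : S.piecewise x w ∉ Z := fun h2 => hw (hiff.2 ⟨h1, h2⟩)
              rw [Set.indicator_of_notMem h2, mul_zero]
            · rw [Set.indicator_of_notMem h1, zero_mul]
        · rw [Set.indicator_of_notMem hx]
          have h2 : ∀ w, S.piecewise x w ∉ Z := by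
            intro w hw
            refine hx fun j hj => ?_
            simpa [hj] using hw j (Set.mem_univ j)
          simp [h2]
    _ = ENNReal.ofReal ((r ^ d)⁻¹) *
          ∫⁻ x : Fin d → ℝ, ∫⁻ w : Fin d → ℝ, A.indicator g x * Z.indicator 1 w := by
        rw [lintegral_swap_coord S hF]
    _ ≤ _ := by
        refine le_of_eq ?_
        rw [mul_assoc]
        congr 1
        rw [← hvol, ← lintegral_indicator hAm, ← lintegral_const_mul _ (hg.indicator hAm)]
        refine lintegral_congr fun x => ?_
        rw [lintegral_const_mul _ (measurable_one.indicator hZm), lintegral_indicator_one hZm,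
          mul_comm]

end BoxIntegral

/-! ### Averages over cubes -/

section CubeAverage

variable {d : ℕ}

theorem muBall_ellInfty (y : Fin d → ℝ) (δ : ℝ) :
    muBall (ellInfty d) y δ = Metric.closedBall y δ := by
  ext x; simp [muBall, ellInfty, dist_eq_norm]

theorem isUnconditional_ellInfty (d : ℕ) : IsUnconditional fun x => ellInfty d x := by
  intro x
  simp only [ellInfty, coe_normSeminorm]
  simp only [Pi.norm_def, Real.nnnorm_abs]

theorem setLIntegral_muBall_ellInfty (f : (Fin d → ℝ) → ENNReal) (y : Fin d → ℝ) {δ : ℝ}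
    (hδ : 0 < δ) :
    ∫⁻ u in muBall (ellInfty d) y δ, f u =
      ENNReal.ofReal (δ ^ d) * ∫⁻ v in unitCube d, f (y + δ • v) := by
  set K : (Fin d → ℝ) → ENNReal :=
    fun w => (muBall (ellInfty d) y δ).indicator f (y + w) with hK
  have h1 : ∫⁻ v in unitCube d, f (y + δ • v) = ∫⁻ v, K (δ • v) := by
    rw [← lintegral_indicator (measurableSet_unitCube d)]
    refine lintegral_congr fun v => ?_
    have hiff : v ∈ unitCube d ↔ y + δ • v ∈ muBall (ellInfty d) y δ := by
      simp only [unitCube, muBall, Set.mem_ofPred_eq, add_sub_cancel_left, ellInfty,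
        coe_normSeminorm, norm_smul, Real.norm_of_nonneg hδ.le, mul_le_iff_le_one_right hδ]
      rw [pi_norm_le_iff_of_nonneg zero_le_one]
      rfl
    simp only [hK]
    by_cases h : v ∈ unitCube d
    · rw [Set.indicator_of_mem h, Set.indicator_of_mem (hiff.1 h)]
    · rw [Set.indicator_of_notMem h, Set.indicator_of_notMem (fun h' => h (hiff.2 h'))]
  rw [h1, lintegral_comp_smul K hδ, ← mul_assoc, ← ENNReal.ofReal_mul (by positivity),
    mul_inv_cancel₀ (by positivity), ENNReal.ofReal_one, one_mul]
  rw [← lintegral_indicator (measurableSet_muBall _ _ _)]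
  exact (lintegral_add_left_eq_self _ y).symm

theorem volume_muBall_ellInfty (y : Fin d → ℝ) {δ : ℝ} (hδ : 0 < δ) :
    volume (muBall (ellInfty d) y δ) = ENNReal.ofReal (δ ^ d) * 2 ^ d := by
  have := setLIntegral_muBall_ellInfty (fun _ => 1) y hδ
  simpa [volume_unitCube] using this

theorem average_muBall_ellInfty_le (f : (Fin d → ℝ) → ENNReal) (y : Fin d → ℝ) {δ : ℝ}
    (hδ : 0 < δ) :
    (∫⁻ u in muBall (ellInfty d) y δ, f u) / volume (muBall (ellInfty d) y δ) ≤
      ∫⁻ v in unitCube d, f (y + δ • v) := by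
  rw [setLIntegral_muBall_ellInfty f y hδ, volume_muBall_ellInfty y hδ]
  refine ENNReal.div_le_of_le_mul ?_
  rw [mul_comm]
  gcongr
  refine le_mul_of_one_le_right zero_le (one_le_pow₀ (by norm_num))

/-- An average over a cube containing `x` is controlled by an integral over a cube centered at the
origin in those coordinates in which `x` is small compared with the side of the cube. -/
theorem average_le_boxInt {f : (Fin d → ℝ) → ENNReal} (hf : AbsAntitone f) {x y : Fin d → ℝ}
    {δ m : ℝ} (hδ : 0 < δ) (hx : x ∈ muBall (ellInfty d) y δ) (hm : |m| ≤ 4 * δ) :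
    (∫⁻ u in muBall (ellInfty d) y δ, f u) / volume (muBall (ellInfty d) y δ) ≤
      boxInt (Finset.univ.filter fun j => |x j| ≤ 4 * δ) m (fun z => f ((1 / 4 : ℝ) • z)) x := by
  set S := Finset.univ.filter fun j => |x j| ≤ 4 * δ with hS
  -- Centring the cube at the origin in the coordinates of `S` can only increase the integral.
  set y' : Fin d → ℝ := S.piecewise 0 y with hy'
  have h1 : ∫⁻ u in muBall (ellInfty d) y δ, f u ≤ ∫⁻ u in muBall (ellInfty d) y' δ, f u := by
    refine absAntitone_setLIntegral_muBall (isUnconditional_ellInfty d) hf δ _ _ fun j => ?_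
    by_cases h : j ∈ S <;> simp [hy', h]
  rw [volume_muBall _ y, ← volume_muBall _ y']
  refine (ENNReal.div_le_div_right h1 _).trans ((average_muBall_ellInfty_le f y' hδ).trans ?_)
  refine setLIntegral_mono' (measurableSet_unitCube d) fun v hv => hf _ _ fun j => ?_
  by_cases h : j ∈ S
  · simp only [hy', h, Finset.piecewise_eq_of_mem, Pi.smul_apply, smul_eq_mul, Pi.add_apply,
      Pi.zero_apply, zero_add, abs_mul, abs_of_pos hδ]
    rw [abs_of_pos (by norm_num : (0 : ℝ) < 1 / 4), ← mul_assoc]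
    gcongr
    linarith
  · have hj : 4 * δ < |x j| := by simpa [hS] using h
    have h2 : |x j - y j| ≤ δ := by
      have h3 : ‖x - y‖ ≤ δ := hx
      exact (norm_le_pi_norm (x - y) j).trans h3
    have h3 : |δ * v j| ≤ δ := by
      rw [abs_mul, abs_of_pos hδ]
      exact mul_le_of_le_one_right hδ.le (hv j)
    simp only [hy', h, not_false_eq_true, Finset.piecewise_eq_of_notMem, Pi.smul_apply,
      smul_eq_mul, Pi.add_apply, abs_mul]
    rw [abs_of_pos (by norm_num : (0 : ℝ) < 1 / 4)]
    -- The last two terms are at most `δ < |x j| / 4` each, so the points of the cube keep at least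
    -- half of `|x j|`.
    have h4 : |x j| ≤ |y j + δ * v j| + |x j - y j| + |δ * v j| := by
      have := abs_add_three (y j + δ * v j) (x j - y j) (-(δ * v j))
      rwa [abs_neg, show y j + δ * v j + (x j - y j) + -(δ * v j) = x j by ring] at this
    linarith [abs_nonneg (x j)]

end CubeAverage

theorem measurableSet_le_and_le {α : Type*} [MeasurableSpace α] {f g f' g' : α → ℝ}
    (hf : Measurable f) (hg : Measurable g) (hf' : Measurable f') (hg' : Measurable g') :
    MeasurableSet {a | f a ≤ g a ∧ f' a ≤ g' a} :=
  (measurableSet_le hf hg).inter (measurableSet_le hf' hg')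

/-! ### Decomposition with respect to the scale -/

section SupOn

variable {d : ℕ}

/-- The largest of the numbers `|x j|` with `j ∈ S`. -/
noncomputable def supOn (S : Finset (Fin d)) (x : Fin d → ℝ) : ℝ := ‖S.piecewise x 0‖

theorem supOn_nonneg (S : Finset (Fin d)) (x : Fin d → ℝ) : 0 ≤ supOn S x := norm_nonneg _

theorem supOn_le_iff {S : Finset (Fin d)} {x : Fin d → ℝ} {c : ℝ} (hc : 0 ≤ c) :
    supOn S x ≤ c ↔ ∀ j ∈ S, |x j| ≤ c := by
  rw [supOn, pi_norm_le_iff_of_nonneg hc]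
  refine forall_congr' fun j => ?_
  by_cases h : j ∈ S <;> simp [h, hc]

theorem abs_le_supOn {S : Finset (Fin d)} {x : Fin d → ℝ} {j : Fin d} (hj : j ∈ S) :
    |x j| ≤ supOn S x :=
  (supOn_le_iff (supOn_nonneg S x)).1 le_rfl j hj

theorem measurable_supOn (S : Finset (Fin d)) : Measurable (supOn S) := by
  refine Measurable.norm (measurable_pi_iff.2 fun j => ?_)
  by_cases h : j ∈ S <;> (simp [h]; try fun_prop)

/-- The box integral decreases with the scale, so its value at `m` is at most its average over `(m /
2, m]`, where `2 / m ≤ 2 / r`. This frees the scale from `x` and allows Fubini. -/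
theorem boxInt_le_lintegral (S : Finset (Fin d)) {g : (Fin d → ℝ) → ENNReal} (hg : AbsAntitone g)
    {m : ℝ} (hm : 0 < m) (x : Fin d → ℝ) :
    boxInt S m g x ≤ ∫⁻ r in Set.Ioi (0 : ℝ), ENNReal.ofReal (2 / r) *
      {r : ℝ | r ≤ m ∧ m ≤ 2 * r}.indicator (fun r => boxInt S r g x) r := by
  calc boxInt S m g x
      = ENNReal.ofReal (2 / m) * boxInt S m g x * volume (Set.Ioc (m / 2) m) := by
        rw [Real.volume_Ioc, mul_comm, ← mul_assoc, ← ENNReal.ofReal_mul (by linarith)]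
        rw [show (m - m / 2) * (2 / m) = 1 by field_simp; norm_num]
        simp
    _ = ∫⁻ _ in Set.Ioc (m / 2) m, ENNReal.ofReal (2 / m) * boxInt S m g x := by
        simp
    _ ≤ ∫⁻ r in Set.Ioc (m / 2) m, ENNReal.ofReal (2 / r) *
          {r : ℝ | r ≤ m ∧ m ≤ 2 * r}.indicator (fun r => boxInt S r g x) r := by
        refine setLIntegral_mono' measurableSet_Ioc fun r hr => ?_
        have hr0 : 0 < r := (by positivity : 0 < m / 2).trans hr.1
        rw [Set.indicator_of_mem (show r ∈ {r : ℝ | r ≤ m ∧ m ≤ 2 * r} from ⟨hr.2, by linarith [hr.1]⟩)]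
        gcongr
        · exact hr.2
        · exact boxInt_anti S hg hr0.le hr.2 x
    _ ≤ _ := by
        refine lintegral_mono_set fun r hr => ?_
        exact (by positivity : 0 < m / 2).trans hr.1

theorem setLIntegral_boxInt_supOn_le (S : Finset (Fin d)) {T : Finset (Fin d)} (hT : T.Nonempty)
    {g : (Fin d → ℝ) → ENNReal} (hg : AbsAntitone g) (hgm : Measurable g) (E : Set (Fin d → ℝ)) :
    ∫⁻ x in E, boxInt S (supOn T x) g x ≤ ∫⁻ r in Set.Ioi (0 : ℝ), ENNReal.ofReal (2 / r) *
      ∫⁻ x in E ∩ {x | r ≤ supOn T x ∧ supOn T x ≤ 2 * r}, boxInt S r g x := by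
  have hP : MeasurableSet {p : (Fin d → ℝ) × ℝ | p.2 ≤ supOn T p.1 ∧ supOn T p.1 ≤ 2 * p.2} := by
    have := measurable_supOn T
    exact measurableSet_le_and_le (by fun_prop) (by fun_prop) (by fun_prop) (by fun_prop)
  have hbm : Measurable fun p : (Fin d → ℝ) × ℝ => boxInt S p.2 g p.1 :=
    (measurable_boxInt S hgm).comp measurable_swap
  have hK : Measurable (Function.uncurry fun (x : Fin d → ℝ) (r : ℝ) => ENNReal.ofReal (2 / r) *
      {p : (Fin d → ℝ) × ℝ | p.2 ≤ supOn T p.1 ∧ supOn T p.1 ≤ 2 * p.2}.indicator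
        (fun p => boxInt S p.2 g p.1) (x, r)) := by
    refine Measurable.mul ?_ (hbm.indicator hP)
    exact (by fun_prop : Measurable fun p : (Fin d → ℝ) × ℝ => ENNReal.ofReal (2 / p.2))
  calc ∫⁻ x in E, boxInt S (supOn T x) g x
      ≤ ∫⁻ x in E, ∫⁻ r in Set.Ioi (0 : ℝ), ENNReal.ofReal (2 / r) *
        {p : (Fin d → ℝ) × ℝ | p.2 ≤ supOn T p.1 ∧ supOn T p.1 ≤ 2 * p.2}.indicator
          (fun p => boxInt S p.2 g p.1) (x, r) := by
        refine lintegral_mono_ae (ae_restrict_of_ae ?_)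
        filter_upwards [ae_forall_ne_zero d] with x hx
        obtain ⟨j, hj⟩ := hT
        exact boxInt_le_lintegral S hg ((abs_pos.2 (hx j)).trans_le (abs_le_supOn hj)) x
    _ = ∫⁻ r in Set.Ioi (0 : ℝ), ∫⁻ x in E, ENNReal.ofReal (2 / r) *
        {p : (Fin d → ℝ) × ℝ | p.2 ≤ supOn T p.1 ∧ supOn T p.1 ≤ 2 * p.2}.indicator
          (fun p => boxInt S p.2 g p.1) (x, r) :=
        lintegral_lintegral_swap hK.aemeasurable
    _ = _ := by
        refine lintegral_congr fun r => ?_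
        rw [lintegral_const_mul' _ _ ENNReal.ofReal_ne_top]
        congr 1
        have hm : MeasurableSet {x : Fin d → ℝ | r ≤ supOn T x ∧ supOn T x ≤ 2 * r} :=
          measurable_prodMk_right (y := r) hP
        rw [Set.inter_comm, ← Measure.restrict_restrict hm, ← lintegral_indicator hm]
        rfl

theorem lintegral_Ioc_two_div {ρ : ℝ} (hρ : 0 ≤ ρ) :
    ∫⁻ r in Set.Ioc (1 : ℝ) ρ, ENNReal.ofReal (2 / r) = 2 * ENNReal.ofReal (Real.posLog ρ) := by
  rcases le_total ρ 1 with h | h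
  · rw [Set.Ioc_eq_empty (not_lt.2 h)]
    simp [(Real.posLog_eq_zero_iff ρ).2 (abs_le.2 ⟨by linarith, h⟩)]
  · rw [← ofReal_integral_eq_lintegral_ofReal]
    · rw [← intervalIntegral.integral_of_le h]
      have hdiv : ∫ r in (1 : ℝ)..ρ, 2 / r = 2 * ∫ r in (1 : ℝ)..ρ, r⁻¹ :=
        intervalIntegral.integral_const_mul 2 fun r : ℝ => r⁻¹
      rw [hdiv, integral_inv_of_pos one_pos (by linarith), div_one, ENNReal.ofReal_mul (by norm_num),
        Real.posLog_eq_log (by rwa [abs_of_nonneg (by linarith)])]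
      simp
    · have : ContinuousOn (fun r : ℝ => 2 / r) (Set.Icc 1 ρ) :=
        continuousOn_const.div continuousOn_id fun r hr => by
          have := hr.1
          exact (zero_lt_one.trans_le this).ne'
      exact this.integrableOn_Icc.mono_set Set.Ioc_subset_Icc_self
    · filter_upwards [ae_restrict_mem measurableSet_Ioc] with r hr
      have := hr.1
      exact div_nonneg (by norm_num) (by linarith)

theorem lintegral_Ici_div_sq {a c : ℝ} (ha : 0 < a) (hc : 0 ≤ c) :
    ∫⁻ r in Set.Ici a, ENNReal.ofReal (c / r ^ 2) = ENNReal.ofReal (c / a) := by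
  have hrw : ∀ r : ℝ, c / r ^ 2 = c * r ^ (-2 : ℝ) := by
    intro r
    rw [show (-2 : ℝ) = ((-2 : ℤ) : ℝ) by norm_num, Real.rpow_intCast]
    rw [zpow_neg, div_eq_mul_inv]; rfl
  rw [setLIntegral_congr Ioi_ae_eq_Ici.symm]
  rw [← ofReal_integral_eq_lintegral_ofReal]
  · simp only [hrw]
    rw [integral_const_mul, integral_Ioi_rpow_of_lt (by norm_num) ha]
    congr 1
    norm_num
    rw [Real.rpow_neg_one, div_eq_mul_inv]
  · simp only [hrw]
    exact (integrableOn_Ioi_rpow_of_lt (by norm_num) ha).const_mul c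
  · filter_upwards with r
    positivity

theorem prod_volume_le (S : Finset (Fin d)) {r : ℝ} (hr : 0 < r) (I : Fin d → Set ℝ) (s : Finset (Fin d))
    (hI : ∀ j ∈ s, volume (I j) ≤ ENNReal.ofReal (4 * r)) :
    (∏ j ∈ s, if j ∈ S then volume (I j) else ENNReal.ofReal (2 * r)) ≤
      ENNReal.ofReal ((4 * r) ^ s.card) := by
  rw [ENNReal.ofReal_pow (by positivity), ← Finset.prod_const]
  refine Finset.prod_le_prod' fun j hj => ?_
  split_ifs
  · exact hI j hj
  · gcongr; norm_num

/-- At scale `r` the box has sides at most `4 * r`, which cancels the normalization `r ^ (-d)` up to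
`4 ^ d`. The remaining mass is bounded by `2 * r` times the trace for `r ≤ 1` and by the total mass
for `1 < r ≤ ρ`; no scale beyond `ρ` occurs. -/
theorem setLIntegral_boxInt_self_le {S : Finset (Fin d)} {j : Fin d} (hj : j ∈ S)
    {g : (Fin d → ℝ) → ENNReal} (hg : AbsAntitone g) (hgm : Measurable g) {ρ : ℝ} (hρ : 0 ≤ ρ) :
    ∫⁻ x in {x | supOn S x ≤ ρ}, boxInt S (supOn S x) g x ≤
      4 ^ d * (4 * traceNorm g j + 2 * ((∫⁻ x, g x) * ENNReal.ofReal (Real.posLog ρ))) := by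
  refine (setLIntegral_boxInt_supOn_le S ⟨j, hj⟩ hg hgm _).trans ?_
  set T := traceNorm g j
  set N := ∫⁻ x, g x
  have hin : ∀ r : ℝ, 0 < r →
      ∫⁻ x in {x | supOn S x ≤ ρ} ∩ {x | r ≤ supOn S x ∧ supOn S x ≤ 2 * r}, boxInt S r g x ≤
        4 ^ d * ∫⁻ u in {u : Fin d → ℝ | |u j| ≤ r}, g u := by
    intro r hr
    have h1 := setLIntegral_boxInt_le S hgm hr (I := fun _ => Set.Icc (-(2 * r)) (2 * r))
      fun _ => measurableSet_Icc
    refine (lintegral_mono_set ?_).trans (h1.trans ?_)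
    · intro x hx k hk
      rw [Set.mem_Icc, ← abs_le]
      exact (abs_le_supOn hk).trans hx.2.2
    · have h2 := prod_volume_le S hr (fun _ => Set.Icc (-(2 * r)) (2 * r)) Finset.univ (fun k _ => by
        rw [Real.volume_Icc]; apply le_of_eq; congr 1; ring)
      have h3 : ENNReal.ofReal ((r ^ d)⁻¹) * ENNReal.ofReal ((4 * r) ^ d) = 4 ^ d := by
        rw [← ENNReal.ofReal_mul (by positivity), mul_pow, mul_comm (4 ^ d : ℝ), ← mul_assoc,
          inv_mul_cancel₀ (by positivity), one_mul, ENNReal.ofReal_pow (by norm_num)]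
        norm_num
      rw [Finset.card_univ, Fintype.card_fin] at h2
      gcongr
      · refine le_trans ?_ h3.le
        gcongr
      · exact fun hu => hu j hj
  have hpt : ∀ r ∈ Set.Ioi (0 : ℝ), ENNReal.ofReal (2 / r) *
      ∫⁻ x in {x | supOn S x ≤ ρ} ∩ {x | r ≤ supOn S x ∧ supOn S x ≤ 2 * r}, boxInt S r g x ≤
      (Set.Ioc (0 : ℝ) 1).indicator (fun _ => 4 ^ d * (4 * T)) r +
      (Set.Ioc (1 : ℝ) ρ).indicator (fun r => ENNReal.ofReal (2 / r) * (4 ^ d * N)) r := by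
    intro r hr
    have hr0 : (0 : ℝ) < r := hr
    by_cases hr1 : r ≤ 1
    · rw [Set.indicator_of_mem (show r ∈ Set.Ioc (0 : ℝ) 1 from ⟨hr, hr1⟩)]
      refine le_add_right ?_
      refine (mul_le_mul_right ((hin r hr).trans
        (mul_le_mul_right (setLIntegral_abs_le_le hg hgm j r) _)) _).trans (le_of_eq ?_)
      calc ENNReal.ofReal (2 / r) * (4 ^ d * (ENNReal.ofReal (2 * r) * T))
          = 4 ^ d * ((ENNReal.ofReal (2 / r) * ENNReal.ofReal (2 * r)) * T) := by ring
        _ = _ := by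
            rw [← ENNReal.ofReal_mul (by positivity),
              show 2 / r * (2 * r) = 4 by field_simp; norm_num]
            norm_num
    · refine le_add_left ?_
      by_cases hr2 : r ≤ ρ
      · rw [Set.indicator_of_mem (show r ∈ Set.Ioc (1 : ℝ) ρ from ⟨not_le.1 hr1, hr2⟩)]
        gcongr
        refine (hin r hr).trans ?_
        gcongr
        exact setLIntegral_le_lintegral _ _
      · have : {x : Fin d → ℝ | supOn S x ≤ ρ} ∩ {x | r ≤ supOn S x ∧ supOn S x ≤ 2 * r} = ∅ := by
          ext x
          simp only [Set.mem_inter_iff, Set.mem_ofPred_eq, Set.mem_empty_iff_false, iff_false]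
          rintro ⟨h1, h2, -⟩
          exact hr2 (h2.trans h1)
        rw [this]
        simp
  refine (setLIntegral_mono' measurableSet_Ioi hpt).trans ?_
  refine (setLIntegral_le_lintegral _ _).trans ?_
  rw [lintegral_add_left (measurable_const.indicator measurableSet_Ioc),
    lintegral_indicator measurableSet_Ioc, lintegral_indicator measurableSet_Ioc,
    lintegral_mul_const (4 ^ d * N) (by fun_prop), lintegral_Ioc_two_div hρ]
  simp only [lintegral_const, Measure.restrict_apply, MeasurableSet.univ, Set.univ_inter,
    Real.volume_Ioc, sub_zero, ENNReal.ofReal_one, mul_one]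
  apply le_of_eq
  ring

/-- A line in direction `i` meets the cone in an interval of length `2 * |x l|`, on which the weight
is `c / |x l|`. -/
theorem lintegral_cone_mul_le (i l : Fin d) (hil : l ≠ i) {c : ℝ} (hc : 0 ≤ c)
    {g : (Fin d → ℝ) → ENNReal} (hg : AbsAntitone g) (hgm : Measurable g) :
    ∫⁻ u, {u : Fin d → ℝ | |u i| ≤ |u l|}.indicator (fun u => ENNReal.ofReal (c / |u l|)) u * g u ≤
      ENNReal.ofReal (2 * c) * traceNorm g i := by
  have hs : MeasurableSet {u : Fin d → ℝ | |u i| ≤ |u l|} :=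
    measurableSet_le (by fun_prop) (by fun_prop)
  refine lintegral_mul_le_traceNorm hg hgm i (Measurable.indicator (by fun_prop) hs) fun x => ?_
  have : ∀ t, {u : Fin d → ℝ | |u i| ≤ |u l|}.indicator (fun u => ENNReal.ofReal (c / |u l|))
      (Function.update x i t) =
      (Set.Icc (-|x l|) |x l|).indicator (fun _ => ENNReal.ofReal (c / |x l|)) t := by
    intro t
    by_cases h : |t| ≤ |x l|
    · rw [Set.indicator_of_mem (by simpa [hil] using h),
        Set.indicator_of_mem (by rwa [Set.mem_Icc, ← abs_le])]
      simp [hil]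
    · rw [Set.indicator_of_notMem (by simpa [hil] using h),
        Set.indicator_of_notMem (by rwa [Set.mem_Icc, ← abs_le])]
  simp only [this]
  rw [lintegral_indicator measurableSet_Icc]
  simp only [lintegral_const, Measure.restrict_apply, MeasurableSet.univ, Set.univ_inter,
    Real.volume_Icc]
  rw [← ENNReal.ofReal_mul (by positivity)]
  refine ENNReal.ofReal_le_ofReal ?_
  rcases eq_or_ne (x l) 0 with h | h
  · simp [h, hc]
  · have := abs_pos.2 h
    apply le_of_eq
    field_simp
    ring

/-- The side of the box in direction `i` has length one instead of `4 * r`, so the weight in the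
scale is of order `r ^ (-2)`. Its integral over `r ≥ max |u i| |u l|` converges and gives the
reciprocal of that maximum. On each of the two cones where one coordinate dominates the other, the
trace in the direction of the smaller one applies. No logarithm arises. -/
theorem setLIntegral_boxInt_insert_le {S : Finset (Fin d)} {i l : Fin d} (hi : i ∉ S) (hl : l ∈ S)
    {g : (Fin d → ℝ) → ENNReal} (hg : AbsAntitone g) (hgm : Measurable g) :
    ∫⁻ x in {x | x i ∈ Set.Ioo (0 : ℝ) 1}, boxInt (insert i S) (supOn S x) g x ≤
      4 ^ (d + 1) * (traceNorm g i + traceNorm g l) := by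
  have hli : l ≠ i := fun h => hi (h ▸ hl)
  refine (setLIntegral_boxInt_supOn_le (insert i S) ⟨l, hl⟩ hg hgm _).trans ?_
  set c : ℝ := 2 * 4 ^ d with hc
  have hc0 : 0 ≤ c := by positivity
  have hin : ∀ r ∈ Set.Ioi (0 : ℝ), ENNReal.ofReal (2 / r) *
      ∫⁻ x in {x : Fin d → ℝ | x i ∈ Set.Ioo (0 : ℝ) 1} ∩ {x | r ≤ supOn S x ∧ supOn S x ≤ 2 * r},
        boxInt (insert i S) r g x ≤
      ∫⁻ u : Fin d → ℝ, {p : ℝ × (Fin d → ℝ) | |p.2 i| ≤ p.1 ∧ |p.2 l| ≤ p.1}.indicator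
        (fun p => ENNReal.ofReal (c / p.1 ^ 2) * g p.2) (r, u) := by
    intro r hr
    have hr0 : (0 : ℝ) < r := hr
    -- The coordinate `i` runs through the unit slab of the trace norm; the others are limited by
    -- the scale.
    set I : Fin d → Set ℝ := fun j => if j = i then Set.Ioo 0 1 else Set.Icc (-(2 * r)) (2 * r)
    have h1 := setLIntegral_boxInt_le (insert i S) hgm hr0 (I := I)
      fun j => by by_cases h : j = i <;> simp [I, h]
    have h2 : (∏ j, if j ∈ insert i S then volume (I j) else ENNReal.ofReal (2 * r)) ≤
        ENNReal.ofReal ((4 * r) ^ (d - 1)) := by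
      rw [← Finset.mul_prod_erase _ _ (Finset.mem_univ i)]
      have h3 := prod_volume_le (insert i S) hr0 I (Finset.univ.erase i) (fun k hk => by
        simp only [I, Finset.ne_of_mem_erase hk, if_false]
        rw [Real.volume_Icc]; apply le_of_eq; congr 1; ring)
      rw [Finset.card_erase_of_mem (Finset.mem_univ i), Finset.card_univ, Fintype.card_fin] at h3
      refine le_trans (le_of_eq ?_) h3
      simp [I]
    have h4 : ENNReal.ofReal (2 / r) * (ENNReal.ofReal ((r ^ d)⁻¹) *
        ENNReal.ofReal ((4 * r) ^ (d - 1))) ≤ ENNReal.ofReal (c / r ^ 2) := by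
      rw [← ENNReal.ofReal_mul (by positivity), ← ENNReal.ofReal_mul (by positivity)]
      refine ENNReal.ofReal_le_ofReal ?_
      obtain ⟨n, rfl⟩ : ∃ n, d = n + 1 := ⟨d - 1, by have := i.pos; omega⟩
      rw [Nat.add_sub_cancel, hc, mul_pow]
      have : 2 / r * ((r ^ (n + 1))⁻¹ * (4 ^ n * r ^ n)) = 2 * 4 ^ n / r ^ 2 := by
        field_simp
        ring
      rw [this]
      gcongr
      · norm_num
      · omega
    have hset : MeasurableSet {u : Fin d → ℝ | |u i| ≤ r ∧ |u l| ≤ r} :=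
      measurableSet_le_and_le (by fun_prop) (by fun_prop) (by fun_prop) (by fun_prop)
    calc _ ≤ ENNReal.ofReal (2 / r) * (ENNReal.ofReal ((r ^ d)⁻¹) *
          ENNReal.ofReal ((4 * r) ^ (d - 1)) *
          ∫⁻ u in {u : Fin d → ℝ | |u i| ≤ r ∧ |u l| ≤ r}, g u) := by
          gcongr
          refine (lintegral_mono_set ?_).trans (h1.trans ?_)
          · intro x hx k hk
            by_cases hki : k = i
            · subst hki; simpa [I] using hx.1
            · simp only [I, hki, if_false]
              rw [Set.mem_Icc, ← abs_le]
              exact (abs_le_supOn (Finset.mem_of_mem_insert_of_ne hk hki)).trans hx.2.2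
          · gcongr
            exact fun hu => ⟨hu i (by simp), hu l (by simp [hl])⟩
      _ ≤ ENNReal.ofReal (c / r ^ 2) * ∫⁻ u in {u : Fin d → ℝ | |u i| ≤ r ∧ |u l| ≤ r}, g u := by
          rw [← mul_assoc]
          gcongr
      _ = _ := by
          rw [← lintegral_indicator hset,
            ← lintegral_const_mul' _ _ ENNReal.ofReal_ne_top]
          refine lintegral_congr fun u => ?_
          by_cases h : |u i| ≤ r ∧ |u l| ≤ r
          · rw [Set.indicator_of_mem (by exact h), Set.indicator_of_mem (by exact h)]
          · rw [Set.indicator_of_notMem (by exact h), Set.indicator_of_notMem (by exact h), mul_zero]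
  refine (setLIntegral_mono' measurableSet_Ioi hin).trans ?_
  have hP : MeasurableSet {p : ℝ × (Fin d → ℝ) | |p.2 i| ≤ p.1 ∧ |p.2 l| ≤ p.1} :=
    measurableSet_le_and_le (by fun_prop) (by fun_prop) (by fun_prop) (by fun_prop)
  have hK : Measurable ({p : ℝ × (Fin d → ℝ) | |p.2 i| ≤ p.1 ∧ |p.2 l| ≤ p.1}.indicator
      (fun p => ENNReal.ofReal (c / p.1 ^ 2) * g p.2)) :=
    Measurable.indicator (by fun_prop) hP
  rw [lintegral_lintegral_swap (f := fun (r : ℝ) (u : Fin d → ℝ) =>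
    {p : ℝ × (Fin d → ℝ) | |p.2 i| ≤ p.1 ∧ |p.2 l| ≤ p.1}.indicator
      (fun p => ENNReal.ofReal (c / p.1 ^ 2) * g p.2) (r, u)) hK.aemeasurable]
  have hc1 := lintegral_cone_mul_le i l hli hc0 hg hgm
  have hc2 := lintegral_cone_mul_le l i hli.symm hc0 hg hgm
  have h2c : ENNReal.ofReal (2 * c) = 4 ^ (d + 1) := by
    rw [hc, show (2 * (2 * 4 ^ d) : ℝ) = 4 ^ (d + 1) by ring, ENNReal.ofReal_pow (by norm_num)]
    norm_num
  rw [h2c] at hc1 hc2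
  rw [mul_add]
  refine le_trans ?_ (add_le_add hc1 hc2)
  rw [← lintegral_add_left]
  swap
  · refine Measurable.mul (Measurable.indicator (by fun_prop) ?_) hgm
    exact measurableSet_le (by fun_prop) (by fun_prop)
  refine lintegral_mono_ae ?_
  filter_upwards [ae_forall_ne_zero d] with u hu
  set a := max |u i| |u l| with ha
  have ha0 : 0 < a := lt_max_of_lt_left (abs_pos.2 (hu i))
  calc ∫⁻ r in Set.Ioi (0 : ℝ), {p : ℝ × (Fin d → ℝ) | |p.2 i| ≤ p.1 ∧ |p.2 l| ≤ p.1}.indicator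
        (fun p => ENNReal.ofReal (c / p.1 ^ 2) * g p.2) (r, u)
      ≤ ∫⁻ r, (Set.Ici a).indicator (fun r => ENNReal.ofReal (c / r ^ 2) * g u) r := by
        refine (setLIntegral_le_lintegral _ _).trans (lintegral_mono fun r => ?_)
        by_cases h : |u i| ≤ r ∧ |u l| ≤ r
        · rw [Set.indicator_of_mem (by exact h),
            Set.indicator_of_mem (by simpa [ha] using h)]
        · rw [Set.indicator_of_notMem (by exact h)]; exact zero_le
    _ = ENNReal.ofReal (c / a) * g u := by
        rw [lintegral_indicator measurableSet_Ici, lintegral_mul_const _ (by fun_prop),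
          lintegral_Ici_div_sq ha0 hc0]
    _ ≤ _ := by
        rcases le_total |u i| |u l| with h | h
        · refine le_add_right ?_
          rw [Set.indicator_of_mem (by exact h), ha, max_eq_right h]
        · refine le_add_left ?_
          rw [Set.indicator_of_mem (by exact h), ha, max_eq_left h]

end SupOn

/-! ### Integral and trace bounds for the cubic maximal function -/

section MaximalBounds

variable {d : ℕ} {f : (Fin d → ℝ) → ENNReal}

theorem absAntitone_quarter (hf : AbsAntitone f) : AbsAntitone fun z => f ((1 / 4 : ℝ) • z) :=
  hf.comp_smul _

theorem measurable_quarter (hm : Measurable f) : Measurable fun z => f ((1 / 4 : ℝ) • z) :=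
  hm.comp (measurable_const_smul _)

theorem quarter_pow : ENNReal.ofReal (((1 / 4 : ℝ) ^ d)⁻¹) = 4 ^ d := by
  rw [one_div, inv_pow, inv_inv, ENNReal.ofReal_pow (by norm_num)]
  norm_num

theorem lintegral_quarter (f : (Fin d → ℝ) → ENNReal) :
    ∫⁻ z, f ((1 / 4 : ℝ) • z) = 4 ^ d * ∫⁻ z, f z := by
  rw [lintegral_comp_smul f (by norm_num : (0 : ℝ) < 1 / 4), quarter_pow]

theorem traceNorm_quarter_le (hf : AbsAntitone f) (i : Fin d) :
    traceNorm (fun z => f ((1 / 4 : ℝ) • z)) i ≤ 4 ^ d * traceNorm f i := by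
  have := traceNorm_comp_smul_le hf i (by norm_num : (0 : ℝ) < 1 / 4) (by norm_num)
  rwa [quarter_pow] at this

theorem boxInt_empty (m : ℝ) (g : (Fin d → ℝ) → ENNReal) (x : Fin d → ℝ) :
    boxInt ∅ m g x = 2 ^ d * g x := by
  simp [boxInt, volume_unitCube, mul_comm]

/-- The set of small coordinates depends on the cube, so all sets `S` are summed. Shrinking the
scale from `4 * δ` to `supOn S x` makes the bound independent of the cube; `δ ≤ R` survives as the
restriction on `supOn S x`. -/
theorem localMaximal_ellInfty_le_sum (hf : AbsAntitone f) {R : ℝ} (x : Fin d → ℝ) :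
    localMaximal R (ellInfty d) f x ≤ 2 ^ d * f ((1 / 4 : ℝ) • x) +
      ∑ S : Finset (Fin d) with S.Nonempty, {x | supOn S x ≤ 4 * R}.indicator
        (fun x => boxInt S (supOn S x) (fun z => f ((1 / 4 : ℝ) • z)) x) x := by
  refine iSup_le fun y => iSup_le fun δ => iSup_le fun h => ?_
  obtain ⟨hδ, hR, hx⟩ := h
  set S := Finset.univ.filter fun j => |x j| ≤ 4 * δ with hS
  have hm : supOn S x ≤ 4 * δ :=
    (supOn_le_iff (by positivity)).2 fun j hj => (Finset.mem_filter.1 hj).2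
  have h1 := average_le_boxInt hf hδ hx (m := supOn S x)
    (by rwa [abs_of_nonneg (supOn_nonneg S x)])
  refine h1.trans ?_
  rw [← hS]
  rcases S.eq_empty_or_nonempty with h0 | h0
  · rw [h0, boxInt_empty]
    exact le_self_add
  · refine le_add_left ?_
    refine le_trans ?_ (Finset.single_le_sum (f := fun S : Finset (Fin d) =>
      {x | supOn S x ≤ 4 * R}.indicator
        (fun x => boxInt S (supOn S x) (fun z => f ((1 / 4 : ℝ) • z)) x) x)
      (fun _ _ => zero_le) (Finset.mem_filter.2 ⟨Finset.mem_univ S, h0⟩))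
    have hmem : x ∈ {x | supOn S x ≤ 4 * R} := by
      show supOn S x ≤ 4 * R
      linarith
    simp only [Set.indicator_of_mem hmem]
    exact le_rfl

theorem measurable_boxInt_supOn (S T : Finset (Fin d)) {g : (Fin d → ℝ) → ENNReal}
    (hg : Measurable g) : Measurable fun x => boxInt S (supOn T x) g x :=
  (measurable_boxInt S hg).comp ((measurable_supOn T).prodMk measurable_id)

theorem card_finset_filter_le (p : Finset (Fin d) → Prop) [DecidablePred p] :
    (((Finset.univ.filter p).card : ℕ) : ENNReal) ≤ 2 ^ d := by
  have h : (Finset.univ.filter p).card ≤ 2 ^ d := by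
    refine (Finset.card_filter_le _ _).trans ?_
    simp
  exact_mod_cast h

theorem posLog_four_mul_le (R : ℝ) :
    ENNReal.ofReal (Real.posLog (4 * R)) ≤ 3 + ENNReal.ofReal (Real.posLog R) := by
  have h1 : Real.posLog (4 * R) ≤ 3 + Real.posLog R := by
    refine Real.posLog_mul.trans ?_
    gcongr
    rw [Real.posLog_eq_log (by norm_num)]
    have := Real.log_le_sub_one_of_pos (by norm_num : (0 : ℝ) < 4)
    linarith
  refine (ENNReal.ofReal_le_ofReal h1).trans ?_
  rw [ENNReal.ofReal_add (by norm_num) Real.posLog_nonneg]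
  norm_num

theorem lintegral_localMaximal_ellInfty_le (hf : AbsAntitone f) (hm : Measurable f) {R : ℝ}
    (hR : 0 < R) :
    ∫⁻ x, localMaximal R (ellInfty d) f x ≤ 8 * 32 ^ d *
      ((∑ j, traceNorm f j) + (∫⁻ x, f x) + (∫⁻ x, f x) * ENNReal.ofReal (Real.posLog R)) := by
  set g : (Fin d → ℝ) → ENNReal := fun z => f ((1 / 4 : ℝ) • z) with hg
  have hga := absAntitone_quarter hf
  have hgm := measurable_quarter hm
  set T := ∑ j, traceNorm f j
  set N := ∫⁻ x, f x
  set L := ENNReal.ofReal (Real.posLog R)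
  have hterm : ∀ S ∈ Finset.univ.filter fun S : Finset (Fin d) => S.Nonempty,
      ∫⁻ x, {x | supOn S x ≤ 4 * R}.indicator (fun x => boxInt S (supOn S x) g x) x ≤
        4 ^ d * (4 * (4 ^ d * T) + 2 * (4 ^ d * N * (3 + L))) := by
    intro S hS
    obtain ⟨j, hj⟩ := (Finset.mem_filter.1 hS).2
    rw [lintegral_indicator (measurableSet_le (measurable_supOn S) measurable_const)]
    refine (setLIntegral_boxInt_self_le hj hga hgm (by positivity : 0 ≤ 4 * R)).trans ?_
    gcongr
    · refine (traceNorm_quarter_le hf j).trans ?_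
      gcongr
      exact Finset.single_le_sum (f := fun j => traceNorm f j) (fun _ _ => zero_le)
        (Finset.mem_univ j)
    · exact (lintegral_quarter f).le
    · exact posLog_four_mul_le R
  calc ∫⁻ x, localMaximal R (ellInfty d) f x
      ≤ ∫⁻ x, (2 ^ d * g x + ∑ S : Finset (Fin d) with S.Nonempty,
          {x | supOn S x ≤ 4 * R}.indicator (fun x => boxInt S (supOn S x) g x) x) :=
        lintegral_mono fun x => localMaximal_ellInfty_le_sum hf x
    _ = 2 ^ d * (4 ^ d * N) + ∑ S : Finset (Fin d) with S.Nonempty,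
          ∫⁻ x, {x | supOn S x ≤ 4 * R}.indicator (fun x => boxInt S (supOn S x) g x) x := by
        rw [lintegral_add_left (hgm.const_mul _), lintegral_const_mul _ hgm,
          lintegral_finsetSum, hg, lintegral_quarter]
        intro S _
        exact (measurable_boxInt_supOn S S hgm).indicator
          (measurableSet_le (measurable_supOn S) measurable_const)
    _ ≤ 2 ^ d * (4 ^ d * N) +
          2 ^ d * (4 ^ d * (4 * (4 ^ d * T) + 2 * (4 ^ d * N * (3 + L)))) := by
        gcongr
        refine (Finset.sum_le_card_nsmul _ _ _ hterm).trans ?_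
        rw [nsmul_eq_mul]
        gcongr
        exact card_finset_filter_le _
    _ ≤ 8 * 32 ^ d * (T + N + N * L) := by
        have e1 : (2 : ENNReal) ^ d * (4 ^ d * N) ≤ 32 ^ d * N := by
          rw [← mul_assoc, ← mul_pow]
          gcongr
          norm_num
        have e2 : (2 : ENNReal) ^ d * (4 ^ d * (4 * (4 ^ d * T) + 2 * (4 ^ d * N * (3 + L)))) =
            32 ^ d * (4 * T + 6 * N + 2 * (N * L)) := by
          rw [show (32 : ENNReal) = 2 * 4 * 4 by norm_num, mul_pow, mul_pow]
          ring
        rw [e2]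
        refine (add_le_add_left e1 _).trans ?_
        rw [← mul_add, mul_comm (8 : ENNReal), mul_assoc]
        gcongr
        calc N + (4 * T + 6 * N + 2 * (N * L)) = 4 * T + 7 * N + 2 * (N * L) := by ring
          _ ≤ 8 * T + 8 * N + 8 * (N * L) := by
              gcongr <;> norm_num
          _ = _ := by ring

theorem boxInt_singleton_le {g : (Fin d → ℝ) → ENNReal} (hg : AbsAntitone g) (i : Fin d) {m : ℝ}
    (hm : m ≠ 0) (x : Fin d → ℝ) : boxInt {i} m g x ≤ 2 ^ d * trace g i x := by
  calc boxInt {i} m g x ≤ ∫⁻ _ in unitCube d, trace g i x := by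
        refine lintegral_mono_ae (ae_restrict_of_ae ?_)
        filter_upwards [ae_forall_ne_zero d] with v hv
        rw [Finset.piecewise_singleton, ← trace_update i x ((m • v) i)]
        exact hg.le_trace i (by simp [hm, hv i])
    _ = _ := by simp [volume_unitCube, mul_comm]

theorem trace_localMaximal_le (hf : AbsAntitone f) (R : ℝ) (i : Fin d) {x : Fin d → ℝ}
    (hx : ∀ j, x j ≠ 0) :
    trace (localMaximal R (ellInfty d) f) i x ≤
      2 * (2 ^ d * trace (fun z => f ((1 / 4 : ℝ) • z)) i x) +
      ∑ S : Finset (Fin d) with i ∉ S ∧ S.Nonempty,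
        boxInt (insert i S) (supOn S x) (fun z => f ((1 / 4 : ℝ) • z)) x := by
  set g : (Fin d → ℝ) → ENNReal := fun z => f ((1 / 4 : ℝ) • z) with hg
  have hga := absAntitone_quarter hf
  obtain ⟨ε, hε, hεx⟩ : ∃ ε : ℝ, 0 < ε ∧ ∀ j, ε ≤ |x j| := by
    have : Nonempty (Fin d) := ⟨i⟩
    obtain ⟨j₀, hj₀⟩ := Finite.exists_min fun j => |x j|
    exact ⟨|x j₀|, abs_pos.2 (hx j₀), hj₀⟩
  refine iSup_le fun n => ?_
  -- The trace is approached from a height `s` below every `|x j|`, so that `i` belongs to `S` as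
  -- soon as `S` is nonempty.
  obtain ⟨s, hs0, hs1, hs2⟩ : ∃ s : ℝ, 0 < s ∧ s ≤ ε ∧ s ≤ 1 / ((n : ℝ) + 1) :=
    ⟨min ε (1 / ((n : ℝ) + 1)), by positivity, min_le_left _ _, min_le_right _ _⟩
  set z := Function.update x i s with hz
  refine (absAntitone_localMaximal (isUnconditional_ellInfty d) hf R z _ fun j => ?_).trans ?_
  · by_cases h : j = i
    · subst h
      simp only [hz, Function.update_self]
      rw [abs_of_pos hs0, abs_of_pos (by positivity)]
      exact hs2
    · simp [hz, h]
  refine iSup_le fun y => iSup_le fun δ => iSup_le fun h => ?_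
  obtain ⟨hδ, hR, hzb⟩ := h
  set S := Finset.univ.filter fun j => |z j| ≤ 4 * δ with hS
  have hzi : z i = s := by simp [hz]
  have hzj : ∀ j, j ≠ i → z j = x j := fun j hj => by simp [hz, hj]
  rcases S.eq_empty_or_nonempty with h0 | ⟨k, hk⟩
  · refine (average_le_boxInt hf hδ hzb (m := 0) (by simpa using hδ.le)).trans ?_
    rw [← hS, h0, boxInt_empty, two_mul, add_assoc]
    refine le_add_right ?_
    gcongr
    rw [← trace_update i x s]
    exact hga.le_trace i (by simpa [hz] using hs0.ne')
  have hiS : i ∈ S := by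
    refine Finset.mem_filter.2 ⟨Finset.mem_univ i, ?_⟩
    have hk' := (Finset.mem_filter.1 hk).2
    rw [hzi, abs_of_pos hs0]
    by_cases hki : k = i
    · rw [hki, hzi, abs_of_pos hs0] at hk'; exact hk'
    · rw [hzj k hki] at hk'
      exact hs1.trans ((hεx k).trans hk')
  have hins : insert i (S.erase i) = S := Finset.insert_erase hiS
  have hupd : ∀ m, boxInt S m g z = boxInt S m g x := by
    intro m
    refine lintegral_congr fun v => ?_
    congr 1
    ext j
    by_cases h : j ∈ S
    · simp [h]
    · have : j ≠ i := fun hji => h (hji ▸ hiS)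
      simp [h, hzj j this]
  rcases (S.erase i).eq_empty_or_nonempty with h0 | h0
  · have hSi : S = {i} := by rw [← hins, h0]; rfl
    -- With no small coordinate besides `i` the scale must remain positive: at scale `0` the
    -- function would be evaluated on the hyperplane itself, where its value may exceed the trace.
    refine (average_le_boxInt hf hδ hzb (m := δ) (by rw [abs_of_pos hδ]; linarith)).trans ?_
    rw [← hS, hupd, hSi, two_mul, add_assoc]
    exact le_add_right (boxInt_singleton_le hga i hδ.ne' x)
  · have hm : supOn (S.erase i) x ≤ 4 * δ := by
      refine (supOn_le_iff (by positivity)).2 fun j hj => ?_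
      rw [← hzj j (Finset.ne_of_mem_erase hj)]
      exact (Finset.mem_filter.1 (Finset.mem_of_mem_erase hj)).2
    refine (average_le_boxInt hf hδ hzb (m := supOn (S.erase i) x)
      (by rwa [abs_of_nonneg (supOn_nonneg _ x)])).trans ?_
    rw [← hS, hupd]
    refine le_add_left ?_
    refine le_trans (le_of_eq ?_) (Finset.single_le_sum (f := fun S : Finset (Fin d) =>
      boxInt (insert i S) (supOn S x) g x) (fun _ _ => zero_le)
      (Finset.mem_filter.2 ⟨Finset.mem_univ (S.erase i), Finset.notMem_erase i S, h0⟩))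
    simp only [hins]

theorem traceNorm_localMaximal_ellInfty_le (hf : AbsAntitone f) (hm : Measurable f) (R : ℝ)
    (i : Fin d) :
    traceNorm (localMaximal R (ellInfty d) f) i ≤ 8 * 32 ^ d * ∑ j, traceNorm f j := by
  set g : (Fin d → ℝ) → ENNReal := fun z => f ((1 / 4 : ℝ) • z) with hg
  have hga := absAntitone_quarter hf
  have hgm := measurable_quarter hm
  set T := ∑ j, traceNorm f j
  have hT : ∀ j, traceNorm g j ≤ 4 ^ d * traceNorm f j := traceNorm_quarter_le hf
  have hT1 : ∀ j, traceNorm f j ≤ T := fun j =>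
    Finset.single_le_sum (f := fun j => traceNorm f j) (fun _ _ => zero_le) (Finset.mem_univ j)
  have hterm : ∀ S ∈ Finset.univ.filter fun S : Finset (Fin d) => i ∉ S ∧ S.Nonempty,
      ∫⁻ x in {x | x i ∈ Set.Ioo (0 : ℝ) 1}, boxInt (insert i S) (supOn S x) g x ≤
        4 ^ (d + 1) * (4 ^ d * T) := by
    intro S hS
    obtain ⟨hi, l, hl⟩ := (Finset.mem_filter.1 hS).2
    refine (setLIntegral_boxInt_insert_le hi hl hga hgm).trans ?_
    gcongr
    refine (add_le_add (hT i) (hT l)).trans ?_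
    rw [← mul_add]
    gcongr
    have hil : i ≠ l := fun h => hi (h ▸ hl)
    rw [← Finset.sum_pair (f := fun j => traceNorm f j) hil]
    exact Finset.sum_le_sum_of_subset (Finset.subset_univ _)
  calc traceNorm (localMaximal R (ellInfty d) f) i
      ≤ ∫⁻ x in {x | x i ∈ Set.Ioo (0 : ℝ) 1}, (2 * (2 ^ d * trace g i x) +
          ∑ S : Finset (Fin d) with i ∉ S ∧ S.Nonempty,
            boxInt (insert i S) (supOn S x) g x) := by
        refine lintegral_mono_ae (ae_restrict_of_ae ?_)
        filter_upwards [ae_forall_ne_zero d] with x hx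
        exact trace_localMaximal_le hf R i hx
    _ = 2 * (2 ^ d * traceNorm g i) + ∑ S : Finset (Fin d) with i ∉ S ∧ S.Nonempty,
          ∫⁻ x in {x | x i ∈ Set.Ioo (0 : ℝ) 1}, boxInt (insert i S) (supOn S x) g x := by
        have htm := measurable_trace hgm i
        rw [lintegral_add_left ((htm.const_mul _).const_mul _),
          lintegral_const_mul _ (htm.const_mul _), lintegral_const_mul _ htm, lintegral_finsetSum]
        · rfl
        · intro S _
          exact measurable_boxInt_supOn _ S hgm
    _ ≤ 2 * (2 ^ d * (4 ^ d * T)) + 2 ^ d * (4 ^ (d + 1) * (4 ^ d * T)) := by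
        gcongr
        · exact (hT i).trans (mul_le_mul_right (hT1 i) _)
        · refine (Finset.sum_le_card_nsmul _ _ _ hterm).trans ?_
          rw [nsmul_eq_mul]
          gcongr
          exact card_finset_filter_le _
    _ ≤ 8 * 32 ^ d * T := by
        have e1 : 2 * ((2 : ENNReal) ^ d * (4 ^ d * T)) ≤ 2 * (32 ^ d * T) := by
          rw [← mul_assoc, ← mul_assoc, ← mul_assoc, mul_assoc 2, ← mul_pow]
          gcongr
          norm_num
        have e2 : (2 : ENNReal) ^ d * (4 ^ (d + 1) * (4 ^ d * T)) = 4 * (32 ^ d * T) := by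
          rw [show (32 : ENNReal) = 2 * 4 * 4 by norm_num, mul_pow, mul_pow]
          ring
        rw [e2]
        refine (add_le_add_left e1 _).trans ?_
        rw [← add_mul, mul_assoc]
        gcongr
        norm_num

end MaximalBounds

/-! ### The variation is bounded by the traces -/

section Variation

variable {d : ℕ} {f : (Fin d → ℝ) → ENNReal}

theorem AbsAntitone.ne_top_of_lintegral_ne_top (hf : AbsAntitone f) (hi : ∫⁻ x, f x ≠ ⊤)
    {x : Fin d → ℝ} (hx : ∀ j, x j ≠ 0) : f x ≠ ⊤ := by
  intro htop
  set B : Set (Fin d → ℝ) := Set.univ.pi fun j => Set.Icc (-|x j|) |x j| with hB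
  have hBm : MeasurableSet B := MeasurableSet.univ_pi fun _ => measurableSet_Icc
  have hvol : volume B ≠ 0 := by
    rw [hB, volume_pi_pi, Finset.prod_ne_zero_iff]
    intro j _
    have := abs_pos.2 (hx j)
    simp only [Real.volume_Icc, ne_eq, ENNReal.ofReal_eq_zero, not_le]
    linarith
  have h1 : ∫⁻ _ in B, (⊤ : ENNReal) ≤ ∫⁻ x, f x := by
    refine (setLIntegral_mono' hBm fun y hy => ?_).trans (setLIntegral_le_lintegral B f)
    rw [← htop]
    exact hf _ _ fun j => abs_le.2 (hy j (Set.mem_univ j))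
  rw [lintegral_const, Measure.restrict_apply_univ, ENNReal.top_mul hvol, top_le_iff] at h1
  exact hi h1

theorem integrable_toReal_of_lintegral_ne_top (hm : Measurable f) (hi : ∫⁻ x, f x ≠ ⊤) :
    Integrable fun x => (f x).toReal :=
  MeasureTheory.integrable_toReal_of_lintegral_ne_top hm.aemeasurable hi

theorem enorm_toReal_sub_add {a b : ENNReal} (ha : a ≠ ⊤) (hba : b ≤ a) :
    ‖a.toReal - b.toReal‖ₑ + b = a := by
  have hb := ne_top_of_le_ne_top ha hba
  have h := (ENNReal.toReal_le_toReal hb ha).2 hba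
  rw [Real.enorm_of_nonneg (sub_nonneg.2 h), ENNReal.ofReal_sub _ ENNReal.toReal_nonneg,
    ENNReal.ofReal_toReal ha, ENNReal.ofReal_toReal hb, tsub_add_cancel_of_le hba]

theorem ae_ne_top_comp_add_right (hm : Measurable f) (hi : ∫⁻ x, f x ≠ ⊤) (v : Fin d → ℝ) :
    ∀ᵐ x, f (x + v) ≠ ⊤ := by
  have h : ∫⁻ x, f (x + v) ≠ ⊤ := by rwa [lintegral_add_right_eq_self f v]
  filter_upwards [ae_lt_top (hm.comp (measurable_add_const v)) h] with x hx
  exact hx.ne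

/-- Where `b ≤ a`, the integral of the modulus of the difference is the difference of the integrals;
the additive form avoids truncated subtraction. -/
theorem setLIntegral_enorm_sub_le {a b : (Fin d → ℝ) → ENNReal} {H : Set (Fin d → ℝ)}
    (hH : MeasurableSet H) (hb : Measurable b) (ha : ∀ᵐ x, a x ≠ ⊤)
    (hba : ∀ x ∈ H, b x ≤ a x) (hbi : ∫⁻ x in H, b x ≠ ⊤) {c : ENNReal}
    (hc : ∫⁻ x in H, a x ≤ c + ∫⁻ x in H, b x) :
    ∫⁻ x in H, ‖(a x).toReal - (b x).toReal‖ₑ ≤ c := by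
  have : (∫⁻ x in H, ‖(a x).toReal - (b x).toReal‖ₑ) + ∫⁻ x in H, b x = ∫⁻ x in H, a x := by
    rw [← lintegral_add_right _ hb]
    refine lintegral_congr_ae ?_
    filter_upwards [ae_restrict_of_ae ha, ae_restrict_mem hH] with x hx hxH
    exact enorm_toReal_sub_add hx (hba x hxH)
  rw [← this] at hc
  exact (ENNReal.add_le_add_iff_right hbi).1 hc

theorem lintegral_enorm_translate_sub_le (hf : AbsAntitone f) (hm : Measurable f)
    (hi : ∫⁻ x, f x ≠ ⊤) (i : Fin d) {ε : ℝ} (hε : 0 < ε) :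
    ∫⁻ x, ‖(f (x + Pi.single i (-ε))).toReal - (f x).toReal‖ₑ ≤
      2 * ENNReal.ofReal ε * traceNorm f i := by
  set e : Fin d → ℝ := Pi.single i (-ε) with he
  have hme : Measurable fun x => f (x + e) := hm.comp (measurable_add_const e)
  -- The threshold `ε / 2` is where `|x i - ε|` and `|x i|` change order. On each side the
  -- difference has a fixed sign, and after a change of variables the two integrals differ by at
  -- most the mass of the slab `|x i| ≤ ε / 2`.
  set H : Set (Fin d → ℝ) := {x | x i ∈ Set.Ici (ε / 2)} with hH
  have hHm : MeasurableSet H := measurableSet_slab i measurableSet_Ici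
  set K : Set (Fin d → ℝ) := {x | x i ∈ Set.Ici (-(ε / 2))} with hK
  have hKm : MeasurableSet K := measurableSet_slab i measurableSet_Ici
  set B : Set (Fin d → ℝ) := {x | x i ∈ Set.Icc (-(ε / 2)) (ε / 2)} with hB
  have hslab : ∫⁻ x in B, f x ≤ ENNReal.ofReal ε * traceNorm f i := by
    have := setLIntegral_slab_le hf hm i (measurableSet_Icc (a := -(ε / 2)) (b := ε / 2))
    rwa [Real.volume_Icc, show ε / 2 - -(ε / 2) = ε by ring] at this
  have hxe : ∀ x : Fin d → ℝ, (x + e) i = x i - ε := fun x => by simp [he, sub_eq_add_neg]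
  have hxj : ∀ (x : Fin d → ℝ) j, j ≠ i → (x + e) j = x j := fun x j hj => by simp [he, hj]
  have hfin : ∀ s : Set (Fin d → ℝ), ∫⁻ x in s, f x ≠ ⊤ := fun s =>
    ne_top_of_le_ne_top hi (setLIntegral_le_lintegral s f)
  have htr : ∀ s t : Set (Fin d → ℝ), MeasurableSet s → MeasurableSet t →
      (∀ x, x ∈ s ↔ x + e ∈ t) → ∫⁻ x in s, f (x + e) = ∫⁻ x in t, f x := by
    intro s t hs ht hst
    rw [← lintegral_indicator hs, ← lintegral_indicator ht,
      ← lintegral_add_right_eq_self (t.indicator f) e]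
    refine lintegral_congr fun x => ?_
    by_cases h : x ∈ s
    · rw [Set.indicator_of_mem h, Set.indicator_of_mem ((hst x).1 h)]
    · rw [Set.indicator_of_notMem h, Set.indicator_of_notMem (fun h' => h ((hst x).2 h'))]
  have hHK : ∀ x, x ∈ H ↔ x + e ∈ K := by
    intro x
    change ε / 2 ≤ x i ↔ -(ε / 2) ≤ (x + e) i
    rw [hxe]
    constructor <;> intro h <;> linarith
  have h1 : ∫⁻ x in H, ‖(f (x + e)).toReal - (f x).toReal‖ₑ ≤ ENNReal.ofReal ε * traceNorm f i := by
    refine setLIntegral_enorm_sub_le hHm hm (ae_ne_top_comp_add_right hm hi e) ?_ (hfin H) ?_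
    · intro x hx
      refine hf _ _ fun j => ?_
      by_cases h : j = i
      · have hx' : ε / 2 ≤ x i := hx
        subst h
        rw [hxe, abs_le, abs_of_nonneg (by linarith)]
        constructor <;> linarith
      · rw [hxj x j h]
    · rw [htr H K hHm hKm hHK]
      refine (lintegral_mono_set ?_).trans ((lintegral_union_le f B H).trans
        (add_le_add_left hslab _))
      intro x hx
      have hx' : -(ε / 2) ≤ x i := hx
      rcases le_total (x i) (ε / 2) with h | h
      · exact Or.inl ⟨hx', h⟩
      · exact Or.inr h
  have h2 : ∫⁻ x in Hᶜ, ‖(f (x + e)).toReal - (f x).toReal‖ₑ ≤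
      ENNReal.ofReal ε * traceNorm f i := by
    have hHK' : ∀ x, x ∈ Hᶜ ↔ x + e ∈ Kᶜ := fun x => not_congr (hHK x)
    have e1 := htr Hᶜ Kᶜ hHm.compl hKm.compl hHK'
    rw [lintegral_congr fun x => enorm_sub_rev (f (x + e)).toReal (f x).toReal]
    refine setLIntegral_enorm_sub_le hHm.compl hme ?_ ?_ (by rw [e1]; exact hfin _) ?_
    · filter_upwards [ae_lt_top hm hi] with x hx using hx.ne
    · intro x hx
      refine hf _ _ fun j => ?_
      by_cases h : j = i
      · have hx' : x i < ε / 2 := not_le.1 hx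
        subst h
        rw [hxe, abs_le, abs_of_neg (by linarith : x j - ε < 0)]
        constructor <;> linarith
      · rw [hxj x j h]
    · rw [e1]
      refine (lintegral_mono_set ?_).trans ((lintegral_union_le f B Kᶜ).trans
        (add_le_add_left hslab _))
      intro x hx
      have hx' : x i < ε / 2 := not_le.1 hx
      by_cases h : -(ε / 2) ≤ x i
      · exact Or.inl ⟨h, hx'.le⟩
      · exact Or.inr h
  rw [← lintegral_add_compl _ hHm]
  refine (add_le_add h1 h2).trans (le_of_eq ?_)
  ring

/-- The difference quotient of `ψ` is moved to `f` by a translation, where the bound is uniform in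
the step. -/
theorem ofReal_integral_mul_lineDeriv_le (hf : AbsAntitone f) (hm : Measurable f)
    (hi : ∫⁻ x, f x ≠ ⊤) (i : Fin d) {ψ : (Fin d → ℝ) → ℝ} {C : NNReal} (hψ : LipschitzWith C ψ)
    (hψ1 : ∀ x, |ψ x| ≤ 1) :
    ENNReal.ofReal (∫ x, (f x).toReal * lineDeriv ℝ ψ x (Pi.single i 1)) ≤
      2 * traceNorm f i := by
  have hv := integrable_toReal_of_lintegral_ne_top hm hi
  have hlim := hψ.integral_inv_smul_sub_mul_tendsto_integral_lineDeriv_mul (μ := volume) hv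
    (Pi.single i 1)
  simp only [mul_comm (lineDeriv ℝ ψ _ _)] at hlim
  refine le_of_tendsto (ENNReal.tendsto_ofReal hlim) ?_
  filter_upwards [self_mem_nhdsWithin] with t (ht : 0 < t)
  have hψb : ∀ x, ‖ψ x‖ ≤ 1 := hψ1
  have hψm : AEStronglyMeasurable ψ (volume : Measure (Fin d → ℝ)) :=
    hψ.continuous.aestronglyMeasurable
  have hte : -(t • Pi.single i (1 : ℝ)) = (Pi.single i (-t) : Fin d → ℝ) := by
    rw [← Pi.single_smul, ← Pi.single_neg]; simp
  have hv' : Integrable fun x : Fin d → ℝ => (f (x + Pi.single i (-t))).toReal := hv.comp_add_right _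
  have e1 : ∫ x, (t⁻¹ • (ψ (x + t • Pi.single i 1) - ψ x)) * (f x).toReal =
      t⁻¹ * ∫ x, ((f (x + Pi.single i (-t))).toReal - (f x).toReal) * ψ x := by
    have h1 : Integrable fun x => ψ (x + t • Pi.single i 1) * (f x).toReal :=
      hv.bdd_mul (c := 1) (hψ.continuous.comp (continuous_add_const _)).aestronglyMeasurable
        (Filter.Eventually.of_forall fun x => hψb _)
    have h2 : Integrable fun x => ψ x * (f x).toReal :=
      hv.bdd_mul (c := 1) hψm (Filter.Eventually.of_forall hψb)
    have h3 : Integrable fun x => ψ x * (f (x + Pi.single i (-t))).toReal :=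
      hv'.bdd_mul (c := 1) hψm (Filter.Eventually.of_forall hψb)
    have h4 : ∫ x, ψ (x + t • Pi.single i 1) * (f x).toReal =
        ∫ x, ψ x * (f (x + Pi.single i (-t))).toReal := by
      have h := integral_add_right_eq_self (μ := volume)
        (fun x => ψ (x + t • Pi.single i 1) * (f x).toReal) (Pi.single i (-t))
      rw [← h, ← hte]
      simp
    simp only [smul_eq_mul, mul_assoc, integral_const_mul]
    congr 1
    simp only [sub_mul, mul_sub, mul_comm _ (ψ _)]
    rw [integral_sub h1 h2, integral_sub h3 h2, h4]
  rw [e1, ENNReal.ofReal_mul (by positivity)]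
  have h5 : ENNReal.ofReal (∫ x, ((f (x + Pi.single i (-t))).toReal - (f x).toReal) * ψ x) ≤
      2 * ENNReal.ofReal t * traceNorm f i := by
    refine le_trans ?_ (lintegral_enorm_translate_sub_le hf hm hi i ht)
    refine (ENNReal.ofReal_le_ofReal (Real.le_norm_self _)).trans ?_
    rw [ofReal_norm]
    refine (enorm_integral_le_lintegral_enorm _).trans (lintegral_mono fun x => ?_)
    rw [enorm_mul]
    refine mul_le_of_le_one_right zero_le ?_
    rw [← ofReal_norm]
    exact ENNReal.ofReal_le_one.2 (hψb x)
  refine (mul_le_mul_right h5 _).trans (le_of_eq ?_)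
  have : ENNReal.ofReal t⁻¹ * ENNReal.ofReal t = 1 := by
    rw [← ENNReal.ofReal_mul (by positivity), inv_mul_cancel₀ ht.ne', ENNReal.ofReal_one]
  calc ENNReal.ofReal t⁻¹ * (2 * ENNReal.ofReal t * traceNorm f i)
      = (ENNReal.ofReal t⁻¹ * ENNReal.ofReal t) * (2 * traceNorm f i) := by ring
    _ = _ := by rw [this, one_mul]

theorem variation_le_sum_traceNorm (hf : AbsAntitone f) (hm : Measurable f)
    (hi : ∫⁻ x, f x ≠ ⊤) :
    variation (fun x => (f x).toReal) ≤ 2 * ∑ i, traceNorm f i := by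
  refine iSup_le fun φ => iSup_le fun hφ => ?_
  obtain ⟨hφ1, hφ2, hφ3⟩ := hφ
  have hdiff : Differentiable ℝ φ := hφ1.differentiable (by norm_num)
  have hcomp : ∀ i, ContDiff ℝ 1 fun x => φ x i := fun i =>
    (EuclideanSpace.proj (𝕜 := ℝ) i).contDiff.comp hφ1
  have hcs : ∀ i, HasCompactSupport fun x => φ x i := fun i =>
    hφ2.comp_left (g := fun y : EuclideanSpace ℝ (Fin d) => y i) rfl
  have hld : ∀ i x, fderiv ℝ φ x (Pi.single i 1) i =
      lineDeriv ℝ (fun x => φ x i) x (Pi.single i 1) := by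
    intro i x
    have h1 : HasFDerivAt (fun x => φ x i)
        ((EuclideanSpace.proj (𝕜 := ℝ) i).comp (fderiv ℝ φ x)) x :=
      (EuclideanSpace.proj (𝕜 := ℝ) i).hasFDerivAt.comp x
        (hdiff x).hasFDerivAt
    rw [h1.differentiableAt.lineDeriv_eq_fderiv, h1.fderiv]
    rfl
  have hv := integrable_toReal_of_lintegral_ne_top hm hi
  have hint : ∀ i, Integrable fun x => (f x).toReal *
      lineDeriv ℝ (fun x => φ x i) x (Pi.single i 1) := by
    intro i
    obtain ⟨C, hC⟩ := (hcomp i).lipschitzWith_of_hasCompactSupport (hcs i) (by norm_num)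
    refine hv.mul_bdd (c := C * ‖(Pi.single i 1 : Fin d → ℝ)‖) ?_
      (Filter.Eventually.of_forall fun x => norm_lineDeriv_le_of_lipschitz ℝ hC)
    exact (measurable_lineDeriv hC.continuous).aestronglyMeasurable
  simp only [divergence, hld, Finset.mul_sum]
  rw [integral_finsetSum _ fun i _ => hint i]
  refine (Finset.le_sum_of_subadditive ENNReal.ofReal ENNReal.ofReal_zero.le
    (fun _ _ => ENNReal.ofReal_add_le) _ _).trans ?_
  refine Finset.sum_le_sum fun i _ => ?_
  obtain ⟨C, hC⟩ := (hcomp i).lipschitzWith_of_hasCompactSupport (hcs i) (by norm_num)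
  refine ofReal_integral_mul_lineDeriv_le hf hm hi i hC fun x => ?_
  exact (PiLp.norm_apply_le (φ x) i).trans (hφ3 x)

end Variation

/-! ### The traces are bounded by the variation -/

section TraceBound

variable {d : ℕ} {f : (Fin d → ℝ) → ENNReal}

theorem divergence_smul_single (i : Fin d) {ψ : (Fin d → ℝ) → ℝ} (hψ : Differentiable ℝ ψ)
    (x : Fin d → ℝ) :
    divergence (fun x => ψ x • EuclideanSpace.single i (1 : ℝ)) x =
      fderiv ℝ ψ x (Pi.single i 1) := by
  have h : HasFDerivAt (fun x => ψ x • EuclideanSpace.single i (1 : ℝ))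
      ((fderiv ℝ ψ x).smulRight (EuclideanSpace.single i (1 : ℝ))) x :=
    (hψ x).hasFDerivAt.smul_const _
  simp [divergence, h.fderiv]

theorem ofReal_integral_mul_fderiv_le_variation (v : (Fin d → ℝ) → ℝ) (i : Fin d)
    {ψ : (Fin d → ℝ) → ℝ} (hψ : ContDiff ℝ 1 ψ) (hc : HasCompactSupport ψ)
    (hψ1 : ∀ x, |ψ x| ≤ 1) :
    ENNReal.ofReal (∫ x, v x * fderiv ℝ ψ x (Pi.single i 1)) ≤ variation v := by
  simp only [← divergence_smul_single i (hψ.differentiable (by norm_num))]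
  refine le_iSup₂_of_le (f := fun (φ : (Fin d → ℝ) → EuclideanSpace ℝ (Fin d))
    (_ : ContDiff ℝ 1 φ ∧ HasCompactSupport φ ∧ ∀ x, ‖φ x‖ ≤ 1) =>
      ENNReal.ofReal (∫ x, v x * divergence φ x))
    (fun x => ψ x • EuclideanSpace.single i (1 : ℝ)) ⟨?_, ?_, ?_⟩ le_rfl
  · exact hψ.smul contDiff_const
  · exact hc.smul_right
  · intro x
    rw [norm_smul, PiLp.norm_single, norm_one, mul_one]
    exact hψ1 x

/-- The test field is a smooth substitute for the sign of `x i`, namely `2 / π * arctan (x i / ε)`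
in direction `i`. It is bounded by one but lacks compact support, hence the cutoffs `η (t n • x)`,
whose derivatives are of order `t n` and vanish in the limit. -/
theorem ofReal_integral_arctan_le (hm : Measurable f) (hi : ∫⁻ x, f x ≠ ⊤) (i : Fin d) {ε : ℝ}
    (hε : 0 < ε) :
    ENNReal.ofReal (∫ x, (f x).toReal * (2 / Real.pi * (1 / (1 + (x i / ε) ^ 2) * (1 / ε)))) ≤
      variation fun x => (f x).toReal := by
  set v : (Fin d → ℝ) → ℝ := fun x => (f x).toReal with hvdef
  have hv : Integrable v := integrable_toReal_of_lintegral_ne_top hm hi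
  let η : ContDiffBump (0 : Fin d → ℝ) := ⟨1, 2, one_pos, by norm_num⟩
  have hηc : ContDiff ℝ 1 (η : (Fin d → ℝ) → ℝ) := η.contDiff
  have hηd : Differentiable ℝ (η : (Fin d → ℝ) → ℝ) := hηc.differentiable (by norm_num)
  obtain ⟨C, hC⟩ := hηc.lipschitzWith_of_hasCompactSupport η.hasCompactSupport (by norm_num)
  set a : (Fin d → ℝ) → ℝ := fun x => 2 / Real.pi * Real.arctan (x i / ε) with ha
  set a' : (Fin d → ℝ) → ℝ :=
    fun x => 2 / Real.pi * (1 / (1 + (x i / ε) ^ 2) * (1 / ε)) with ha'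
  have hpi := Real.pi_pos
  have ha1 : ∀ x, |a x| ≤ 1 := by
    intro x
    have h1 := Real.arctan_lt_pi_div_two (x i / ε)
    have h2 := Real.neg_pi_div_two_lt_arctan (x i / ε)
    rw [ha, abs_mul, abs_of_pos (by positivity)]
    have h3 : |Real.arctan (x i / ε)| ≤ Real.pi / 2 := abs_le.2 ⟨by linarith, h1.le⟩
    calc 2 / Real.pi * |Real.arctan (x i / ε)| ≤ 2 / Real.pi * (Real.pi / 2) := by gcongr
      _ = 1 := by field_simp
  have hac : ContDiff ℝ 1 a := by
    refine contDiff_const.mul (Real.contDiff_arctan.comp ?_)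
    fun_prop
  have had : ∀ x, fderiv ℝ a x (Pi.single i 1) = a' x := by
    intro x
    have h0 : HasFDerivAt (fun x : Fin d → ℝ => x i)
        (ContinuousLinearMap.proj (R := ℝ) (φ := fun _ : Fin d => ℝ) i) x :=
      (ContinuousLinearMap.proj (R := ℝ) (φ := fun _ : Fin d => ℝ) i).hasFDerivAt
    have h1 := ((h0.mul_const (1 / ε)).arctan).const_mul (2 / Real.pi)
    have h2 : a = fun x => 2 / Real.pi * Real.arctan (x i * (1 / ε)) := by
      ext x; simp [ha, div_eq_mul_inv]
    rw [h2, h1.fderiv]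
    simp [ha', div_eq_mul_inv]
  have ha'0 : ∀ x, |a' x| ≤ 2 / Real.pi * (1 / ε) := by
    intro x
    rw [abs_of_nonneg (by positivity)]
    have : 1 / (1 + (x i / ε) ^ 2) ≤ 1 := by
      rw [div_le_one (by positivity)]
      nlinarith [sq_nonneg (x i / ε)]
    have h2 : 1 / (1 + (x i / ε) ^ 2) * (1 / ε) ≤ 1 * (1 / ε) := by gcongr
    calc a' x ≤ 2 / Real.pi * (1 * (1 / ε)) := by simp only [ha']; gcongr
      _ = _ := by rw [one_mul]
  set t : ℕ → ℝ := fun n => 1 / ((n : ℝ) + 1) with ht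
  have ht0 : ∀ n, 0 < t n := fun n => by simp only [ht]; positivity
  have ht1 : ∀ n, t n ≤ 1 := fun n => by
    simp only [ht]
    rw [div_le_one (by positivity)]
    linarith [Nat.cast_nonneg (α := ℝ) n]
  have htl : Filter.Tendsto t Filter.atTop (nhds 0) := tendsto_one_div_add_atTop_nhds_zero_nat
  set ψ : ℕ → (Fin d → ℝ) → ℝ := fun n x => a x * η (t n • x) with hψ
  have hsc : ∀ n, ContDiff ℝ 1 fun x : Fin d → ℝ => η (t n • x) := fun n =>
    hηc.comp (contDiff_const_smul (t n))
  have hψc : ∀ n, ContDiff ℝ 1 (ψ n) := fun n => hac.mul (hsc n)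
  have hψd : ∀ n x, fderiv ℝ (ψ n) x (Pi.single i 1) =
      a' x * η (t n • x) + a x * (t n * fderiv ℝ η (t n • x) (Pi.single i 1)) := by
    intro n x
    have h1 : HasFDerivAt (fun x : Fin d → ℝ => η (t n • x))
        ((fderiv ℝ η (t n • x)).comp (t n • ContinuousLinearMap.id ℝ (Fin d → ℝ))) x :=
      (hηd (t n • x)).hasFDerivAt.comp x ((hasFDerivAt_id x).const_smul (t n))
    have h2 := ((hac.differentiable (by norm_num)) x).hasFDerivAt.mul h1
    rw [show fderiv ℝ (ψ n) x = _ from h2.fderiv]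
    simp only [add_apply, smul_apply, smul_eq_mul,
      ContinuousLinearMap.comp_apply, ContinuousLinearMap.id_apply, map_smul, had]
    ring
  have hcs : ∀ n, HasCompactSupport fun x : Fin d → ℝ => η (t n • x) := fun n =>
    η.hasCompactSupport.comp_smul (ht0 n).ne'
  have hψn : ∀ n x, |ψ n x| ≤ 1 := by
    intro n x
    rw [hψ, abs_mul, abs_of_nonneg η.nonneg]
    exact mul_le_one₀ (ha1 x) η.nonneg η.le_one
  have hle : ∀ n, ENNReal.ofReal (∫ x, v x * fderiv ℝ (ψ n) x (Pi.single i 1)) ≤ variation v :=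
    fun n => ofReal_integral_mul_fderiv_le_variation v i (hψc n) ((hcs n).mul_left) (hψn n)
  refine le_of_tendsto (x := Filter.atTop) (ENNReal.tendsto_ofReal ?_)
    (Filter.Eventually.of_forall hle)
  refine tendsto_integral_of_dominated_convergence
    (fun x => |v x| * (2 / Real.pi * (1 / ε) + C * ‖(Pi.single i 1 : Fin d → ℝ)‖)) ?_
    (hv.abs.mul_const _) ?_ ?_
  · intro n
    exact hv.aestronglyMeasurable.mul
      (((hψc n).continuous_fderiv (by norm_num)).clm_apply continuous_const).aestronglyMeasurable
  · intro n
    refine Filter.Eventually.of_forall fun x => ?_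
    rw [norm_mul, Real.norm_eq_abs, hψd]
    gcongr
    refine (norm_add_le _ _).trans (add_le_add ?_ ?_)
    · rw [norm_mul, Real.norm_eq_abs, Real.norm_of_nonneg η.nonneg]
      exact (mul_le_of_le_one_right (abs_nonneg _) η.le_one).trans (ha'0 x)
    · rw [norm_mul (a x), norm_mul (t n), Real.norm_eq_abs (a x), Real.norm_of_nonneg (ht0 n).le]
      have h1 : ‖fderiv ℝ η (t n • x) (Pi.single i 1)‖ ≤ C * ‖(Pi.single i 1 : Fin d → ℝ)‖ :=
        ((fderiv ℝ η (t n • x)).le_opNorm _).trans (by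
          gcongr; exact norm_fderiv_le_of_lipschitz ℝ hC)
      calc |a x| * (t n * ‖fderiv ℝ η (t n • x) (Pi.single i 1)‖)
          ≤ 1 * (1 * (C * ‖(Pi.single i 1 : Fin d → ℝ)‖)) := by
            gcongr
            · exact ha1 x
            · exact ht1 n
        _ = _ := by ring
  · refine Filter.Eventually.of_forall fun x => ?_
    simp only [hψd]
    refine Filter.Tendsto.const_mul _ ?_
    have hx : Filter.Tendsto (fun n => t n • x) Filter.atTop (nhds 0) := by
      simpa using htl.smul_const x
    have hη0 : Filter.Tendsto (fun n => η (t n • x)) Filter.atTop (nhds 1) := by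
      have := (hηc.continuous.tendsto 0).comp hx
      rwa [η.one_of_mem_closedBall (by simp [η.rIn_pos.le])] at this
    have hη1 : Filter.Tendsto (fun n => fderiv ℝ η (t n • x) (Pi.single i 1)) Filter.atTop
        (nhds (fderiv ℝ η 0 (Pi.single i 1))) :=
      (((hηc.continuous_fderiv (by norm_num)).clm_apply continuous_const).tendsto 0).comp hx
    have := (hη0.const_mul (a' x)).add ((htl.mul hη1).const_mul (a x))
    rw [zero_mul, mul_zero, add_zero, mul_one] at this
    exact this

theorem setLIntegral_slab_le_variation (hm : Measurable f) (hi : ∫⁻ x, f x ≠ ⊤) (i : Fin d)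
    {ε : ℝ} (hε : 0 < ε) :
    ∫⁻ x in {x : Fin d → ℝ | x i ∈ Set.Ioo 0 ε}, f x ≤
      ENNReal.ofReal (Real.pi * ε) * variation fun x => (f x).toReal := by
  have hpi := Real.pi_pos
  have hms := measurableSet_slab (d := d) i (measurableSet_Ioo (a := (0 : ℝ)) (b := ε))
  set h : (Fin d → ℝ) → ℝ := fun x => 2 / Real.pi * (1 / (1 + (x i / ε) ^ 2) * (1 / ε)) with hh
  have hv := integrable_toReal_of_lintegral_ne_top hm hi
  have hh0 : ∀ x, 0 ≤ h x := fun x => by simp only [hh]; positivity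
  have hhb : ∀ x, ‖h x‖ ≤ 2 / Real.pi * (1 / ε) := by
    intro x
    rw [Real.norm_of_nonneg (hh0 x)]
    have : 1 / (1 + (x i / ε) ^ 2) ≤ 1 := by
      rw [div_le_one (by positivity)]
      nlinarith [sq_nonneg (x i / ε)]
    calc h x ≤ 2 / Real.pi * (1 * (1 / ε)) := by simp only [hh]; gcongr
      _ = _ := by rw [one_mul]
  have hint : Integrable fun x => (f x).toReal * h x := by
    refine hv.mul_bdd (c := 2 / Real.pi * (1 / ε)) ?_ (Filter.Eventually.of_forall hhb)
    exact (by fun_prop : Measurable h).aestronglyMeasurable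
  refine le_trans ?_ (mul_le_mul_right (ofReal_integral_arctan_le hm hi i hε) _)
  rw [ofReal_integral_eq_lintegral_ofReal hint (Filter.Eventually.of_forall fun x =>
    mul_nonneg ENNReal.toReal_nonneg (hh0 x)), ← lintegral_const_mul' _ _ ENNReal.ofReal_ne_top]
  rw [← lintegral_indicator hms]
  refine lintegral_mono_ae ?_
  filter_upwards [ae_lt_top hm hi] with x hx
  by_cases hxs : x ∈ {x : Fin d → ℝ | x i ∈ Set.Ioo 0 ε}
  swap
  · rw [Set.indicator_of_notMem hxs]; exact zero_le
  rw [Set.indicator_of_mem hxs, ENNReal.ofReal_mul ENNReal.toReal_nonneg,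
    ENNReal.ofReal_toReal hx.ne, mul_left_comm, ← ENNReal.ofReal_mul (by positivity)]
  refine le_mul_of_one_le_right zero_le ?_
  rw [ENNReal.one_le_ofReal]
  have hx0 : 0 < x i := hxs.1
  have hx1 : x i < ε := hxs.2
  have h1 : (x i / ε) ^ 2 ≤ 1 := by
    rw [sq_le_one_iff_abs_le_one, abs_of_pos (by positivity)]
    exact div_le_one_of_le₀ hx1.le hε.le
  -- On the slab `x i < ε` this is at least `1`, which explains the factor `π * ε`.
  have h2 : Real.pi * ε * h x = 2 / (1 + (x i / ε) ^ 2) := by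
    simp only [hh]
    have : (1 + (x i / ε) ^ 2) ≠ 0 := by positivity
    field_simp
  rw [h2, le_div_iff₀ (by positivity)]
  linarith

theorem traceNorm_le_variation (hf : AbsAntitone f) (hm : Measurable f) (hi : ∫⁻ x, f x ≠ ⊤)
    (i : Fin d) :
    traceNorm f i ≤ ENNReal.ofReal Real.pi * variation fun x => (f x).toReal := by
  have hms := fun s (hs : MeasurableSet s) => measurableSet_slab (d := d) i hs
  have hmono : Monotone fun (n : ℕ) x => f (Function.update x i (1 / ((n : ℝ) + 1))) := by
    intro m n hmn x
    refine hf _ _ fun j => ?_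
    by_cases h : j = i
    · subst h
      simp only [Function.update_self]
      rw [abs_of_pos (by positivity), abs_of_pos (by positivity)]
      gcongr
    · simp [h]
  unfold traceNorm trace
  have hmeas : ∀ n : ℕ, Measurable fun x => f (Function.update x i (1 / ((n : ℝ) + 1))) :=
    fun _ => hm.comp measurable_update_left
  rw [lintegral_iSup hmeas hmono]
  refine iSup_le fun n => ?_
  set ε : ℝ := 1 / ((n : ℝ) + 1) with hε
  have hε0 : 0 < ε := by positivity
  calc ∫⁻ x in {x : Fin d → ℝ | x i ∈ Set.Ioo (0 : ℝ) 1}, f (Function.update x i ε)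
      = ∫⁻ x, {x : Fin d → ℝ | x i ∈ Set.Ioo (0 : ℝ) 1}.indicator
          (fun x => f (Function.update x i ε)) x :=
        (lintegral_indicator (hms _ measurableSet_Ioo) _).symm
    -- By monotonicity the value at height `ε` is at most the average over the heights in `(0, ε)`.
    _ ≤ ∫⁻ x, ENNReal.ofReal (1 / ε) *
          {x : Fin d → ℝ | x i ∈ Set.Ioo (0 : ℝ) ε}.indicator f x := by
        refine lintegral_le_of_forall_lintegral_update_le i
          (Measurable.indicator (hm.comp measurable_update_left) (hms _ measurableSet_Ioo))
          ((hm.indicator (hms _ measurableSet_Ioo)).const_mul _) fun x => ?_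
        have h1 : ∀ t, {x : Fin d → ℝ | x i ∈ Set.Ioo (0 : ℝ) 1}.indicator
            (fun x => f (Function.update x i ε)) (Function.update x i t) =
            (Set.Ioo (0 : ℝ) 1).indicator (fun _ => f (Function.update x i ε)) t := by
          intro t
          by_cases ht : t ∈ Set.Ioo (0 : ℝ) 1
          · rw [Set.indicator_of_mem (by simpa using ht), Set.indicator_of_mem ht]; simp
          · rw [Set.indicator_of_notMem (by simpa using ht), Set.indicator_of_notMem ht]
        have h2 : ∀ t, (Set.Ioo (0 : ℝ) ε).indicator (fun _ => f (Function.update x i ε)) t ≤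
            {x : Fin d → ℝ | x i ∈ Set.Ioo (0 : ℝ) ε}.indicator f (Function.update x i t) := by
          intro t
          by_cases ht : t ∈ Set.Ioo (0 : ℝ) ε
          · rw [Set.indicator_of_mem ht, Set.indicator_of_mem (by simpa using ht)]
            refine hf _ _ fun j => ?_
            by_cases h : j = i
            · subst h
              simp only [Function.update_self]
              rw [abs_of_pos ht.1, abs_of_pos hε0]
              exact ht.2.le
            · simp [h]
          · rw [Set.indicator_of_notMem ht]; exact zero_le
        simp only [h1]
        rw [lintegral_indicator measurableSet_Ioo, lintegral_const_mul' _ _ ENNReal.ofReal_ne_top]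
        refine le_trans ?_ (mul_le_mul_right (lintegral_mono h2) _)
        rw [lintegral_indicator measurableSet_Ioo]
        simp only [lintegral_const, Measure.restrict_apply_univ, Real.volume_Ioo, sub_zero,
          ENNReal.ofReal_one, mul_one]
        rw [mul_left_comm, ← ENNReal.ofReal_mul (by positivity), one_div_mul_cancel hε0.ne']
        simp
    _ = ENNReal.ofReal (1 / ε) * ∫⁻ x in {x : Fin d → ℝ | x i ∈ Set.Ioo (0 : ℝ) ε}, f x := by
        rw [lintegral_const_mul' _ _ ENNReal.ofReal_ne_top,
          lintegral_indicator (hms _ measurableSet_Ioo)]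
    _ ≤ ENNReal.ofReal (1 / ε) * (ENNReal.ofReal (Real.pi * ε) *
          variation fun x => (f x).toReal) := by
        gcongr
        exact setLIntegral_slab_le_variation hm hi i hε0
    _ = _ := by
        rw [← mul_assoc, ← ENNReal.ofReal_mul (by positivity)]
        congr 2
        field_simp

end TraceBound

/-! ### Comparison of a norm with the maximum norm -/

section NormComparison

variable {d : ℕ}

theorem IsNormOn.exists_le_and_le (hd : 0 < d) {μ : Seminorm ℝ (Fin d → ℝ)} (hμ : IsNormOn μ) :
    ∃ a b : ℝ, 0 < a ∧ 0 < b ∧ ∀ x, a * ‖x‖ ≤ μ x ∧ μ x ≤ b * ‖x‖ := by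
  have : Nonempty (Fin d) := ⟨⟨0, hd⟩⟩
  have hne : (Metric.sphere (0 : Fin d → ℝ) 1).Nonempty := NormedSpace.sphere_nonempty.2 zero_le_one
  have hc : ContinuousOn μ (Metric.sphere (0 : Fin d → ℝ) 1) := μ.continuous_pi.continuousOn
  obtain ⟨p, hp, hpm⟩ := (isCompact_sphere (0 : Fin d → ℝ) 1).exists_isMinOn hne hc
  obtain ⟨q, hq, hqm⟩ := (isCompact_sphere (0 : Fin d → ℝ) 1).exists_isMaxOn hne hc
  have hpos : ∀ z ∈ Metric.sphere (0 : Fin d → ℝ) 1, 0 < μ z := by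
    intro z hz
    refine lt_of_le_of_ne (apply_nonneg μ z) fun h => ?_
    rw [hμ z h.symm] at hz
    simp at hz
  refine ⟨μ p, μ q, hpos p hp, hpos q hq, fun x => ?_⟩
  rcases eq_or_ne x 0 with rfl | hx
  · simp
  have hx0 : 0 < ‖x‖ := norm_pos_iff.2 hx
  have hz : ‖x‖⁻¹ • x ∈ Metric.sphere (0 : Fin d → ℝ) 1 := by
    simp [norm_smul, hx0.ne']
  have hxe : μ x = ‖x‖ * μ (‖x‖⁻¹ • x) := by
    rw [map_smul_eq_mul, norm_inv, norm_norm, mul_inv_cancel_left₀ hx0.ne']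
  rw [hxe, mul_comm _ ‖x‖, mul_comm _ ‖x‖]
  exact ⟨mul_le_mul_of_nonneg_left (hpm hz) hx0.le, mul_le_mul_of_nonneg_left (hqm hz) hx0.le⟩

/-- A ball lies between two concentric cubes whose half-sides have ratio `b / a`; its average is
compared with that over the outer cube. -/
theorem localMaximal_le_mul_localMaximal_ellInfty {μ : Seminorm ℝ (Fin d → ℝ)} {a b : ℝ}
    (ha : 0 < a) (hb : 0 < b) (hμ : ∀ x, a * ‖x‖ ≤ μ x ∧ μ x ≤ b * ‖x‖) (R : ℝ)
    (f : (Fin d → ℝ) → ENNReal) (x : Fin d → ℝ) :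
    localMaximal R μ f x ≤
      ENNReal.ofReal ((b / a) ^ d) * localMaximal (R / a) (ellInfty d) f x := by
  refine iSup_le fun y => iSup_le fun δ => iSup_le fun h => ?_
  obtain ⟨hδ, hR, hx⟩ := h
  have hsub : muBall μ y δ ⊆ muBall (ellInfty d) y (δ / a) := by
    intro z hz
    change ‖z - y‖ ≤ δ / a
    rw [le_div_iff₀ ha, mul_comm]
    exact (hμ _).1.trans hz
  have hsup : muBall (ellInfty d) y (δ / b) ⊆ muBall μ y δ := by
    intro z hz
    have hz' : ‖z - y‖ ≤ δ / b := hz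
    rw [le_div_iff₀ hb, mul_comm] at hz'
    exact (hμ _).2.trans hz'
  have hvol : volume (muBall (ellInfty d) y (δ / a)) ≤
      ENNReal.ofReal ((b / a) ^ d) * volume (muBall μ y δ) := by
    refine le_trans (le_of_eq ?_) (mul_le_mul_right (measure_mono hsup) _)
    rw [volume_muBall_ellInfty y (by positivity), volume_muBall_ellInfty y (by positivity),
      ← mul_assoc, ← ENNReal.ofReal_mul (by positivity), ← mul_pow]
    congr 3
    field_simp
  have hpos : volume (muBall (ellInfty d) y (δ / a)) ≠ 0 := by
    rw [volume_muBall_ellInfty y (by positivity)]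
    have : (0 : ℝ) < (δ / a) ^ d := by positivity
    simp [this]
  have htop : volume (muBall (ellInfty d) y (δ / a)) ≠ ⊤ := by
    rw [volume_muBall_ellInfty y (by positivity)]
    exact ENNReal.mul_ne_top ENNReal.ofReal_ne_top (by simp)
  refine le_trans ?_ (mul_le_mul_right (le_localMaximal (by positivity : 0 < δ / a)
    (div_le_div_of_nonneg_right hR ha.le) (hsub hx)) _)
  refine ENNReal.div_le_of_le_mul ?_
  calc ∫⁻ u in muBall μ y δ, f u ≤ ∫⁻ u in muBall (ellInfty d) y (δ / a), f u :=
        lintegral_mono_set hsub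
    _ = (∫⁻ u in muBall (ellInfty d) y (δ / a), f u) / volume (muBall (ellInfty d) y (δ / a)) *
          volume (muBall (ellInfty d) y (δ / a)) := (ENNReal.div_mul_cancel hpos htop).symm
    _ ≤ (∫⁻ u in muBall (ellInfty d) y (δ / a), f u) / volume (muBall (ellInfty d) y (δ / a)) *
          (ENNReal.ofReal ((b / a) ^ d) * volume (muBall μ y δ)) := by gcongr
    _ = _ := by ring

/-- The variation has no such monotonicity; this is why a pointwise comparison of maximal functions
suffices in the present setting. -/
theorem traceNorm_le_mul {u v : (Fin d → ℝ) → ENNReal} {K : ENNReal} (hK : K ≠ ⊤)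
    (h : ∀ x, u x ≤ K * v x) (i : Fin d) : traceNorm u i ≤ K * traceNorm v i := by
  unfold traceNorm trace
  rw [← lintegral_const_mul' _ _ hK]
  refine lintegral_mono fun x => ?_
  rw [ENNReal.mul_iSup]
  exact iSup_mono fun n => h _

end NormComparison

/-! ### The bound in the space of functions of bounded variation -/

section Assembly

variable {d : ℕ} {f : (Fin d → ℝ) → ENNReal}

/-- A measurable representative of a function in `BD`. -/
theorem MemBD.exists_measurable_rep (hf : MemBD f) :
    ∃ g : (Fin d → ℝ) → ENNReal, AbsAntitone g ∧ Measurable g ∧ g =ᵐ[volume] f ∧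
      ∫⁻ x, g x ≠ ⊤ := by
  obtain ⟨hb, ⟨hm, hi⟩, -⟩ := hf
  have ha := hb.absAntitone
  have hae := lscEnvelope_ae_eq ha hm hi.ne
  refine ⟨lscEnvelope f, absAntitone_lscEnvelope ha,
    (lowerSemicontinuous_lscEnvelope ha).measurable, hae, ?_⟩
  rw [lintegral_congr_ae hae]
  exact hi.ne

theorem l1Norm_congr_ae {g : (Fin d → ℝ) → ENNReal} (h : g =ᵐ[volume] f) : l1Norm g = l1Norm f :=
  lintegral_congr_ae h

theorem variation_congr_ae {u v : (Fin d → ℝ) → ℝ} (h : u =ᵐ[volume] v) :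
    variation u = variation v := by
  unfold variation
  refine iSup_congr fun φ => iSup_congr fun _ => ?_
  congr 1
  refine integral_congr_ae ?_
  filter_upwards [h] with x hx
  rw [hx]

theorem bvNorm_congr_ae {g : (Fin d → ℝ) → ENNReal} (h : g =ᵐ[volume] f) : bvNorm g = bvNorm f := by
  unfold bvNorm
  have h' : (fun x => (g x).toReal) =ᵐ[volume] fun x => (f x).toReal :=
    h.fun_comp ENNReal.toReal
  rw [l1Norm_congr_ae h, variation_congr_ae h']

/-- The basic a priori bound for the cubic maximal function. -/
theorem exists_lintegral_add_traceNorm_localMaximal_le (d : ℕ) :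
    ∃ C : ENNReal, C ≠ ⊤ ∧ ∀ R : ℝ, 0 < R → ∀ f : (Fin d → ℝ) → ENNReal, AbsAntitone f →
      Measurable f → ∫⁻ x, f x ≠ ⊤ →
      (∫⁻ x, localMaximal R (ellInfty d) f x) +
        2 * ∑ i, traceNorm (localMaximal R (ellInfty d) f) i ≤
          C * (bvNorm f + l1Norm f * ENNReal.ofReal (Real.posLog R)) := by
  set A : ENNReal := 8 * 32 ^ d with hA
  have hAt : A ≠ ⊤ := by rw [hA]; finiteness
  set P : ENNReal := ENNReal.ofReal Real.pi
  refine ⟨A * ((2 * d + 1) * (d * P) + 1), by finiteness, fun R hR f hf hm hi => ?_⟩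
  have h1 := lintegral_localMaximal_ellInfty_le hf hm hR
  set T := ∑ j, traceNorm f j
  set L := ENNReal.ofReal (Real.posLog R)
  set V := variation fun x => (f x).toReal with hV
  have h2 : ∑ i, traceNorm (localMaximal R (ellInfty d) f) i ≤ d * (A * T) := by
    refine (Finset.sum_le_card_nsmul _ _ _ fun i _ =>
      traceNorm_localMaximal_ellInfty_le hf hm R i).trans (le_of_eq ?_)
    rw [nsmul_eq_mul, Finset.card_univ, Fintype.card_fin]
  have hT : T ≤ d * (P * V) := by
    refine (Finset.sum_le_card_nsmul _ _ _ fun i _ =>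
      traceNorm_le_variation hf hm hi i).trans (le_of_eq ?_)
    rw [nsmul_eq_mul, Finset.card_univ, Fintype.card_fin]
  unfold bvNorm l1Norm
  set N := ∫⁻ x, f x
  rw [← hV]
  calc (∫⁻ x, localMaximal R (ellInfty d) f x) +
        2 * ∑ i, traceNorm (localMaximal R (ellInfty d) f) i
      ≤ A * (T + N + N * L) + 2 * (d * (A * T)) := by gcongr
    _ = A * ((2 * d + 1) * T + N + N * L) := by ring
    _ ≤ A * ((2 * d + 1) * (d * (P * V)) + N + N * L) := by gcongr
    _ = A * ((2 * d + 1) * (d * P) * V + 1 * (N + N * L)) := by ring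
    _ ≤ A * ((2 * d + 1) * (d * P) * (N + V + N * L) + 1 * (N + V + N * L)) := by
        gcongr
        · exact le_add_right le_add_self
        · exact le_self_add
    _ = _ := by ring

theorem exists_pos_le_ofReal {C : ENNReal} (hC : C ≠ ⊤) :
    ∃ c : ℝ, 0 < c ∧ C ≤ ENNReal.ofReal c := by
  refine ⟨C.toReal + 1, by positivity, ?_⟩
  rw [← ENNReal.ofReal_toReal hC]
  refine ENNReal.ofReal_le_ofReal ?_
  rw [ENNReal.toReal_ofReal ENNReal.toReal_nonneg]
  linarith

theorem MemBD.bound_ne_top (hf : MemBD f) (R : ℝ) :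
    bvNorm f + l1Norm f * ENNReal.ofReal (Real.posLog R) ≠ ⊤ := by
  have h1 : l1Norm f ≠ ⊤ := hf.2.1.2.ne
  have h2 : variation (fun x => (f x).toReal) ≠ ⊤ := hf.2.2.ne
  unfold bvNorm
  finiteness

theorem exists_bvNorm_localMaximal_le (hd : 0 < d) {μ : Seminorm ℝ (Fin d → ℝ)} (hμ : IsNormOn μ)
    (hu : IsUnconditional fun x => μ x) :
    ∃ c : ℝ, 0 < c ∧ ∀ R : ℝ, 0 < R → ∀ f : (Fin d → ℝ) → ENNReal, MemBD f →
      MemBV (localMaximal R μ f) ∧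
      bvNorm (localMaximal R μ f) ≤
        ENNReal.ofReal c * (bvNorm f + l1Norm f * ENNReal.ofReal (Real.posLog R)) := by
  obtain ⟨C, hC, hbound⟩ := exists_lintegral_add_traceNorm_localMaximal_le d
  obtain ⟨a, b, ha, hb, hab⟩ := hμ.exists_le_and_le hd
  set K : ENNReal := ENNReal.ofReal ((b / a) ^ d) with hK
  have hKt : K ≠ ⊤ := ENNReal.ofReal_ne_top
  -- Passing from radius `R` to `R / a` changes the logarithm by at most this constant, which is
  -- absorbed since `l1Norm g ≤ bvNorm g`.
  set Q : ENNReal := ENNReal.ofReal (Real.posLog a⁻¹) with hQ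
  obtain ⟨c, hc0, hc⟩ := exists_pos_le_ofReal
    (show K * (C * (1 + Q)) ≠ ⊤ by finiteness)
  refine ⟨c, hc0, fun R hR f hf => ?_⟩
  obtain ⟨g, hg, hgm, hae, hgi⟩ := hf.exists_measurable_rep
  have hfin := hf.bound_ne_top R
  rw [← localMaximal_congr_ae hae]
  rw [← bvNorm_congr_ae hae, ← l1Norm_congr_ae hae] at hfin ⊢
  set M := localMaximal R μ g with hM
  set M' := localMaximal (R / a) (ellInfty d) g with hM'
  have hle : ∀ x, M x ≤ K * M' x :=
    localMaximal_le_mul_localMaximal_ellInfty ha hb hab R g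
  have hMa : AbsAntitone M := absAntitone_localMaximal hu hg R
  have hMm : Measurable M := measurable_localMaximal μ R g
  have hlog : ENNReal.ofReal (Real.posLog (R / a)) ≤ ENNReal.ofReal (Real.posLog R) + Q := by
    rw [hQ, ← ENNReal.ofReal_add Real.posLog_nonneg Real.posLog_nonneg, div_eq_mul_inv]
    exact ENNReal.ofReal_le_ofReal Real.posLog_mul
  have hmain : (∫⁻ x, M x) + 2 * ∑ i, traceNorm M i ≤
      ENNReal.ofReal c * (bvNorm g + l1Norm g * ENNReal.ofReal (Real.posLog R)) := by
    calc (∫⁻ x, M x) + 2 * ∑ i, traceNorm M i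
        ≤ (∫⁻ x, K * M' x) + 2 * ∑ i, K * traceNorm M' i := by
          gcongr with x i
          · exact hle x
          · exact traceNorm_le_mul hKt hle i
      _ = K * ((∫⁻ x, M' x) + 2 * ∑ i, traceNorm M' i) := by
          rw [lintegral_const_mul' _ _ hKt, ← Finset.mul_sum]
          ring
      _ ≤ K * (C * (bvNorm g + l1Norm g * ENNReal.ofReal (Real.posLog (R / a)))) := by
          gcongr
          exact hbound (R / a) (by positivity) g hg hgm hgi
      _ ≤ K * (C * (bvNorm g + l1Norm g * (ENNReal.ofReal (Real.posLog R) + Q))) := by gcongr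
      _ ≤ K * (C * (1 + Q)) * (bvNorm g + l1Norm g * ENNReal.ofReal (Real.posLog R)) := by
          rw [mul_assoc, mul_assoc]
          gcongr
          have hl : l1Norm g ≤ bvNorm g := le_self_add
          calc bvNorm g + l1Norm g * (ENNReal.ofReal (Real.posLog R) + Q)
              = (bvNorm g + l1Norm g * ENNReal.ofReal (Real.posLog R)) + Q * l1Norm g := by ring
            _ ≤ (bvNorm g + l1Norm g * ENNReal.ofReal (Real.posLog R)) +
                  Q * (bvNorm g + l1Norm g * ENNReal.ofReal (Real.posLog R)) := by
                gcongr
                exact le_add_right hl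
            _ = _ := by ring
      _ ≤ _ := by gcongr
  have htop : ENNReal.ofReal c * (bvNorm g + l1Norm g * ENNReal.ofReal (Real.posLog R)) < ⊤ :=
    (ENNReal.mul_ne_top ENNReal.ofReal_ne_top hfin).lt_top
  have hMi : ∫⁻ x, M x < ⊤ := (le_self_add.trans hmain).trans_lt htop
  have hbv : bvNorm M ≤
      ENNReal.ofReal c * (bvNorm g + l1Norm g * ENNReal.ofReal (Real.posLog R)) :=
    (add_le_add_right (variation_le_sum_traceNorm hMa hMm hMi.ne) _).trans hmain
  exact ⟨⟨⟨hMm.aemeasurable, hMi⟩, (le_add_self.trans hbv).trans_lt htop⟩, hbv⟩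

end Assembly

/-! ### Lipschitz estimates away from the coordinate hyperplanes -/

section Lipschitz

variable {d : ℕ} {f : (Fin d → ℝ) → ENNReal}

theorem setLIntegral_muBall_le_translate (hf : AbsAntitone f) (hm : Measurable f) (δ : ℝ)
    (y h : Fin d → ℝ) :
    ∫⁻ u in muBall (ellInfty d) y δ, f u ≤ (∫⁻ u in muBall (ellInfty d) (y + h) δ, f u) +
      ENNReal.ofReal (2 * ‖h‖) * ∑ i, traceNorm f i := by
  set Q := muBall (ellInfty d) y δ
  set Q' := muBall (ellInfty d) (y + h) δ
  -- A point of the cube lost by the translation is within `‖h‖` of a face, hence lies in one of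
  -- these pairs of slabs. Since the slabs are parallel to the coordinate hyperplanes, traces bound
  -- their mass; this step is specific to cubes.
  set I : Fin d → Set ℝ := fun i =>
    Set.Icc (y i - δ) (y i - δ + ‖h‖) ∪ Set.Icc (y i + δ - ‖h‖) (y i + δ) with hI
  have hIm : ∀ i, MeasurableSet (I i) := fun i => measurableSet_Icc.union measurableSet_Icc
  have hIv : ∀ i, volume (I i) ≤ ENNReal.ofReal (2 * ‖h‖) := by
    intro i
    refine (measure_union_le _ _).trans ?_
    rw [Real.volume_Icc, Real.volume_Icc, two_mul, ENNReal.ofReal_add (norm_nonneg h) (norm_nonneg h)]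
    apply le_of_eq
    congr 2 <;> ring
  have hsub : Q ⊆ Q' ∪ ⋃ i, {z : Fin d → ℝ | z i ∈ I i} := by
    intro z hz
    by_cases hz' : z ∈ Q'
    · exact Or.inl hz'
    right
    rw [Set.mem_iUnion]
    have hδ : 0 ≤ δ := (apply_nonneg (ellInfty d) (z - y)).trans hz
    have h1 : ¬ ‖z - (y + h)‖ ≤ δ := hz'
    rw [pi_norm_le_iff_of_nonneg hδ] at h1
    push Not at h1
    obtain ⟨i, hi⟩ := h1
    refine ⟨i, ?_⟩
    have h2 : |z i - y i| ≤ δ := (norm_le_pi_norm (z - y) i).trans hz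
    have h3 : |h i| ≤ ‖h‖ := norm_le_pi_norm h i
    have h4 : δ < |z i - (y i + h i)| := hi
    rw [abs_le] at h2 h3
    rw [lt_abs] at h4
    rcases h4 with h4 | h4
    · right
      constructor <;> linarith
    · left
      constructor <;> linarith
  refine (lintegral_mono_set hsub).trans ((lintegral_union_le f _ _).trans ?_)
  gcongr
  refine (lintegral_iUnion_le _ _).trans ?_
  rw [tsum_fintype, Finset.mul_sum]
  refine Finset.sum_le_sum fun i _ => (setLIntegral_slab_le hf hm i (hIm i)).trans ?_
  gcongr
  exact hIv i

theorem average_muBall_ellInfty (f : (Fin d → ℝ) → ENNReal) (y : Fin d → ℝ) {δ : ℝ}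
    (hδ : 0 < δ) :
    (∫⁻ u in muBall (ellInfty d) y δ, f u) / volume (muBall (ellInfty d) y δ) =
      (∫⁻ v in unitCube d, f (y + δ • v)) / 2 ^ d := by
  rw [setLIntegral_muBall_ellInfty f y hδ, volume_muBall_ellInfty y hδ]
  have : (0 : ℝ) < δ ^ d := by positivity
  exact ENNReal.mul_div_mul_left _ _ (by simpa using this) ENNReal.ofReal_ne_top

/-- Away from the coordinate hyperplanes only cubes that are not too small matter. -/
theorem exists_average_ge (hf : AbsAntitone f) {R ε δ : ℝ} {p y : Fin d → ℝ}
    (hR : 0 < R) (hε : 0 < ε) (hp : ∀ j, ε ≤ p j) (hδ : 0 < δ) (hδR : δ ≤ R)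
    (hpy : p ∈ muBall (ellInfty d) y δ) :
    ∃ (y' : Fin d → ℝ) (δ' : ℝ), min (ε / 2) R ≤ δ' ∧ δ' ≤ R ∧ p ∈ muBall (ellInfty d) y' δ' ∧
      (∫⁻ u in muBall (ellInfty d) y δ, f u) / volume (muBall (ellInfty d) y δ) ≤
        (∫⁻ u in muBall (ellInfty d) y' δ', f u) / volume (muBall (ellInfty d) y' δ') := by
  set δ₀ := min (ε / 2) R with hδ₀
  have hδ₀0 : 0 < δ₀ := by positivity
  have hδ₀ε : δ₀ ≤ ε / 2 := min_le_left _ _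
  rcases le_or_gt δ₀ δ with h | h
  · exact ⟨y, δ, h, hδR, hpy, le_rfl⟩
  -- The new cube has `p` as its outermost corner and, because `δ₀ ≤ ε / 2`, stays in the
  -- nonnegative orthant. The old cube is first pushed inwards until `p` is its corner too;
  -- enlarging it from that corner moves every point towards the origin.
  refine ⟨fun j => p j - δ₀, δ₀, le_rfl, min_le_right _ _, ?_, ?_⟩
  · rw [muBall_ellInfty, mem_closedBall_iff_norm, pi_norm_le_iff_of_nonneg hδ₀0.le]
    intro j
    simp [abs_of_pos hδ₀0]
  · have hyj : ∀ j, p j - δ ≤ y j := by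
      intro j
      have h1 : |p j - y j| ≤ δ := (norm_le_pi_norm (p - y) j).trans hpy
      have := (abs_le.1 h1).2
      linarith
    have h1 : ∫⁻ u in muBall (ellInfty d) y δ, f u ≤
        ∫⁻ u in muBall (ellInfty d) (fun j => p j - δ) δ, f u := by
      refine absAntitone_setLIntegral_muBall (isUnconditional_ellInfty d) hf δ _ _ fun j => ?_
      have := hp j
      rw [abs_of_nonneg (by linarith)]
      exact (hyj j).trans (le_abs_self _)
    rw [volume_muBall _ y, ← volume_muBall (ellInfty d) (fun j => p j - δ)]
    refine (ENNReal.div_le_div_right h1 _).trans ?_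
    rw [average_muBall_ellInfty f _ hδ, average_muBall_ellInfty f _ hδ₀0]
    gcongr ?_ / _
    refine setLIntegral_mono' (measurableSet_unitCube d) fun v hv => hf _ _ fun j => ?_
    have hv1 := (abs_le.1 (hv j)).1
    have hv2 := (abs_le.1 (hv j)).2
    have hpj := hp j
    simp only [Pi.add_apply, Pi.smul_apply, smul_eq_mul]
    have e0 : 0 ≤ p j - δ₀ + δ₀ * v j := by nlinarith
    have e1 : p j - δ₀ + δ₀ * v j ≤ p j - δ + δ * v j := by nlinarith
    rw [abs_of_nonneg e0, abs_of_nonneg (e0.trans e1)]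
    exact e1

theorem localMaximal_le_add (hf : AbsAntitone f) (hm : Measurable f)
    {R ε : ℝ} (hR : 0 < R) (hε : 0 < ε) {p : Fin d → ℝ} (hp : ∀ j, ε ≤ p j) (q : Fin d → ℝ) :
    localMaximal R (ellInfty d) f p ≤ localMaximal R (ellInfty d) f q +
      ENNReal.ofReal (2 * ‖q - p‖) * (∑ i, traceNorm f i) /
        ENNReal.ofReal (min (ε / 2) R ^ d) := by
  have hδ₀0 : 0 < min (ε / 2) R := by positivity
  refine iSup_le fun y => iSup_le fun δ => iSup_le fun h => ?_
  obtain ⟨hδ, hδR, hpy⟩ := h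
  obtain ⟨y', δ', hδ', hδR', hpy', hle⟩ := exists_average_ge hf hR hε hp hδ hδR hpy
  have hδ'0 : 0 < δ' := hδ₀0.trans_le hδ'
  have hq : q ∈ muBall (ellInfty d) (y' + (q - p)) δ' := by
    simpa [muBall, show q - (y' + (q - p)) = p - y' by abel] using hpy'
  refine hle.trans ?_
  refine (ENNReal.div_le_div_right
    (setLIntegral_muBall_le_translate hf hm δ' y' (q - p)) _).trans ?_
  rw [ENNReal.add_div]
  gcongr
  · rw [volume_muBall _ y', ← volume_muBall _ (y' + (q - p))]
    exact le_localMaximal hδ'0 hδR' hq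
  · rw [volume_muBall_ellInfty y' hδ'0]
    refine le_trans ?_ (le_mul_of_one_le_right zero_le (one_le_pow₀ (by norm_num)))
    gcongr

/-- Truncation of a function near the coordinate hyperplanes. -/
noncomputable def clipNear (ε : ℝ) (u : (Fin d → ℝ) → ℝ) (x : Fin d → ℝ) : ℝ :=
  u fun j => max |x j| ε

/-- Where all coordinates are at least `ε`, only radii at least `min (ε / 2) R` matter, and such
averages are Lipschitz in the position. The map sending each `x j` to `max |x j| ε` is 1-Lipschitz,
so the estimate becomes global, also across the hyperplanes. -/
theorem exists_lipschitzWith_clipNear (hf : AbsAntitone f) (hm : Measurable f)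
    (hT : ∀ i, traceNorm f i ≠ ⊤) {R ε : ℝ} (hR : 0 < R) (hε : 0 < ε)
    (hM : ∫⁻ x, localMaximal R (ellInfty d) f x ≠ ⊤) :
    ∃ K, LipschitzWith K
      (clipNear ε fun x => (localMaximal R (ellInfty d) f x).toReal) := by
  set M := localMaximal R (ellInfty d) f with hMdef
  have hMa : AbsAntitone M := absAntitone_localMaximal (isUnconditional_ellInfty d) hf R
  set T := ∑ i, traceNorm f i with hTdef
  have hTt : T ≠ ⊤ := ENNReal.sum_ne_top.2 fun i _ => hT i
  set δ₀ := min (ε / 2) R ^ d with hδ₀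
  have hδ₀0 : 0 < δ₀ := by positivity
  set K : ℝ := 2 * T.toReal / δ₀ with hK
  have hK0 : 0 ≤ K := by positivity
  have key : ∀ p q : Fin d → ℝ, (∀ j, ε ≤ p j) → (∀ j, ε ≤ q j) →
      (M p).toReal ≤ (M q).toReal + K * ‖q - p‖ := by
    intro p q hp hq
    have hpt : M p ≠ ⊤ := hMa.ne_top_of_lintegral_ne_top hM fun j => (hε.trans_le (hp j)).ne'
    have hqt : M q ≠ ⊤ := hMa.ne_top_of_lintegral_ne_top hM fun j => (hε.trans_le (hq j)).ne'
    have h := localMaximal_le_add hf hm hR hε hp q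
    have he : ENNReal.ofReal (2 * ‖q - p‖) * T / ENNReal.ofReal δ₀ =
        ENNReal.ofReal (K * ‖q - p‖) := by
      rw [← ENNReal.ofReal_toReal hTt, ← ENNReal.ofReal_mul (by positivity),
        ← ENNReal.ofReal_div_of_pos hδ₀0]
      congr 1
      rw [hK]; ring
    rw [he] at h
    have h2 := ENNReal.toReal_mono (ENNReal.add_ne_top.2 ⟨hqt, ENNReal.ofReal_ne_top⟩) h
    rwa [ENNReal.toReal_add hqt ENNReal.ofReal_ne_top,
      ENNReal.toReal_ofReal (by positivity)] at h2
  refine ⟨K.toNNReal, LipschitzWith.of_dist_le_mul fun x y => ?_⟩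
  rw [Real.coe_toNNReal K hK0, Real.dist_eq, dist_eq_norm]
  set p : Fin d → ℝ := fun j => max |x j| ε with hp
  set q : Fin d → ℝ := fun j => max |y j| ε with hq
  have hpq : ‖p - q‖ ≤ ‖x - y‖ := by
    rw [pi_norm_le_iff_of_nonneg (norm_nonneg _)]
    intro j
    have h1 : |max |x j| ε - max |y j| ε| ≤ |(|x j| - |y j|)| := abs_max_sub_max_le_abs _ _ _
    exact h1.trans ((abs_abs_sub_abs_le_abs_sub _ _).trans (norm_le_pi_norm (x - y) j))
  have hp' : ∀ j, ε ≤ p j := fun j => le_max_right _ _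
  have hq' : ∀ j, ε ≤ q j := fun j => le_max_right _ _
  have h1 := key p q hp' hq'
  have h2 := key q p hq' hp'
  rw [norm_sub_rev] at h1
  have h3 : K * ‖p - q‖ ≤ K * ‖x - y‖ := by gcongr
  change |(M p).toReal - (M q).toReal| ≤ _
  rw [abs_le]
  constructor <;> linarith

end Lipschitz

/-! ### The weak gradient -/

section WeakGradient

variable {d : ℕ} {f : (Fin d → ℝ) → ENNReal}

/-- The coordinate `i` is left out of the product so that differentiating in direction `i` never
hits the cutoff, whose gradient is of order `1 / ε`. -/
theorem exists_cutoff (i : Fin d) {ε : ℝ} (hε : 0 < ε) :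
    ∃ χ : (Fin d → ℝ) → ℝ, ContDiff ℝ 1 χ ∧ (∀ x, 0 ≤ χ x ∧ χ x ≤ 1) ∧
      (∀ x, (∃ j, j ≠ i ∧ |x j| ≤ ε) → χ x = 0) ∧ (∀ x, (∀ j, 2 * ε ≤ |x j|) → χ x = 1) ∧
      ∀ x (t : ℝ), χ (x + t • Pi.single i 1) = χ x := by
  let η : ContDiffBump (0 : ℝ) := ⟨1, 2, one_pos, by norm_num⟩
  refine ⟨fun x => ∏ j ∈ Finset.univ.erase i, (1 - η (x j / ε)), ?_, fun x => ⟨?_, ?_⟩, ?_, ?_, ?_⟩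
  · refine contDiff_prod fun j _ => contDiff_const.sub (η.contDiff.comp ?_)
    fun_prop
  · exact Finset.prod_nonneg fun j _ => sub_nonneg.2 η.le_one
  · exact Finset.prod_le_one (fun j _ => sub_nonneg.2 η.le_one)
      fun j _ => sub_le_self _ η.nonneg
  · rintro x ⟨j, hji, hj⟩
    refine Finset.prod_eq_zero (Finset.mem_erase.2 ⟨hji, Finset.mem_univ j⟩) ?_
    rw [η.one_of_mem_closedBall, sub_self]
    rw [mem_closedBall_zero_iff, Real.norm_eq_abs, abs_div, abs_of_pos hε]
    exact (div_le_one hε).2 hj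
  · intro x hx
    refine Finset.prod_eq_one fun j _ => ?_
    rw [η.zero_of_le_dist, sub_zero]
    rw [dist_zero_right, Real.norm_eq_abs, abs_div, abs_of_pos hε]
    exact (le_div_iff₀ hε).2 (hx j)
  · intro x t
    refine Finset.prod_congr rfl fun j hj => ?_
    simp [Finset.ne_of_mem_erase hj]

theorem eventually_forall_lt_abs {ε : ℝ} {x : Fin d → ℝ} (hx : ∀ j, ε < |x j|) :
    ∀ᶠ y in nhds x, ∀ j, ε < |y j| :=
  Filter.eventually_all.2 fun j =>
    ((continuous_apply j).abs.tendsto x).eventually (lt_mem_nhds (hx j))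

theorem clipNear_eq (hf : AbsAntitone f) {ε : ℝ} {x : Fin d → ℝ} (hx : ∀ j, ε < |x j|) :
    clipNear ε (fun x => (f x).toReal) x = (f x).toReal := by
  exact congrArg ENNReal.toReal
    (hf.eq_of_abs_eq fun j => by rw [max_eq_left (hx j).le, abs_abs])

theorem clipNear_eventuallyEq (hf : AbsAntitone f) {ε : ℝ} {x : Fin d → ℝ}
    (hx : ∀ j, ε < |x j|) :
    clipNear ε (fun x => (f x).toReal) =ᶠ[nhds x] fun x => (f x).toReal := by
  filter_upwards [eventually_forall_lt_abs hx] with y hy using clipNear_eq hf hy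

theorem lineDeriv_clipNear_eq_zero (u : (Fin d → ℝ) → ℝ) (i : Fin d) {ε : ℝ} {x : Fin d → ℝ}
    (hx : |x i| < ε) : lineDeriv ℝ (clipNear ε u) x (Pi.single i 1) = 0 := by
  have h : (fun t : ℝ => clipNear ε u (x + t • Pi.single i 1)) =ᶠ[nhds 0]
      fun _ => clipNear ε u x := by
    have hc : Filter.Tendsto (fun t : ℝ => |x i + t|) (nhds 0) (nhds |x i|) := by
      have : Continuous fun t : ℝ => |x i + t| := by fun_prop
      simpa using this.tendsto 0
    filter_upwards [hc.eventually (gt_mem_nhds hx)] with t ht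
    unfold clipNear
    congr 1
    ext j
    by_cases hj : j = i
    · subst hj
      simp only [Pi.add_apply, Pi.smul_apply, Pi.single_eq_same, smul_eq_mul, mul_one]
      rw [max_eq_right ht.le, max_eq_right hx.le]
    · simp [hj]
  rw [lineDeriv, h.deriv_eq, deriv_const]

theorem exists_nat_forall_lt_abs {x : Fin d → ℝ} (hx : ∀ j, x j ≠ 0) (c : ℝ) :
    ∃ N : ℕ, ∀ n : ℕ, N ≤ n → ∀ j, c * (1 / ((n : ℝ) + 1)) < |x j| := by
  have h : ∀ j, ∀ᶠ n : ℕ in Filter.atTop, c * (1 / ((n : ℝ) + 1)) < |x j| := fun j => by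
    have := (tendsto_one_div_add_atTop_nhds_zero_nat (𝕜 := ℝ)).const_mul c
    rw [mul_zero] at this
    exact this.eventually (gt_mem_nhds (abs_pos.2 (hx j)))
  obtain ⟨N, hN⟩ := Filter.eventually_atTop.1 (Filter.eventually_all.2 h)
  exact ⟨N, hN⟩

theorem ae_lineDifferentiableAt_toReal (hf : AbsAntitone f)
    (hlip : ∀ ε : ℝ, 0 < ε → ∃ K, LipschitzWith K (clipNear ε fun x => (f x).toReal)) (i : Fin d) :
    ∀ᵐ x, LineDifferentiableAt ℝ (fun x => (f x).toReal) x (Pi.single i 1) := by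
  have h : ∀ n : ℕ, ∀ᵐ x, LineDifferentiableAt ℝ
      (clipNear (1 / ((n : ℝ) + 1)) fun x => (f x).toReal) x (Pi.single i 1) := fun n => by
    obtain ⟨K, hK⟩ := hlip (1 / ((n : ℝ) + 1)) (by positivity)
    exact hK.ae_lineDifferentiableAt _
  filter_upwards [ae_all_iff.2 h, ae_forall_ne_zero d] with x hx hx0
  obtain ⟨N, hN⟩ := exists_nat_forall_lt_abs hx0 1
  have hN' := hN N le_rfl
  rw [one_mul] at hN'
  exact (clipNear_eventuallyEq hf hN').lineDifferentiableAt_iff.1 (hx N)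

theorem aestronglyMeasurable_lineDeriv_toReal (hf : AbsAntitone f)
    (hlip : ∀ ε : ℝ, 0 < ε → ∃ K, LipschitzWith K (clipNear ε fun x => (f x).toReal)) (i : Fin d) :
    AEStronglyMeasurable (fun x => lineDeriv ℝ (fun x => (f x).toReal) x (Pi.single i 1))
      (volume : Measure (Fin d → ℝ)) := by
  refine aestronglyMeasurable_of_tendsto_ae Filter.atTop
    (f := fun (n : ℕ) x => lineDeriv ℝ (clipNear (1 / ((n : ℝ) + 1)) fun x => (f x).toReal) x
      (Pi.single i 1)) (fun n => ?_) ?_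
  · obtain ⟨K, hK⟩ := hlip (1 / ((n : ℝ) + 1)) (by positivity)
    exact (measurable_lineDeriv hK.continuous).aestronglyMeasurable
  · filter_upwards [ae_forall_ne_zero d] with x hx0
    obtain ⟨N, hN⟩ := exists_nat_forall_lt_abs hx0 1
    refine tendsto_const_nhds.congr' ?_
    filter_upwards [Filter.eventually_ge_atTop N] with n hn
    have hn' := hN n hn
    rw [one_mul] at hn'
    exact (clipNear_eventuallyEq hf hn').lineDeriv_eq.symm

/-- Fatou's lemma for difference quotients, whose integrals are bounded by the translation estimate.
-/
theorem lintegral_enorm_lineDeriv_toReal_le (hf : AbsAntitone f) (hm : Measurable f)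
    (hi : ∫⁻ x, f x ≠ ⊤)
    (hlip : ∀ ε : ℝ, 0 < ε → ∃ K, LipschitzWith K (clipNear ε fun x => (f x).toReal))
    (i : Fin d) :
    ∫⁻ x, ‖lineDeriv ℝ (fun x => (f x).toReal) x (Pi.single i 1)‖ₑ ≤ 2 * traceNorm f i := by
  set v : (Fin d → ℝ) → ℝ := fun x => (f x).toReal
  set q : ℕ → (Fin d → ℝ) → ENNReal := fun n x =>
    ENNReal.ofReal ((n : ℝ) + 1) *
      ‖v (x + Pi.single i (-(1 / ((n : ℝ) + 1)))) - v x‖ₑ with hq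
  have hvm : Measurable v := hm.ennreal_toReal
  have hqm : ∀ n, Measurable (q n) := fun n =>
    ((hvm.comp (measurable_add_const _)).sub hvm).enorm.const_mul _
  have hqle : ∀ n, ∫⁻ x, q n x ≤ 2 * traceNorm f i := by
    intro n
    have h0 : (0 : ℝ) < 1 / ((n : ℝ) + 1) := by positivity
    rw [hq, lintegral_const_mul' _ _ ENNReal.ofReal_ne_top]
    refine (mul_le_mul_right (lintegral_enorm_translate_sub_le hf hm hi i h0) _).trans
      (le_of_eq ?_)
    calc ENNReal.ofReal ((n : ℝ) + 1) *
          (2 * ENNReal.ofReal (1 / ((n : ℝ) + 1)) * traceNorm f i)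
        = (ENNReal.ofReal ((n : ℝ) + 1) * ENNReal.ofReal (1 / ((n : ℝ) + 1))) *
          (2 * traceNorm f i) := by ring
      _ = _ := by
          rw [← ENNReal.ofReal_mul (by positivity), mul_one_div_cancel (by positivity),
            ENNReal.ofReal_one, one_mul]
  have hlim : ∀ᵐ x, Filter.Tendsto (fun n => q n x) Filter.atTop
      (nhds ‖lineDeriv ℝ v x (Pi.single i 1)‖ₑ) := by
    filter_upwards [ae_lineDifferentiableAt_toReal hf hlip i] with x hx
    have h1 := hx.hasLineDerivAt.tendsto_slope_zero_left
    have h2 : Filter.Tendsto (fun n : ℕ => -(1 / ((n : ℝ) + 1))) Filter.atTop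
        (nhdsWithin 0 (Set.Iio 0)) := by
      refine tendsto_nhdsWithin_iff.2 ⟨?_, Filter.Eventually.of_forall fun n => ?_⟩
      · simpa using (tendsto_one_div_add_atTop_nhds_zero_nat (𝕜 := ℝ)).neg
      · have : (0 : ℝ) < 1 / ((n : ℝ) + 1) := by positivity
        exact neg_lt_zero.2 this
    refine ((h1.comp h2).enorm).congr fun n => ?_
    simp only [Function.comp_apply, hq, enorm_smul]
    have e1 : (-(1 / ((n : ℝ) + 1))) • (Pi.single i 1 : Fin d → ℝ) =
        Pi.single i (-(1 / ((n : ℝ) + 1))) := by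
      rw [← Pi.single_smul]; simp
    have e2 : ‖(-(1 / ((n : ℝ) + 1)))⁻¹‖ₑ = ENNReal.ofReal ((n : ℝ) + 1) := by
      rw [inv_neg, enorm_neg, one_div, inv_inv, Real.enorm_of_nonneg (by positivity)]
    rw [e1, e2]
  calc ∫⁻ x, ‖lineDeriv ℝ v x (Pi.single i 1)‖ₑ
      = ∫⁻ x, Filter.liminf (fun n => q n x) Filter.atTop := by
        refine lintegral_congr_ae ?_
        filter_upwards [hlim] with x hx using hx.liminf_eq.symm
    _ ≤ Filter.liminf (fun n => ∫⁻ x, q n x) Filter.atTop := lintegral_liminf_le hqm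
    _ ≤ 2 * traceNorm f i := by
        refine (Filter.liminf_le_liminf (Filter.Eventually.of_forall hqle)).trans ?_
        simp

theorem integrable_lineDeriv_toReal (hf : AbsAntitone f) (hm : Measurable f)
    (hi : ∫⁻ x, f x ≠ ⊤)
    (hlip : ∀ ε : ℝ, 0 < ε → ∃ K, LipschitzWith K (clipNear ε fun x => (f x).toReal))
    (i : Fin d) (hT : traceNorm f i ≠ ⊤) :
    Integrable fun x => lineDeriv ℝ (fun x => (f x).toReal) x (Pi.single i 1) :=
  ⟨aestronglyMeasurable_lineDeriv_toReal hf hlip i,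
    (lintegral_enorm_lineDeriv_toReal_le hf hm hi hlip i).trans_lt
      (ENNReal.mul_ne_top ENNReal.ofNat_ne_top hT).lt_top⟩

/-- Integrate by parts the clipped function, which is Lipschitz on the whole space, against a cutoff
of `φ`, and let `ε` tend to `0`. No boundary term appears at `x i = 0`, because clipping makes the
function constant in `x i` near that hyperplane instead of cutting it off. -/
theorem integral_toReal_mul_fderiv_eq (hf : AbsAntitone f) (hm : Measurable f)
    (hi : ∫⁻ x, f x ≠ ⊤)
    (hlip : ∀ ε : ℝ, 0 < ε → ∃ K, LipschitzWith K (clipNear ε fun x => (f x).toReal))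
    (i : Fin d) (hT : traceNorm f i ≠ ⊤) {φ : (Fin d → ℝ) → ℝ}
    (hφ : ContDiff ℝ 1 φ) (hc : HasCompactSupport φ) :
    ∫ x, (f x).toReal * fderiv ℝ φ x (Pi.single i 1) =
      -∫ x, lineDeriv ℝ (fun x => (f x).toReal) x (Pi.single i 1) * φ x := by
  set v : (Fin d → ℝ) → ℝ := fun x => (f x).toReal with hvdef
  set e : Fin d → ℝ := Pi.single i 1 with he
  have hv : Integrable v := integrable_toReal_of_lintegral_ne_top hm hi
  have hG : Integrable fun x => lineDeriv ℝ v x e := integrable_lineDeriv_toReal hf hm hi hlip i hT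
  set ε : ℕ → ℝ := fun n => 1 / ((n : ℝ) + 1) with hε
  have hε0 : ∀ n, 0 < ε n := fun n => by simp only [hε]; positivity
  choose χ hχ1 hχ2 hχ3 hχ4 hχ5 using fun n => exists_cutoff i (hε0 n)
  choose K hK using fun n => hlip (ε n) (hε0 n)
  have hφd : Differentiable ℝ φ := hφ.differentiable (by norm_num)
  obtain ⟨Cφ, hCφ⟩ := hφ.lipschitzWith_of_hasCompactSupport hc (by norm_num)
  have hparts : ∀ n, ∫ x, clipNear (ε n) v x * (χ n x * fderiv ℝ φ x e) =
      -∫ x, lineDeriv ℝ (clipNear (ε n) v) x e * (χ n x * φ x) := by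
    intro n
    have hg : ContDiff ℝ 1 fun x => χ n x * φ x := (hχ1 n).mul hφ
    have hgc : HasCompactSupport fun x => χ n x * φ x := hc.mul_left
    obtain ⟨D, hD⟩ := hg.lipschitzWith_of_hasCompactSupport hgc (by norm_num)
    have h := (hK n).integral_lineDeriv_mul_eq (μ := volume) hD hgc e
    rw [h, ← integral_neg]
    refine integral_congr_ae (Filter.Eventually.of_forall fun x => ?_)
    have h1 : lineDeriv ℝ (fun x => χ n x * φ x) x e = χ n x * fderiv ℝ φ x e := by
      rw [← (hφd x).lineDeriv_eq_fderiv]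
      simp only [lineDeriv, he, hχ5]
      exact deriv_const_mul_field _
    simp only [lineDeriv_neg, h1]
    ring
  obtain ⟨Cb, hCb⟩ : ∃ C, ∀ x, ‖φ x‖ ≤ C := hφ.continuous.bounded_above_of_compact_support hc
  have hCd : ∀ x, ‖fderiv ℝ φ x e‖ ≤ Cφ * ‖e‖ := fun x =>
    ((fderiv ℝ φ x).le_opNorm _).trans (by gcongr; exact norm_fderiv_le_of_lipschitz ℝ hCφ)
  have hfd : Continuous fun x => fderiv ℝ φ x e :=
    (hφ.continuous_fderiv (by norm_num)).clm_apply continuous_const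
  have hχb : ∀ n x, ‖χ n x‖ ≤ 1 := fun n x => by
    rw [Real.norm_of_nonneg (hχ2 n x).1]; exact (hχ2 n x).2
  have hlim1 : Filter.Tendsto (fun n => ∫ x, clipNear (ε n) v x * (χ n x * fderiv ℝ φ x e))
      Filter.atTop (nhds (∫ x, v x * fderiv ℝ φ x e)) := by
    refine tendsto_integral_of_dominated_convergence (fun x => ‖v x‖ * (Cφ * ‖e‖)) (fun n => ?_)
      (hv.norm.mul_const _) (fun n => ?_) ?_
    · exact ((hK n).continuous.mul ((hχ1 n).continuous.mul hfd)).aestronglyMeasurable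
    · filter_upwards [ae_forall_ne_zero d] with x hx
      rw [norm_mul, norm_mul]
      have h1 : ‖clipNear (ε n) v x‖ ≤ ‖v x‖ := by
        have hcl : clipNear (ε n) v x = (f fun j => max |x j| (ε n)).toReal := rfl
        rw [hcl, Real.norm_of_nonneg ENNReal.toReal_nonneg]
        change _ ≤ ‖(f x).toReal‖
        rw [Real.norm_of_nonneg ENNReal.toReal_nonneg]
        refine ENNReal.toReal_mono (hf.ne_top_of_lintegral_ne_top hi hx) (hf _ _ fun j => ?_)
        exact (le_max_left _ _).trans (le_abs_self _)
      have h2 : ‖χ n x‖ * ‖fderiv ℝ φ x e‖ ≤ 1 * (Cφ * ‖e‖) := by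
        gcongr
        · exact hχb n x
        · exact hCd x
      rw [one_mul] at h2
      gcongr
    · filter_upwards [ae_forall_ne_zero d] with x hx
      obtain ⟨N, hN⟩ := exists_nat_forall_lt_abs hx 2
      refine tendsto_const_nhds.congr' ?_
      filter_upwards [Filter.eventually_ge_atTop N] with n hn
      have h2 : ∀ j, 2 * ε n < |x j| := hN n hn
      rw [hχ4 n x fun j => (h2 j).le, one_mul]
      congr 1
      refine (clipNear_eq hf fun j => ?_).symm
      linarith [h2 j, hε0 n]
  have hlim2 : Filter.Tendsto
      (fun n => ∫ x, lineDeriv ℝ (clipNear (ε n) v) x e * (χ n x * φ x))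
      Filter.atTop (nhds (∫ x, lineDeriv ℝ v x e * φ x)) := by
    refine tendsto_integral_of_dominated_convergence (fun x => ‖lineDeriv ℝ v x e‖ * Cb)
      (fun n => ?_) (hG.norm.mul_const _) (fun n => ?_) ?_
    · exact (measurable_lineDeriv (hK n).continuous).aestronglyMeasurable.mul
        ((hχ1 n).continuous.mul hφ.continuous).aestronglyMeasurable
    -- Off this null set either the cutoff vanishes, or `|x i| < ε n` and the clipped function is
    -- locally constant in `x i`, or clipping has no effect near `x`. So the line derivative of `v`
    -- dominates in every case.
    · have hne : ∀ᵐ x : Fin d → ℝ, |x i| ≠ ε n := by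
        filter_upwards [Measure.ae_eval_ne (fun _ : Fin d => (volume : Measure ℝ)) i (ε n),
          Measure.ae_eval_ne (fun _ : Fin d => (volume : Measure ℝ)) i (-ε n)] with x h1 h2 h3
        rcases (abs_eq (hε0 n).le).1 h3 with h | h
        · exact h1 h
        · exact h2 h
      filter_upwards [hne] with x hx
      have hb0 : 0 ≤ ‖lineDeriv ℝ v x e‖ * Cb :=
        mul_nonneg (norm_nonneg _) ((norm_nonneg _).trans (hCb x))
      by_cases h1 : ∃ j, j ≠ i ∧ |x j| ≤ ε n
      · rw [hχ3 n x h1]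
        simpa using hb0
      push Not at h1
      rcases lt_or_gt_of_ne hx with h2 | h2
      · rw [lineDeriv_clipNear_eq_zero v i h2]
        simpa using hb0
      · have h3 : ∀ j, ε n < |x j| := by
          intro j
          by_cases hj : j = i
          · rw [hj]; exact h2
          · exact h1 j hj
        rw [(clipNear_eventuallyEq hf h3).lineDeriv_eq, norm_mul, norm_mul]
        have h4 : ‖χ n x‖ * ‖φ x‖ ≤ 1 * Cb := by
          gcongr
          · exact hχb n x
          · exact hCb x
        rw [one_mul] at h4
        gcongr
    · filter_upwards [ae_forall_ne_zero d] with x hx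
      obtain ⟨N, hN⟩ := exists_nat_forall_lt_abs hx 2
      refine tendsto_const_nhds.congr' ?_
      filter_upwards [Filter.eventually_ge_atTop N] with n hn
      have h2 : ∀ j, 2 * ε n < |x j| := hN n hn
      rw [hχ4 n x fun j => (h2 j).le, one_mul]
      congr 1
      refine (clipNear_eventuallyEq hf fun j => ?_).lineDeriv_eq.symm
      linarith [h2 j, hε0 n]
  simp only [hparts] at hlim1
  exact tendsto_nhds_unique hlim1 hlim2.neg

/-- The gradient made of the line derivatives in the coordinate directions. -/
noncomputable def lineGradient (u : (Fin d → ℝ) → ℝ) (x : Fin d → ℝ) : EuclideanSpace ℝ (Fin d) :=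
  ∑ i, lineDeriv ℝ u x (Pi.single i 1) • EuclideanSpace.single i (1 : ℝ)

theorem lineGradient_apply (u : (Fin d → ℝ) → ℝ) (x : Fin d → ℝ) (i : Fin d) :
    lineGradient u x i = lineDeriv ℝ u x (Pi.single i 1) := by
  simp [lineGradient, Pi.single_apply]

theorem hasWeakGradient_lineGradient (hf : AbsAntitone f) (hm : Measurable f)
    (hi : ∫⁻ x, f x ≠ ⊤)
    (hlip : ∀ ε : ℝ, 0 < ε → ∃ K, LipschitzWith K (clipNear ε fun x => (f x).toReal))
    (hT : ∀ i, traceNorm f i ≠ ⊤) :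
    HasWeakGradient (fun x => (f x).toReal) (lineGradient fun x => (f x).toReal) ∧
      Integrable (lineGradient fun x => (f x).toReal) ∧
      ∫⁻ x, ‖lineGradient (fun x => (f x).toReal) x‖ₑ ≤ 2 * ∑ i, traceNorm f i := by
  have hG : Integrable (lineGradient fun x => (f x).toReal) :=
    integrable_finsetSum _ fun i _ =>
      (integrable_lineDeriv_toReal hf hm hi hlip i (hT i)).smul_const _
  refine ⟨⟨(integrable_toReal_of_lintegral_ne_top hm hi).locallyIntegrable,
    hG.locallyIntegrable, fun i φ hφ hc => ?_⟩, hG, ?_⟩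
  · simp only [lineGradient_apply]
    exact integral_toReal_mul_fderiv_eq hf hm hi hlip i (hT i) (hφ.of_le (by norm_num)) hc
  · calc ∫⁻ x, ‖lineGradient (fun x => (f x).toReal) x‖ₑ
        ≤ ∫⁻ x, ∑ i, ‖lineDeriv ℝ (fun x => (f x).toReal) x (Pi.single i 1)‖ₑ := by
          refine lintegral_mono fun x => (enorm_sum_le _ _).trans
            (Finset.sum_le_sum fun i _ => ?_)
          rw [enorm_smul]
          refine mul_le_of_le_one_right zero_le ?_
          rw [← ofReal_norm, PiLp.norm_single, norm_one, ENNReal.ofReal_one]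
      _ = ∑ i, ∫⁻ x, ‖lineDeriv ℝ (fun x => (f x).toReal) x (Pi.single i 1)‖ₑ :=
          lintegral_finsetSum' _ fun i _ =>
            (aestronglyMeasurable_lineDeriv_toReal hf hlip i).enorm
      _ ≤ _ := by
          rw [Finset.mul_sum]
          exact Finset.sum_le_sum fun i _ => lintegral_enorm_lineDeriv_toReal_le hf hm hi hlip i

end WeakGradient

theorem corollary2p12 (d : ℕ) (hd : 2 ≤ d) :
    (∀ μ : Seminorm ℝ (Fin d → ℝ), IsNormOn μ → IsUnconditional (fun x => μ x) →
      ∃ c : ℝ, 0 < c ∧ ∀ R : ℝ, 0 < R → ∀ f : (Fin d → ℝ) → ENNReal, MemBD f →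
        MemBV (localMaximal R μ f) ∧
        bvNorm (localMaximal R μ f) ≤
          ENNReal.ofReal c * (bvNorm f + l1Norm f * ENNReal.ofReal (Real.posLog R))) ∧
    (∃ c : ℝ, 0 < c ∧ ∀ R : ℝ, 0 < R → ∀ f : (Fin d → ℝ) → ENNReal, MemBD f →
        MemL1 (localMaximal R (ellInfty d) f) ∧
        ∃ G : (Fin d → ℝ) → EuclideanSpace ℝ (Fin d),
          HasWeakGradient (fun x => (localMaximal R (ellInfty d) f x).toReal) G ∧
          Integrable G ∧
          l1Norm (localMaximal R (ellInfty d) f) + ∫⁻ x, ‖G x‖ₑ ≤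
            ENNReal.ofReal c * (bvNorm f + l1Norm f * ENNReal.ofReal (Real.posLog R))) := by
  refine ⟨fun μ hμ hu => exists_bvNorm_localMaximal_le (by omega) hμ hu, ?_⟩
  obtain ⟨C, hC, hbound⟩ := exists_lintegral_add_traceNorm_localMaximal_le d
  obtain ⟨c, hc0, hc⟩ := exists_pos_le_ofReal hC
  refine ⟨c, hc0, fun R hR f hf => ?_⟩
  obtain ⟨g, hg, hgm, hae, hgi⟩ := hf.exists_measurable_rep
  have hfin := hf.bound_ne_top R
  have hvar : variation (fun x => (g x).toReal) ≠ ⊤ :=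
    (variation_congr_ae (hae.fun_comp ENNReal.toReal)).trans_ne hf.2.2.ne
  rw [← localMaximal_congr_ae hae]
  rw [← bvNorm_congr_ae hae, ← l1Norm_congr_ae hae] at hfin ⊢
  set M := localMaximal R (ellInfty d) g with hM
  have hMa : AbsAntitone M := absAntitone_localMaximal (isUnconditional_ellInfty d) hg R
  have hMm : Measurable M := measurable_localMaximal (ellInfty d) R g
  have hmain : (∫⁻ x, M x) + 2 * ∑ i, traceNorm M i ≤
      ENNReal.ofReal c * (bvNorm g + l1Norm g * ENNReal.ofReal (Real.posLog R)) :=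
    (hbound R hR g hg hgm hgi).trans (by gcongr)
  have htop : ENNReal.ofReal c * (bvNorm g + l1Norm g * ENNReal.ofReal (Real.posLog R)) < ⊤ :=
    (ENNReal.mul_ne_top ENNReal.ofReal_ne_top hfin).lt_top
  have hMi : ∫⁻ x, M x < ⊤ := (le_self_add.trans hmain).trans_lt htop
  have hgT : ∀ i, traceNorm g i ≠ ⊤ := fun i =>
    ne_top_of_le_ne_top (ENNReal.mul_ne_top ENNReal.ofReal_ne_top hvar)
      (traceNorm_le_variation hg hgm hgi i)
  have hMT : ∀ i, traceNorm M i ≠ ⊤ := fun i => by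
    have hsum : 2 * ∑ i, traceNorm M i ≠ ⊤ := ((le_add_self.trans hmain).trans_lt htop).ne
    refine ne_top_of_le_ne_top hsum ?_
    exact (Finset.single_le_sum (f := fun i => traceNorm M i) (fun _ _ => zero_le)
      (Finset.mem_univ i)).trans (le_mul_of_one_le_left zero_le one_le_two)
  have hlip : ∀ ε : ℝ, 0 < ε → ∃ K, LipschitzWith K (clipNear ε fun x => (M x).toReal) :=
    fun ε hε => exists_lipschitzWith_clipNear hg hgm hgT hR hε hMi.ne
  obtain ⟨hG, hGi, hGn⟩ := hasWeakGradient_lineGradient hMa hMm hMi.ne hlip hMT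
  exact ⟨⟨hMm.aemeasurable, hMi⟩, _, hG, hGi, (add_le_add_right hGn _).trans hmain⟩
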